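/- For each number $n$ of qubits, let $\mathcal G_n=\{\frac1n\sum_jX_j,\ \frac1n\sum_jY_j,\ \frac2{n(n-1)}\sum_{k<j}Z_jZ_k\}$ and $\mathcal M_n=\{\frac1n\sum_jX_j,\ \frac2{n(n-1)}\sum_{k<j}X_jX_k,\ \prod_jX_j\}$, where $X_j,Y_j,Z_j$ are the Pauli operators on qubit $j$; all these operators commute with the permutations of the qubits ($S_n$-equivariance). Let $U(\boldsymbol\theta)=e^{-i\theta_LH_L}\cdots e^{-i\theta_1H_1}$ with $H_l\in\mathcal G_n$ be an $S_n$-equivariant quantum neural network of depth $L=L(n)$, let $O\in\mathcal M_n$, and let $\hat{\mathcal L}(\boldsymbol\theta)=\sum_{i=1}^Mc_i\operatorname{Tr}[U(\boldsymbol\theta)\rho_iU(\boldsymbol\theta)^\dagger O]$ be the empirical loss of a dataset of $n$-qubit states $\rho_i$ with real weights $c_i$; put $\sigma=\sum_ic_i\rho_i$. (All these data may depend on $n$.) Write $(\mathbb C^2)^{\otimes n}=\bigoplus_\lambda\bigoplus_{\nu=1}^{m_\lambda}\mathcal H_\lambda^\nu$ for the decomposition of the space under the operators commuting with $S_n$,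 where $\lambda=(n-m,m)$, $0\le m\le\lfloor n/2\rfloor$, and $\mathcal H_\lambda^\nu$ has dimension $d_\lambda=n-2m+1$ (spin $\frac{n-2m}2$). In an adapted orthonormal basis every $S_n$-equivariant operator $A$ is $\bigoplus_\lambda \mathbf 1_{m_\lambda}\otimes A_\lambda$. For any operator $B$ let $B_\lambda^\nu$ be the $d_\lambda\times d_\lambda$ matrix of its compression to $\mathcal H_\lambda^\nu$ in that basis, and for a square matrix $B$ let $\Delta(B)=\operatorname{Tr}[B^2]-\operatorname{Tr}[B]^2/\dim(B)$. Let $\boldsymbol\theta$ be random, let $\theta_\mu$ be one of the parameters, and assume that $U_A=e^{-i\theta_LH_L}\cdots e^{-i\theta_{\mu+1}H_{\mu+1}}$ and $U_B=e^{-i\theta_\mu H_\mu}\cdots e^{-i\theta_1H_1}$ form independent 2-designs on the isotypic blocks: for all sufficiently large $n$, all joint moments of second order in $\bigoplus_\lambda (U_A)_\lambda\otimes\overline{(U_A)_\lambda}$ and of second order in $\bigoplus_\lambda (U_B)_\lambda\otimes\overline{(U_B)_\lambda}$ are those obtained when all the blocks $(U_A)_\lambda,(U_B)_\lambda$ are independent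 and Haar distributed on $\mathbb U(d_\lambda)$. Suppose that for some choice of $\lambda=\lambda(n)$, with $d_{\lambda}\ge3$ for all large $n$ for which $H_\mu=\frac2{n(n-1)}\sum_{k<j}Z_jZ_k$ or $O=\frac2{n(n-1)}\sum_{k<j}X_jX_k$, one has $$\Delta\Big(\sum_{\nu=1}^{m_\lambda}\sigma_\lambda^\nu\Big)\in\Omega\left(\frac1{\operatorname{poly}(n)}\right).$$ Then $$\operatorname{Var}_{\boldsymbol\theta}\big[\partial_\mu\hat{\mathcal L}(\boldsymbol\theta)\big]\in\Omega\left(\frac1{\operatorname{poly}(n)}\right).$$ In particular there is no barren plateau in the direction $\theta_\mu$, that is, it is not the case that $\mathbb E_{\boldsymbol\theta}[\partial_\mu\hat{\mathcal L}]=0$ for all large $n$ and $\operatorname{Var}_{\boldsymbol\theta}[\partial_\mu\hat{\mathcal L}]\in O(b^{-n})$ for some $b>1$. Here $f\in\Omega(1/\operatorname{poly}(n))$ means that there are $C>0$ and $k\in\mathbb N$ with $f(n)\ge C/n^k$ for all large $n$. -/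

import Mathlib

namespace SnEquivariant

open MeasureTheory ProbabilityTheory Filter Matrix
open scoped ComplexOrder Asymptotics

noncomputable section

/-! ### Qubits, Pauli operators, and the qubit-permuting representation -/

/-- Labels of the computational basis of `n` qubits. -/
abbrev Config (n : ℕ) : Type := Fin n → Fin 2

/-- Operators on `n` qubits, written in the computational basis. -/
abbrev Op (n : ℕ) : Type := Matrix (Config n) (Config n) ℂ

def pauliX : Matrix (Fin 2) (Fin 2) ℂ := !![0, 1; 1, 0]
def pauliY : Matrix (Fin 2) (Fin 2) ℂ := !![0, -Complex.I; Complex.I, 0]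
def pauliZ : Matrix (Fin 2) (Fin 2) ℂ := !![1, 0; 0, -1]
/-- The one-qubit raising operator `|0⟩⟨1|`. -/
def sigmaPlus : Matrix (Fin 2) (Fin 2) ℂ := !![0, 1; 0, 0]
/-- The one-qubit lowering operator `|1⟩⟨0|`. -/
def sigmaMinus : Matrix (Fin 2) (Fin 2) ℂ := !![0, 0; 1, 0]

/-- The one-qubit operator `A` acting on qubit `j`, tensored with the identity elsewhere. -/
def onSite {n : ℕ} (A : Matrix (Fin 2) (Fin 2) ℂ) (j : Fin n) : Op n :=
  Matrix.of fun x y => if ∀ k, k ≠ j → x k = y k then A (x j) (y j) else 0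

/-- `∑_j A_j`. -/
def collective (n : ℕ) (A : Matrix (Fin 2) (Fin 2) ℂ) : Op n := ∑ j : Fin n, onSite A j

/-- `∑_{k<j} A_j A_k`. -/
def pairSum (n : ℕ) (A : Matrix (Fin 2) (Fin 2) ℂ) : Op n :=
  ∑ j : Fin n, ∑ k ∈ Finset.univ.filter (fun k => k < j), onSite A j * onSite A k

/-- `∏_j A_j`, that is, the tensor power of `A` over all qubits. -/
def tensorPower (n : ℕ) (A : Matrix (Fin 2) (Fin 2) ℂ) : Op n :=
  Matrix.of fun x y => ∏ j, A (x j) (y j)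

/-- The normalized one-body operator `(1/n) ∑_j A_j`. -/
def oneBody (n : ℕ) (A : Matrix (Fin 2) (Fin 2) ℂ) : Op n := (1 / (n : ℂ)) • collective n A

/-- The normalized two-body operator `(2/(n(n-1))) ∑_{k<j} A_j A_k`. -/
def twoBody (n : ℕ) (A : Matrix (Fin 2) (Fin 2) ℂ) : Op n :=
  (2 / ((n : ℂ) * ((n : ℂ) - 1))) • pairSum n A

/-- The set of generators `𝒢`. -/
def generatorSet (n : ℕ) : Set (Op n) := {oneBody n pauliX, oneBody n pauliY, twoBody n pauliZ}

/-- The set of measurement operators `ℳ`. -/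
def measurementSet (n : ℕ) : Set (Op n) :=
  {oneBody n pauliX, twoBody n pauliX, tensorPower n pauliX}

/-- The representation of `S_n` permuting the qubits: `R(π)|y⟩ = |y ∘ π⁻¹⟩`. -/
def permRep {n : ℕ} (π : Equiv.Perm (Fin n)) : Op n :=
  Matrix.of fun x y => if x = y ∘ ⇑π⁻¹ then 1 else 0

/-- An operator is `S_n`-equivariant if it commutes with every `R(π)`. -/
def IsEquivariant {n : ℕ} (B : Op n) : Prop :=
  ∀ π : Equiv.Perm (Fin n), B * permRep π = permRep π * B

theorem comp_inv_comp {n : ℕ} (x : Config n) (π : Equiv.Perm (Fin n)) :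
    (x ∘ ⇑π⁻¹) ∘ ⇑π = x := by
  funext k; simp

theorem comp_comp_inv {n : ℕ} (x : Config n) (π : Equiv.Perm (Fin n)) :
    (x ∘ ⇑π) ∘ ⇑π⁻¹ = x := by
  funext k; simp

theorem isEquivariant_iff {n : ℕ} (B : Op n) :
    IsEquivariant B ↔ ∀ π : Equiv.Perm (Fin n), ∀ x y, B (x ∘ π) (y ∘ π) = B x y := by
  have h1 : ∀ (π : Equiv.Perm (Fin n)) x y, (B * permRep π) x y = B x (y ∘ ⇑π⁻¹) := by
    intro π x y
    simp [Matrix.mul_apply, permRep]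
  have h2 : ∀ (π : Equiv.Perm (Fin n)) x y, (permRep π * B) x y = B (x ∘ π) y := by
    intro π x y
    rw [Matrix.mul_apply, Finset.sum_eq_single (x ∘ π)]
    · simp only [permRep, Matrix.of_apply, comp_comp_inv, if_true, one_mul]
    · intro z _ hz
      have : x ≠ z ∘ ⇑π⁻¹ := by
        rintro rfl
        exact hz (comp_inv_comp z π).symm
      simp only [permRep, Matrix.of_apply, this, if_false, zero_mul]
    · simp
  constructor
  · intro h π x y
    have := congrFun (congrFun (h π) x) (y ∘ π)
    rw [h1, h2, comp_comp_inv] at this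
    exact this.symm
  · intro h π
    ext x y
    rw [h1, h2, ← h π x (y ∘ ⇑π⁻¹), comp_inv_comp]

theorem IsEquivariant.smul {n : ℕ} {B : Op n} (h : IsEquivariant B) (c : ℂ) :
    IsEquivariant (c • B) := fun π => by
  rw [Matrix.smul_mul, Matrix.mul_smul, h π]

theorem onSite_comp {n : ℕ} (A : Matrix (Fin 2) (Fin 2) ℂ) (j : Fin n)
    (π : Equiv.Perm (Fin n)) (x y : Config n) :
    onSite A j (x ∘ π) (y ∘ π) = onSite A (π j) x y := by
  have : (∀ k, k ≠ j → x (π k) = y (π k)) ↔ ∀ k, k ≠ π j → x k = y k := by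
    constructor
    · intro h k hk
      have := h (π⁻¹ k) (by rintro rfl; exact hk (by simp))
      simpa using this
    · intro h k hk
      exact h _ (by simpa using hk)
  simp [onSite, this]

theorem isEquivariant_collective (n : ℕ) (A : Matrix (Fin 2) (Fin 2) ℂ) :
    IsEquivariant (collective n A) := by
  rw [isEquivariant_iff]
  intro π x y
  simp only [collective, Matrix.sum_apply, onSite_comp]
  exact Equiv.sum_comp π fun j => onSite A j x y

theorem onSite_mul_comm {n : ℕ} (A : Matrix (Fin 2) (Fin 2) ℂ) {j k : Fin n} (hjk : j ≠ k) :
    onSite A j * onSite A k = onSite A k * onSite A j := by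
  have key : ∀ {j k : Fin n}, j ≠ k → ∀ x y, (onSite A j * onSite A k) x y =
      if ∀ l, l ≠ j → l ≠ k → x l = y l then A (x j) (y j) * A (x k) (y k) else 0 := by
    intro j k hjk x y
    rw [Matrix.mul_apply, Finset.sum_eq_single (Function.update x j (y j))]
    · have e1 : ∀ l, l ≠ j → x l = Function.update x j (y j) l := by
        intro l hl; rw [Function.update_of_ne hl]
      have e2 : (∀ l, l ≠ k → Function.update x j (y j) l = y l) ↔
          ∀ l, l ≠ j → l ≠ k → x l = y l := by
        constructor
        · intro h l hj hk
          have := h l hk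
          rwa [Function.update_of_ne hj] at this
        · intro h l hk
          by_cases hj : l = j
          · subst hj; simp
          · rw [Function.update_of_ne hj]; exact h l hj hk
      simp only [onSite, Matrix.of_apply, if_pos e1, e2, Function.update_self,
        Function.update_of_ne hjk.symm, mul_ite, mul_zero]
    · intro z _ hz
      by_cases h1 : ∀ l, l ≠ j → x l = z l
      · have h2 : ¬ ∀ l, l ≠ k → z l = y l := by
          intro h2
          apply hz
          funext l
          by_cases hl : l = j
          · subst hl; simpa using h2 l hjk
          · rw [Function.update_of_ne hl]; exact (h1 l hl).symm
        simp only [onSite, Matrix.of_apply, if_neg h2, mul_zero]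
      · simp only [onSite, Matrix.of_apply, if_neg h1, zero_mul]
    · simp
  ext x y
  rw [key hjk, key hjk.symm, mul_comm]
  have : (∀ l, l ≠ j → l ≠ k → x l = y l) ↔ ∀ l, l ≠ k → l ≠ j → x l = y l :=
    ⟨fun h l a b => h l b a, fun h l a b => h l b a⟩
  simp only [this]

theorem two_smul_pairSum (n : ℕ) (A : Matrix (Fin 2) (Fin 2) ℂ) :
    (2 : ℂ) • pairSum n A = ∑ j : Fin n, ∑ k ∈ Finset.univ.filter (fun k => k ≠ j),
      onSite A j * onSite A k := by
  have hswap : pairSum n A = ∑ j : Fin n, ∑ k ∈ Finset.univ.filter (fun k => j < k),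
      onSite A j * onSite A k := by
    unfold pairSum
    simp only [Finset.sum_filter]
    rw [Finset.sum_comm]
    refine Finset.sum_congr rfl fun j _ => Finset.sum_congr rfl fun k _ => ?_
    split_ifs with h
    · exact onSite_mul_comm A h.ne'
    · rfl
  rw [two_smul]
  conv_lhs => arg 2; rw [hswap]
  unfold pairSum
  rw [← Finset.sum_add_distrib]
  refine Finset.sum_congr rfl fun j _ => ?_
  simp only [Finset.sum_filter, ← Finset.sum_add_distrib]
  refine Finset.sum_congr rfl fun k _ => ?_
  rcases lt_trichotomy k j with h | h | h
  · simp [h, h.ne, h.not_gt]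
  · simp [h]
  · simp [h, h.ne', h.not_gt]

theorem isEquivariant_pairSum (n : ℕ) (A : Matrix (Fin 2) (Fin 2) ℂ) :
    IsEquivariant (pairSum n A) := by
  have h2 : IsEquivariant ((2 : ℂ) • pairSum n A) := by
    rw [two_smul_pairSum, isEquivariant_iff]
    intro π x y
    have hmul : ∀ j k, (onSite A j * onSite A k) (x ∘ π) (y ∘ π) =
        (onSite A (π j) * onSite A (π k)) x y := by
      intro j k
      simp only [Matrix.mul_apply, ← onSite_comp A _ π]
      exact (Equiv.sum_comp (Equiv.arrowCongr π.symm (Equiv.refl (Fin 2)))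
        fun z => onSite A j (x ∘ π) z * onSite A k z (y ∘ π)).symm
    simp only [Finset.sum_filter, Matrix.sum_apply]
    have : ∀ j k : Fin n, (if k ≠ j then onSite A j * onSite A k else 0) (x ∘ π) (y ∘ π) =
        (if π k ≠ π j then onSite A (π j) * onSite A (π k) else 0) x y := by
      intro j k
      by_cases h : k = j
      · simp [h]
      · simp [h, hmul]
    simp only [this]
    rw [Equiv.sum_comp π fun j => ∑ k, (if π k ≠ j then onSite A j * onSite A (π k) else 0) x y]
    exact Finset.sum_congr rfl fun j _ =>
      Equiv.sum_comp π fun k => (if k ≠ j then onSite A j * onSite A k else 0) x y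
  simpa [smul_smul] using h2.smul (2⁻¹ : ℂ)

theorem isEquivariant_tensorPower (n : ℕ) (A : Matrix (Fin 2) (Fin 2) ℂ) :
    IsEquivariant (tensorPower n A) := by
  rw [isEquivariant_iff]
  intro π x y
  exact Equiv.prod_comp π fun j => A (x j) (y j)

/-- Every generator in `𝒢` is `S_n`-equivariant. -/
theorem isEquivariant_of_mem_generatorSet {n : ℕ} {H : Op n} (h : H ∈ generatorSet n) :
    IsEquivariant H := by
  rcases h with rfl | rfl | rfl
  · exact (isEquivariant_collective n _).smul _
  · exact (isEquivariant_collective n _).smul _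
  · exact (isEquivariant_pairSum n _).smul _

/-- Every measurement operator in `ℳ` is `S_n`-equivariant. -/
theorem isEquivariant_of_mem_measurementSet {n : ℕ} {O : Op n} (h : O ∈ measurementSet n) :
    IsEquivariant O := by
  rcases h with rfl | rfl | rfl
  · exact (isEquivariant_collective n _).smul _
  · exact (isEquivariant_pairSum n _).smul _
  · exact isEquivariant_tensorPower n _

/-! ### The decomposition `ℋ = ⨁_λ ⨁_ν ℋ_λ^ν`

By Schur–Weyl duality the isotypic component of the irrep `λ = (n-m, m)` of `S_n` is the
component of total spin `(n-2m)/2`.  Its multiplicity space (the irrep of `S_n`, of dimension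
`m_λ`) is the space of highest-weight vectors of weight `n - 2m`, and the invariant subspace
`ℋ_λ^ν`, of dimension `d_λ = n - 2m + 1`, is obtained by applying powers of the collective
lowering operator to the `ν`-th vector of an orthonormal basis of that space. -/

/-- The two-row Young diagrams `λ = (n-m, m)`, labelled by `m = 0, …, ⌊n/2⌋`. -/
abbrev Label (n : ℕ) : Type := Fin (n / 2 + 1)

/-- `d_λ = n - 2m + 1` (the subtraction never truncates, since `m ≤ n/2`). -/
abbrev blockDim {n : ℕ} (m : Label n) : ℕ := n - 2 * (m : ℕ) + 1

/-- Square matrices of size `d_λ`. -/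
abbrev BlockOp {n : ℕ} (m : Label n) : Type :=
  Matrix (Fin (blockDim m)) (Fin (blockDim m)) ℂ

/-- The highest-weight vectors of weight `n - 2m`: those killed by `∑_j σ⁺_j` and fixed up to the
factor `n - 2m` by `∑_j Z_j`. -/
def highestWeightSpace {n : ℕ} (m : Label n) : Submodule ℂ (EuclideanSpace ℂ (Config n)) :=
  LinearMap.ker (Matrix.toEuclideanLin (collective n sigmaPlus)) ⊓
    Module.End.eigenspace (Matrix.toEuclideanLin (collective n pauliZ)) ((n : ℂ) - 2 * (m : ℕ))

/-- The multiplicity `m_λ`. -/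
def multiplicity {n : ℕ} (m : Label n) : ℕ := Module.finrank ℂ (highestWeightSpace m)

/-- A choice, for every `λ`, of an orthonormal basis of the multiplicity space. -/
abbrev MultiplicityBasis (n : ℕ) : Type :=
  ∀ m : Label n, OrthonormalBasis (Fin (multiplicity m)) ℂ (highestWeightSpace m)

/-- The `k`-th vector of the orthonormal basis of `ℋ_λ^ν`, namely
`√((d_λ-1-k)! / (k! (d_λ-1)!)) (∑_j σ⁻_j)^k w_ν`. -/
def blockVector {n : ℕ} (w : MultiplicityBasis n) (m : Label n) (ν : Fin (multiplicity m))
    (k : Fin (blockDim m)) : Config n → ℂ :=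
  ((Real.sqrt (((n - 2 * (m : ℕ) - (k : ℕ)).factorial : ℝ) /
      ((k : ℕ).factorial * (n - 2 * (m : ℕ)).factorial)) : ℝ) : ℂ) •
    ((collective n sigmaMinus) ^ (k : ℕ) *ᵥ
      (fun x => (w m ν : EuclideanSpace ℂ (Config n)) x))

/-- `Q_λ^ν`, the `d_λ × 2^n` matrix such that the columns of `(Q_λ^ν)†` are the basis vectors of
`ℋ_λ^ν`. -/
def blockMap {n : ℕ} (w : MultiplicityBasis n) (m : Label n) (ν : Fin (multiplicity m)) :
    Matrix (Fin (blockDim m)) (Config n) ℂ :=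
  Matrix.of fun k x => star (blockVector w m ν k x)

/-- The restriction `B_λ^ν = Q_λ^ν B (Q_λ^ν)†`. -/
def restrict {n : ℕ} (w : MultiplicityBasis n) (m : Label n) (ν : Fin (multiplicity m))
    (B : Op n) : BlockOp m :=
  blockMap w m ν * B * (blockMap w m ν)ᴴ

/-- `Δ(B) = Tr[B²] - Tr[B]²/dim(B)`, a real number for Hermitian `B`. -/
def Delta {d : ℕ} (B : Matrix (Fin d) (Fin d) ℂ) : ℝ :=
  ((B * B).trace - B.trace ^ 2 / (d : ℂ)).re

/-! ### Quantum neural networks, datasets, and the empirical loss -/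

/-- A layered quantum neural network on `n` qubits with generators in `𝒢`. -/
structure QNN (n : ℕ) where
  /-- the depth `L` -/
  depth : ℕ
  /-- the generators `H_l` of the layers -/
  gen : Fin depth → Op n
  gen_mem : ∀ l, gen l ∈ generatorSet n

/-- The layer `e^{-i θ_l H_l}`. -/
def QNN.layer {n : ℕ} (V : QNN n) (θ : Fin V.depth → ℝ) (l : Fin V.depth) : Op n :=
  NormedSpace.exp ((-(Complex.I * (θ l : ℂ))) • V.gen l)

/-- The product of the layers whose index satisfies `p`, later layers standing to the left. -/
def QNN.layersProd {n : ℕ} (V : QNN n) (p : Fin V.depth → Bool) (θ : Fin V.depth → ℝ) : Op n :=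
  (((List.finRange V.depth).filter p).reverse.map (V.layer θ)).prod

/-- `U(θ) = e^{-i θ_L H_L} ⋯ e^{-i θ_1 H_1}`. -/
def QNN.unitary {n : ℕ} (V : QNN n) (θ : Fin V.depth → ℝ) : Op n :=
  V.layersProd (fun _ => true) θ

/-- `U_B`: the layers up to and including layer `μ`. -/
def QNN.before {n : ℕ} (V : QNN n) (μ : Fin V.depth) (θ : Fin V.depth → ℝ) : Op n :=
  V.layersProd (fun l => decide (l ≤ μ)) θ

/-- `U_A`: the layers after layer `μ`, so that `U = U_A U_B`. -/
def QNN.after {n : ℕ} (V : QNN n) (μ : Fin V.depth) (θ : Fin V.depth → ℝ) : Op n :=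
  V.layersProd (fun l => decide (μ < l)) θ

/-- A finite family of `n`-qubit states `ρ_i` with real weights `c_i`. -/
structure Dataset (n : ℕ) where
  size : ℕ
  weight : Fin size → ℝ
  state : Fin size → Op n
  posSemidef : ∀ i, (state i).PosSemidef
  trace_eq_one : ∀ i, (state i).trace = 1

/-- `σ = ∑_i c_i ρ_i`. -/
def Dataset.average {n : ℕ} (S : Dataset n) : Op n := ∑ i, (S.weight i : ℂ) • S.state i

/-- `ℓ_θ(ρ) = Tr[U(θ) ρ U(θ)† O]` (a real number for Hermitian `ρ` and `O`). -/
def loss {n : ℕ} (V : QNN n) (O : Op n) (ρ : Op n) (θ : Fin V.depth → ℝ) : ℝ :=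
  ((V.unitary θ * ρ * (V.unitary θ)ᴴ * O).trace).re

/-- The empirical loss `ℒ(θ) = ∑_i c_i ℓ_θ(ρ_i)`. -/
def empiricalLoss {n : ℕ} (V : QNN n) (O : Op n) (S : Dataset n) (θ : Fin V.depth → ℝ) : ℝ :=
  ∑ i, S.weight i * loss V O (S.state i) θ

/-- The partial derivative `∂ℒ/∂θ_μ` of the empirical loss. -/
def partialLoss {n : ℕ} (V : QNN n) (O : Op n) (S : Dataset n) (μ : Fin V.depth)
    (θ : Fin V.depth → ℝ) : ℝ :=
  deriv (fun t : ℝ => empiricalLoss V O S (Function.update θ μ t)) (θ μ)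

/-! ### Haar measure and independent 2-designs on the isotypic blocks -/

instance unitaryMeasurableSpace (d : ℕ) : MeasurableSpace (unitaryGroup (Fin d) ℂ) := borel _

instance unitaryBorelSpace (d : ℕ) : BorelSpace (unitaryGroup (Fin d) ℂ) := ⟨rfl⟩

instance unitaryCompactSpace (d : ℕ) : CompactSpace (unitaryGroup (Fin d) ℂ) := by
  refine isCompact_iff_compactSpace.mp (?_ : IsCompact
    (unitaryGroup (Fin d) ℂ : Set (Matrix (Fin d) (Fin d) ℂ)))
  have hK : IsCompact (Set.univ.pi fun _ : Fin d => Set.univ.pi fun _ : Fin d =>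
      Metric.closedBall (0 : ℂ) 1) :=
    isCompact_univ_pi fun _ => isCompact_univ_pi fun _ => isCompact_closedBall _ _
  refine IsCompact.of_isClosed_subset hK ?_ ?_
  · have h : (unitaryGroup (Fin d) ℂ : Set (Matrix (Fin d) (Fin d) ℂ)) =
        {U | star U * U = 1} ∩ {U | U * star U = 1} := by
      ext U
      exact Iff.rfl
    rw [h]
    exact (isClosed_eq (by fun_prop) continuous_const).inter
      (isClosed_eq (by fun_prop) continuous_const)
  · intro U hU
    exact fun i _ j _ => mem_closedBall_zero_iff.mpr (entry_norm_bound_of_unitary hU i j)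

/-- The Haar probability measure on the unitary group `𝕌(d)`. -/
def haarUnitary (d : ℕ) : Measure (unitaryGroup (Fin d) ℂ) := Measure.haarMeasure ⊤

/-- The product over all `λ` of the Haar probability measures on `𝕌(d_λ)`. -/
def blockHaar (n : ℕ) : Measure (∀ m : Label n, unitaryGroup (Fin (blockDim m)) ℂ) :=
  Measure.pi fun m => haarUnitary (blockDim m)

/-- Indices of the entries of `⨁_λ U_λ ⊗ conj U_λ`. -/
abbrev EntryIndex (n : ℕ) : Type :=
  Σ m : Label n, (Fin (blockDim m) × Fin (blockDim m)) × (Fin (blockDim m) × Fin (blockDim m))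

/-- The entry `(U_λ)_{ij} conj((U_λ)_{kl})` of `U_λ ⊗ conj U_λ`. -/
def adEntry {n : ℕ} (U : ∀ m : Label n, BlockOp m) (a : EntryIndex n) : ℂ :=
  U a.1 a.2.1.1 a.2.1.2 * star (U a.1 a.2.2.1 a.2.2.2)

/-- Second moments of the Haar measure on `∏_λ 𝕌(d_λ)`. -/
def haarMoment {n : ℕ} (a a' : EntryIndex n) : ℂ :=
  ∫ U, adEntry (fun m => (U m : BlockOp m)) a * adEntry (fun m => (U m : BlockOp m)) a'
    ∂(blockHaar n)

/-- The random block-diagonal unitaries `A = ⨁_λ A_λ` and `B = ⨁_λ B_λ` form independent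
2-designs in the blocks: all moments of order two in `U_λ ⊗ conj U_λ`, of `A` and of `B` jointly,
are those of `A` and `B` independent with all blocks independent and Haar distributed on
`𝕌(d_λ)`.  (For two entries in one block these are all the moments of degree `(2,2)` of that
block.) -/
def IndependentTwoDesigns {n : ℕ} {Θ : Type*} [MeasurableSpace Θ] (P : Measure Θ)
    (A B : Θ → ∀ m : Label n, BlockOp m) : Prop :=
  ∀ a a' b b' : EntryIndex n,
    ∫ θ, adEntry (A θ) a * adEntry (A θ) a' * (adEntry (B θ) b * adEntry (B θ) b') ∂P =
      haarMoment a a' * haarMoment b b'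

/-- For `θ` drawn from `P`, the parts `U_A` and `U_B` of the network after and before the parameter
`θ_μ` form independent 2-designs in the isotypic blocks.  The blocks `U_λ` are the restrictions to
`ℋ_λ^ν`, for any choice of copies `ν` (they do not depend on that choice). -/
def FormsIndependentTwoDesigns {n : ℕ} (w : MultiplicityBasis n) (V : QNN n) (μ : Fin V.depth)
    (P : Measure (Fin V.depth → ℝ)) : Prop :=
  ∀ ν : ∀ m : Label n, Fin (multiplicity m),
    IndependentTwoDesigns P (fun θ m => restrict w m (ν m) (V.after μ θ))
      (fun θ m => restrict w m (ν m) (V.before μ θ))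

/-! ### Asymptotics and barren plateaus -/

/-- `f ∈ Ω(1/poly(n))`. -/
def IsOmegaInvPoly (f : ℕ → ℝ) : Prop :=
  ∃ C : ℝ, 0 < C ∧ ∃ k : ℕ, ∀ᶠ n : ℕ in atTop, C / (n : ℝ) ^ k ≤ f n

/-- A family of real random variables `g n` (partial derivatives of a loss in one direction) has
a barren plateau: all means vanish and the variances vanish exponentially in `n`. -/
def IsBarrenPlateau {Θ : ℕ → Type*} [∀ n, MeasurableSpace (Θ n)] (P : ∀ n, Measure (Θ n))
    (g : ∀ n, Θ n → ℝ) : Prop :=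
  (∀ᶠ n : ℕ in atTop, ∫ θ, g n θ ∂(P n) = 0) ∧
    ∃ b : ℝ, 1 < b ∧ (fun n : ℕ => variance (g n) (P n)) =O[atTop] fun n : ℕ => (b ^ n)⁻¹

end

end SnEquivariant

open SnEquivariant MeasureTheory ProbabilityTheory Filter

/-!
Cutting the network at the parameter `θ_μ` gives
`∂_μ ℒ = -i Tr[[H_μ, U_B σ U_B†] U_A† O U_A]`, with `σ = ∑_i c_i ρ_i`
(`partialLoss_eq`). Every operator here except `σ` is a polynomial, or a limit of polynomials, in the
collective spin operators and hence acts as `⨁_λ 1 ⊗ A_λ` on the blocks `ℋ_λ^ν`; the blocks are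
orthonormal strings of lowered highest-weight vectors (`star_blockVector_dotProduct`) and exhaust
the whole space (`sum_blockMap`). So the derivative splits into one term per `λ`, in which only
`σ_λ = ∑_ν σ_λ^ν` enters (`gradForm_eq_sum_blockForm`). The operator `∏_j X_j` is covered because it
is the top elementary symmetric polynomial of `X_1, …, X_n`, a polynomial in `∑_j X_j`
(`isBlockwise_flipSum`).

The design condition lets the conjugates `U_B σ U_B†` and `U_A† O U_A` be replaced, in first and
second moments, by independent Haar twirls of the blocks. A tensor invariant under
`W ⊗ conj W ⊗ W ⊗ conj W` is a combination of the identity and the swap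
(`IsInvariantTensor.exists_eq`). Commutators kill the identity part, so that the mean and the
covariances of different blocks vanish, and what is left is the product of the swap coefficients
`Δ(O_λ)/(d_λ²-1)` and `Δ(σ_λ)/(d_λ²-1)`:
`Var[∂_μ ℒ] = ∑_λ 2 d_λ Δ(H_λ) Δ(O_λ) Δ(σ_λ) / (d_λ² - 1)²`
(`variance_partialLoss_eq_sum_delta`).

All summands are nonnegative, since `Δ` of a Hermitian matrix is the squared Hilbert-Schmidt norm
of its traceless part. It remains to bound the summand of the given `λ` from below. Because
`Δ(σ_λ) > 0` forces `d_λ ≥ 2`, one explicit matrix entry of each generator and measurement in the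
spin basis shows that `Δ(H_λ)` and `Δ(O_λ)` are at least `1/n⁴`
(`one_div_pow_four_le_delta_of_mem_generatorSet`, `one_div_pow_four_le_delta_of_mem_measurementSet`).
The two-body operators are scalar on the block with `d_λ = 2`, which is why they need `d_λ ≥ 3`.
-/

namespace SnEquivariant

open Matrix
open scoped ComplexOrder

/-! ### Collective operators -/

theorem matrix_ext_mulVec {ι κ : Type*} [Fintype κ] [DecidableEq κ] {A B : Matrix ι κ ℂ}
    (h : ∀ v, A *ᵥ v = B *ᵥ v) : A = B := by
  ext i j
  simpa using congrFun (h (Pi.single j 1)) i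

theorem onSite_mulVec {n : ℕ} (A : Matrix (Fin 2) (Fin 2) ℂ) (j : Fin n) (v : Config n → ℂ)
    (x : Config n) :
    (onSite A j *ᵥ v) x = ∑ b, A (x j) b * v (Function.update x j b) := by
  have hinj : Function.Injective fun b : Fin 2 => Function.update x j b :=
    Function.update_injective x j
  rw [mulVec, dotProduct]
  symm
  rw [← Finset.sum_image (s := Finset.univ) (g := fun b : Fin 2 => Function.update x j b)
    (f := fun y => A (x j) (y j) * v y) (fun a _ b _ h => hinj h) |>.trans
      (Finset.sum_congr rfl fun b _ => by simp)]
  rw [← Finset.sum_subset (Finset.subset_univ _)]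
  · refine Finset.sum_congr rfl fun y hy => ?_
    obtain ⟨b, -, rfl⟩ := Finset.mem_image.mp hy
    have : ∀ k, k ≠ j → x k = Function.update x j b k := fun k hk => by
      rw [Function.update_of_ne hk]
    simp only [onSite, of_apply, if_pos this]
  · intro y _ hy
    have : ¬ ∀ k, k ≠ j → x k = y k := by
      intro h
      refine hy (Finset.mem_image.mpr ⟨y j, Finset.mem_univ _, ?_⟩)
      funext k
      by_cases hk : k = j
      · subst hk; simp
      · simp [Function.update_of_ne hk, h k hk]
    simp only [onSite, of_apply, if_neg this, zero_mul]

theorem onSite_mul {n : ℕ} (A B : Matrix (Fin 2) (Fin 2) ℂ) (j : Fin n) :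
    onSite A j * onSite B j = onSite (A * B) j := by
  refine matrix_ext_mulVec fun v => funext fun x => ?_
  rw [← mulVec_mulVec]
  simp only [onSite_mulVec, Function.update_self, Function.update_idem, mul_apply, Finset.sum_mul,
    Finset.mul_sum]
  rw [Finset.sum_comm]
  simp only [mul_assoc]

theorem onSite_commute {n : ℕ} (A B : Matrix (Fin 2) (Fin 2) ℂ) {j k : Fin n} (h : j ≠ k) :
    onSite A j * onSite B k = onSite B k * onSite A j := by
  refine matrix_ext_mulVec fun v => funext fun x => ?_
  simp only [← mulVec_mulVec, onSite_mulVec, Function.update_of_ne h, Function.update_of_ne h.symm,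
    Finset.mul_sum]
  rw [Finset.sum_comm]
  refine Finset.sum_congr rfl fun b _ => Finset.sum_congr rfl fun c _ => ?_
  rw [Function.update_comm h]
  ring

theorem onSite_one {n : ℕ} (j : Fin n) : onSite 1 j = (1 : Op n) := by
  refine matrix_ext_mulVec fun v => funext fun x => ?_
  simp [onSite_mulVec, Matrix.one_apply]

theorem onSite_add {n : ℕ} (A B : Matrix (Fin 2) (Fin 2) ℂ) (j : Fin n) :
    onSite (A + B) j = onSite A j + onSite B j := by
  ext x y
  simp only [onSite, of_apply, Matrix.add_apply]
  split_ifs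
  · rfl
  · simp

theorem onSite_smul {n : ℕ} (c : ℂ) (A : Matrix (Fin 2) (Fin 2) ℂ) (j : Fin n) :
    onSite (c • A) j = c • onSite A j := by
  ext x y
  by_cases h : ∀ k, k ≠ j → x k = y k <;> simp [onSite, h]

theorem onSite_conjTranspose {n : ℕ} (A : Matrix (Fin 2) (Fin 2) ℂ) (j : Fin n) :
    (onSite A j)ᴴ = onSite Aᴴ j := by
  ext x y
  have : (∀ k, k ≠ j → x k = y k) ↔ ∀ k, k ≠ j → y k = x k :=
    forall₂_congr fun _ _ => eq_comm
  by_cases h : ∀ k, k ≠ j → x k = y k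
  · simp only [onSite, conjTranspose_apply, of_apply, if_pos h, if_pos (this.mp h)]
  · simp only [onSite, conjTranspose_apply, of_apply, if_neg h, if_neg (fun h' => h (this.mpr h')),
      star_zero]

theorem collective_add (n : ℕ) (A B : Matrix (Fin 2) (Fin 2) ℂ) :
    collective n (A + B) = collective n A + collective n B := by
  simp [collective, onSite_add, Finset.sum_add_distrib]

theorem collective_smul (n : ℕ) (c : ℂ) (A : Matrix (Fin 2) (Fin 2) ℂ) :
    collective n (c • A) = c • collective n A := by
  simp [collective, onSite_smul, Finset.smul_sum]

theorem collective_conjTranspose (n : ℕ) (A : Matrix (Fin 2) (Fin 2) ℂ) :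
    (collective n A)ᴴ = collective n Aᴴ := by
  simp [collective, conjTranspose_sum, onSite_conjTranspose]

theorem collective_mulVec {n : ℕ} (A : Matrix (Fin 2) (Fin 2) ℂ) (v : Config n → ℂ)
    (x : Config n) :
    (collective n A *ᵥ v) x = ∑ j, ∑ b, A (x j) b * v (Function.update x j b) := by
  simp only [collective, sum_mulVec, Finset.sum_apply, onSite_mulVec]

theorem collective_commutator (n : ℕ) (A B : Matrix (Fin 2) (Fin 2) ℂ) :
    collective n A * collective n B =
      collective n B * collective n A + collective n (A * B + (-1 : ℂ) • (B * A)) := by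
  rw [collective_add, collective_smul]
  simp only [collective, Finset.sum_mul_sum, ← onSite_mul]
  rw [Finset.sum_comm (f := fun j k => onSite B j * onSite A k), Finset.smul_sum,
    ← Finset.sum_add_distrib, ← Finset.sum_add_distrib]
  refine Finset.sum_congr rfl fun j _ => ?_
  rw [← Finset.add_sum_erase _ _ (Finset.mem_univ j),
    ← Finset.add_sum_erase _ (fun k => onSite B k * onSite A j) (Finset.mem_univ j),
    Finset.sum_congr rfl fun k hk => onSite_commute A B (Finset.ne_of_mem_erase hk).symm]
  module

theorem raising_mul_lowering (n : ℕ) :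
    collective n sigmaPlus * collective n sigmaMinus =
      collective n sigmaMinus * collective n sigmaPlus + collective n pauliZ := by
  rw [collective_commutator]
  congr 2
  ext i j
  fin_cases i <;> fin_cases j <;> simp [sigmaPlus, sigmaMinus, pauliZ]

theorem pauliZ_mul_lowering (n : ℕ) :
    collective n pauliZ * collective n sigmaMinus =
      collective n sigmaMinus * collective n pauliZ + (-2 : ℂ) • collective n sigmaMinus := by
  rw [collective_commutator, ← collective_smul]
  congr 2
  ext i j
  fin_cases i <;> fin_cases j <;> norm_num [sigmaMinus, pauliZ]

theorem lowering_conjTranspose (n : ℕ) :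
    (collective n sigmaMinus)ᴴ = collective n sigmaPlus := by
  rw [collective_conjTranspose]
  congr 1
  ext i j
  fin_cases i <;> fin_cases j <;> simp [sigmaPlus, sigmaMinus]

theorem raising_conjTranspose (n : ℕ) :
    (collective n sigmaPlus)ᴴ = collective n sigmaMinus := by
  rw [← lowering_conjTranspose, conjTranspose_conjTranspose]

theorem collective_pauliX (n : ℕ) :
    collective n pauliX = collective n sigmaPlus + collective n sigmaMinus := by
  rw [← collective_add]
  congr 1
  ext i j
  fin_cases i <;> fin_cases j <;> simp [sigmaPlus, sigmaMinus, pauliX]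

theorem collective_pauliY (n : ℕ) :
    collective n pauliY =
      Complex.I • (collective n sigmaMinus + (-1 : ℂ) • collective n sigmaPlus) := by
  rw [← collective_smul, ← collective_add, ← collective_smul]
  congr 1
  ext i j
  fin_cases i <;> fin_cases j <;> simp [sigmaPlus, sigmaMinus, pauliY]

/-- For an involution `A` the pair sum is a polynomial in the collective operator. -/
theorem pairSum_eq (n : ℕ) {A : Matrix (Fin 2) (Fin 2) ℂ} (hA : A * A = 1) :
    pairSum n A = (2⁻¹ : ℂ) • (collective n A * collective n A + (-(n : ℂ)) • (1 : Op n)) := by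
  have h : (2 : ℂ) • pairSum n A + (n : ℂ) • (1 : Op n) = collective n A * collective n A := by
    have hn : (n : ℂ) • (1 : Op n) = ∑ j : Fin n, onSite A j * onSite A j := by
      simp [onSite_mul, hA, onSite_one, Nat.cast_smul_eq_nsmul]
    rw [two_smul_pairSum, hn, ← Finset.sum_add_distrib, collective, Finset.sum_mul_sum]
    refine Finset.sum_congr rfl fun j _ => ?_
    rw [← Finset.add_sum_erase _ _ (Finset.mem_univ j), add_comm]
    congr 2
    ext k; simp
  rw [← h, smul_add, smul_add, smul_smul, smul_smul, smul_smul]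
  module

theorem pauliX_mul_self : pauliX * pauliX = 1 := by
  ext i j
  fin_cases i <;> fin_cases j <;> simp [pauliX]

theorem pauliZ_mul_self : pauliZ * pauliZ = 1 := by
  ext i j
  fin_cases i <;> fin_cases j <;> simp [pauliZ]

/-- The number of qubits in the state `|1⟩`. -/
def ones {n : ℕ} (x : Config n) : ℕ := (Finset.univ.filter fun j => x j = 1).card

theorem collective_pauliZ_mulVec {n : ℕ} (v : Config n → ℂ) (x : Config n) :
    (collective n pauliZ *ᵥ v) x = ((n : ℂ) - 2 * (ones x : ℂ)) * v x := by
  have h : ∀ j, ∑ b, pauliZ (x j) b * v (Function.update x j b) =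
      (1 - 2 * (if x j = 1 then 1 else 0)) * v x := by
    intro j
    rw [Finset.sum_eq_single (x j)]
    · rw [Function.update_eq_self]
      congr 1
      generalize x j = b
      fin_cases b <;> norm_num [pauliZ]
    · intro b _ hb
      have : pauliZ (x j) b = 0 := by
        generalize x j = a at *
        fin_cases a <;> fin_cases b <;> simp_all [pauliZ]
      rw [this, zero_mul]
    · simp
  rw [collective_mulVec, Finset.sum_congr rfl fun j _ => h j, ← Finset.sum_mul,
    Finset.sum_sub_distrib, ← Finset.mul_sum, Finset.sum_boole]
  simp [ones]

theorem pauliZ_conjTranspose (n : ℕ) : (collective n pauliZ)ᴴ = collective n pauliZ := by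
  rw [collective_conjTranspose]
  congr 1
  ext i j
  fin_cases i <;> fin_cases j <;> simp [pauliZ]

section Blocks

variable {n : ℕ}

/-! ### Strings of lowered highest-weight vectors -/

/-- A vector killed by `∑_j σ⁺_j` on which `∑_j Z_j` acts as the scalar `N`. -/
structure IsHighestWeight (N : ℂ) (u : Config n → ℂ) : Prop where
  raising : collective n sigmaPlus *ᵥ u = 0
  weight : collective n pauliZ *ᵥ u = N • u

theorem IsHighestWeight.weight_lowering {N : ℂ} {u : Config n → ℂ} (h : IsHighestWeight N u)
    (k : ℕ) : collective n pauliZ *ᵥ (collective n sigmaMinus ^ k *ᵥ u) =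
      (N - 2 * k) • (collective n sigmaMinus ^ k *ᵥ u) := by
  induction k with
  | zero => simpa using h.weight
  | succ k ih =>
    rw [pow_succ', ← mulVec_mulVec, mulVec_mulVec, pauliZ_mul_lowering, add_mulVec,
      ← mulVec_mulVec, ih, mulVec_smul, smul_mulVec]
    push_cast
    module

theorem IsHighestWeight.raising_lowering {N : ℂ} {u : Config n → ℂ} (h : IsHighestWeight N u)
    (k : ℕ) : collective n sigmaPlus *ᵥ (collective n sigmaMinus ^ (k + 1) *ᵥ u) =
      (((k : ℂ) + 1) * (N - k)) • (collective n sigmaMinus ^ k *ᵥ u) := by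
  induction k with
  | zero =>
    rw [pow_succ', ← mulVec_mulVec, mulVec_mulVec, raising_mul_lowering, add_mulVec,
      ← mulVec_mulVec]
    simp [h.raising, h.weight]
  | succ k ih =>
    rw [pow_succ', ← mulVec_mulVec, mulVec_mulVec, raising_mul_lowering, add_mulVec,
      ← mulVec_mulVec, ih, mulVec_smul, h.weight_lowering, mulVec_mulVec, ← pow_succ']
    push_cast
    module

/-- The raising operator is the adjoint of the lowering operator. -/
theorem star_dotProduct_lowering (u v : Config n → ℂ) :
    star u ⬝ᵥ (collective n sigmaMinus *ᵥ v) = star (collective n sigmaPlus *ᵥ u) ⬝ᵥ v := by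
  rw [star_mulVec, raising_conjTranspose, dotProduct_mulVec]

theorem star_lowering_dotProduct (u v : Config n → ℂ) :
    star (collective n sigmaMinus *ᵥ u) ⬝ᵥ v = star u ⬝ᵥ (collective n sigmaPlus *ᵥ v) := by
  rw [star_mulVec, lowering_conjTranspose, dotProduct_mulVec]

theorem IsHighestWeight.star_lowering_dotProduct_lowering {N N' : ℂ} {u u' : Config n → ℂ}
    (h : IsHighestWeight N u) (h' : IsHighestWeight N' u') (k l : ℕ) :
    star (collective n sigmaMinus ^ k *ᵥ u) ⬝ᵥ (collective n sigmaMinus ^ l *ᵥ u') =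
      if k = l then (∏ i ∈ Finset.range k, (((i : ℂ) + 1) * (N' - i))) * (star u ⬝ᵥ u')
        else 0 := by
  induction k generalizing l with
  | zero =>
    cases l with
    | zero => simp
    | succ l =>
      rw [pow_succ' _ l, ← mulVec_mulVec, star_dotProduct_lowering]
      simp [h.raising]
  | succ k ih =>
    rw [pow_succ' _ k, ← mulVec_mulVec, star_lowering_dotProduct]
    cases l with
    | zero => simp [h'.raising]
    | succ l =>
      rw [h'.raising_lowering, dotProduct_smul, ih]
      by_cases hkl : k = l
      · subst hkl
        simp only [if_true, Finset.prod_range_succ, smul_eq_mul]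
        ring
      · simp [hkl]

/-- Highest-weight vectors of different weights are orthogonal. -/
theorem IsHighestWeight.star_dotProduct_eq_zero {N N' : ℝ} {u u' : Config n → ℂ}
    (h : IsHighestWeight (N : ℂ) u) (h' : IsHighestWeight (N' : ℂ) u') (hN : N ≠ N') :
    star u ⬝ᵥ u' = 0 := by
  have key : (N : ℂ) * (star u ⬝ᵥ u') = N' * (star u ⬝ᵥ u') := by
    have h1 : star (collective n pauliZ *ᵥ u) ⬝ᵥ u' =
        star u ⬝ᵥ (collective n pauliZ *ᵥ u') := by
      rw [star_mulVec, pauliZ_conjTranspose, dotProduct_mulVec]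
    rw [h.weight, h'.weight, star_smul, smul_dotProduct, dotProduct_smul] at h1
    simpa using h1
  by_contra hne
  exact hN (by exact_mod_cast mul_right_cancel₀ hne key)

/-! ### The orthonormal vectors of the blocks -/

theorem two_mul_label_le (m : Label n) : 2 * (m : ℕ) ≤ n := by
  have := m.2; omega

/-- The `ν`-th vector of the chosen basis of highest-weight vectors, as a function on
configurations. -/
noncomputable def topVector (w : MultiplicityBasis n) (m : Label n) (ν : Fin (multiplicity m)) :
    Config n → ℂ := fun x => (w m ν : EuclideanSpace ℂ (Config n)) x

theorem mem_highestWeightSpace {m : Label n} {u : EuclideanSpace ℂ (Config n)} :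
    u ∈ highestWeightSpace m ↔ IsHighestWeight ((n : ℂ) - 2 * (m : ℕ)) (fun x => u x) := by
  rw [highestWeightSpace, Submodule.mem_inf, LinearMap.mem_ker, Module.End.mem_eigenspace_iff]
  constructor
  · rintro ⟨h1, h2⟩
    exact ⟨by simpa [toLpLin_apply] using congrArg WithLp.ofLp h1,
      by simpa [toLpLin_apply] using congrArg WithLp.ofLp h2⟩
  · rintro ⟨h1, h2⟩
    exact ⟨WithLp.ofLp_injective 2 (by simpa [toLpLin_apply] using h1),
      WithLp.ofLp_injective 2 (by simpa [toLpLin_apply] using h2)⟩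

/-- Twice the spin of a block. -/
abbrev twiceSpin (m : Label n) : ℕ := n - 2 * (m : ℕ)

theorem cast_twiceSpin (m : Label n) : ((twiceSpin m : ℕ) : ℂ) = (n : ℂ) - 2 * (m : ℕ) := by
  rw [twiceSpin, Nat.cast_sub (two_mul_label_le m)]; push_cast; ring

theorem isHighestWeight_topVector (w : MultiplicityBasis n) (m : Label n)
    (ν : Fin (multiplicity m)) : IsHighestWeight ((twiceSpin m : ℝ) : ℂ) (topVector w m ν) := by
  have := mem_highestWeightSpace.mp (w m ν).2
  rw [Complex.ofReal_natCast, cast_twiceSpin]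
  exact this

theorem star_topVector_dotProduct (w : MultiplicityBasis n) (m : Label n)
    (ν ν' : Fin (multiplicity m)) :
    star (topVector w m ν) ⬝ᵥ topVector w m ν' = if ν = ν' then 1 else 0 := by
  have := orthonormal_iff_ite.mp (w m).orthonormal ν ν'
  rw [← this, Submodule.coe_inner, EuclideanSpace.inner_eq_star_dotProduct, dotProduct_comm]
  rfl

theorem blockDim_eq (m : Label n) : blockDim m = twiceSpin m + 1 := rfl

theorem le_twiceSpin {m : Label n} (k : Fin (blockDim m)) : (k : ℕ) ≤ twiceSpin m :=
  Nat.lt_succ_iff.mp k.2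

/-- The normalization `√((N-k)! / (k! N!))` of the `k`-th vector of a string of length `N + 1`. -/
noncomputable def stringNorm (N k : ℕ) : ℝ :=
  Real.sqrt (((N - k).factorial : ℝ) / (k.factorial * N.factorial))

theorem blockVector_eq (w : MultiplicityBasis n) (m : Label n) (ν : Fin (multiplicity m))
    (k : Fin (blockDim m)) : blockVector w m ν k = (stringNorm (twiceSpin m) k : ℂ) •
      (collective n sigmaMinus ^ (k : ℕ) *ᵥ topVector w m ν) := rfl

theorem stringNorm_pos (N k : ℕ) : 0 < stringNorm N k := by
  unfold stringNorm; positivity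

theorem stringNorm_zero (N : ℕ) : stringNorm N 0 = 1 := by
  have : (N.factorial : ℝ) ≠ 0 := by positivity
  simp [stringNorm, this]

theorem stringNorm_succ_sq {N k : ℕ} (hk : k < N) :
    stringNorm N (k + 1) ^ 2 * (((k : ℝ) + 1) * (N - k)) = stringNorm N k ^ 2 := by
  unfold stringNorm
  rw [Real.sq_sqrt (by positivity), Real.sq_sqrt (by positivity)]
  obtain ⟨r, rfl⟩ : ∃ r, N = k + 1 + r := ⟨N - (k + 1), by omega⟩
  have h1 : k + 1 + r - (k + 1) = r := by omega
  have h2 : k + 1 + r - k = r + 1 := by omega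
  have h3 : ((k + 1 + r).factorial : ℝ) ≠ 0 := by positivity
  have h4 : (k.factorial : ℝ) ≠ 0 := by positivity
  rw [h1, h2, Nat.factorial_succ k, Nat.factorial_succ r]
  push_cast
  field_simp
  ring

/-- The matrix element `√((k+1)(N-k))` of the raising operator between `k + 1` and `k`. -/
noncomputable def ladder (N k : ℕ) : ℝ := Real.sqrt (((k : ℝ) + 1) * (N - k))

theorem ladder_sq {N k : ℕ} (hk : k ≤ N) : ladder N k ^ 2 = ((k : ℝ) + 1) * (N - k) := by
  have : (k : ℝ) ≤ N := by exact_mod_cast hk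
  exact Real.sq_sqrt (mul_nonneg (by positivity) (by linarith))

theorem stringNorm_succ_mul_ladder {N k : ℕ} (hk : k < N) :
    stringNorm N (k + 1) * ladder N k = stringNorm N k := by
  have h0 := stringNorm_pos N k
  have h1 := stringNorm_pos N (k + 1)
  have h2 : 0 ≤ ladder N k := Real.sqrt_nonneg _
  refine (sq_eq_sq₀ (mul_nonneg h1.le h2) h0.le).mp ?_
  rw [mul_pow, ladder_sq hk.le, stringNorm_succ_sq hk]

theorem stringNorm_sq_mul_prod {N k : ℕ} (hk : k ≤ N) :
    stringNorm N k ^ 2 * ∏ i ∈ Finset.range k, (((i : ℝ) + 1) * (N - i)) = 1 := by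
  induction k with
  | zero => simp [stringNorm_zero]
  | succ k ih =>
    rw [Finset.prod_range_succ, mul_comm (∏ i ∈ Finset.range k, _), ← mul_assoc,
      stringNorm_succ_sq hk, ih (by omega)]

theorem star_blockVector_dotProduct (w : MultiplicityBasis n) (m : Label n)
    (ν ν' : Fin (multiplicity m)) (k l : Fin (blockDim m)) :
    star (blockVector w m ν k) ⬝ᵥ blockVector w m ν' l =
      if ν = ν' ∧ k = l then 1 else 0 := by
  rw [blockVector_eq, blockVector_eq, star_smul, smul_dotProduct, dotProduct_smul,
    (isHighestWeight_topVector w m ν).star_lowering_dotProduct_lowering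
      (isHighestWeight_topVector w m ν'), star_topVector_dotProduct]
  by_cases hν : ν = ν'
  · by_cases hk : k = l
    · subst hk
      have := stringNorm_sq_mul_prod (N := twiceSpin m) (k := k) (le_twiceSpin k)
      have h2 := congrArg (fun r : ℝ => (r : ℂ)) this
      push_cast at h2
      simp only [hν, and_self, if_true, smul_eq_mul, mul_one]
      rw [← mul_assoc, Complex.star_def, Complex.conj_ofReal, ← sq]
      simpa using h2
    · have : (k : ℕ) ≠ l := fun h => hk (Fin.ext h)
      simp [this, hk]
  · simp [hν]

theorem star_blockVector_dotProduct_of_ne (w : MultiplicityBasis n) {m m' : Label n} (h : m ≠ m')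
    (ν : Fin (multiplicity m)) (ν' : Fin (multiplicity m')) (k : Fin (blockDim m))
    (l : Fin (blockDim m')) :
    star (blockVector w m ν k) ⬝ᵥ blockVector w m' ν' l = 0 := by
  have hN : (twiceSpin m : ℝ) ≠ twiceSpin m' := by
    intro h'
    have h1 := two_mul_label_le m
    have h2 := two_mul_label_le m'
    have h3 : twiceSpin m = twiceSpin m' := by exact_mod_cast h'
    exact h (Fin.ext (by unfold twiceSpin at h3; omega))
  rw [blockVector_eq, blockVector_eq, star_smul, smul_dotProduct, dotProduct_smul,
    (isHighestWeight_topVector w m ν).star_lowering_dotProduct_lowering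
      (isHighestWeight_topVector w m' ν'),
    (isHighestWeight_topVector w m ν).star_dotProduct_eq_zero
      (isHighestWeight_topVector w m' ν') hN]
  simp

/-- The end of a string: lowering once more gives zero, since the norm of the result vanishes. -/
theorem lowering_pow_topVector (w : MultiplicityBasis n) (m : Label n)
    (ν : Fin (multiplicity m)) :
    collective n sigmaMinus ^ (twiceSpin m + 1) *ᵥ topVector w m ν = 0 := by
  rw [← dotProduct_self_star_eq_zero, dotProduct_comm,
    (isHighestWeight_topVector w m ν).star_lowering_dotProduct_lowering
      (isHighestWeight_topVector w m ν), Finset.prod_range_succ]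
  simp

/-- The matrix of the collective raising operator in a block. -/
noncomputable def spinRaising (m : Label n) : BlockOp m :=
  Matrix.of fun k l => if (l : ℕ) = k + 1 then (ladder (twiceSpin m) k : ℂ) else 0

theorem lowering_mulVec_blockVector (w : MultiplicityBasis n) (m : Label n)
    (ν : Fin (multiplicity m)) (k : Fin (blockDim m)) :
    collective n sigmaMinus *ᵥ blockVector w m ν k =
      ∑ l, (spinRaising m)ᴴ l k • blockVector w m ν l := by
  rw [blockVector_eq, mulVec_smul, mulVec_mulVec, ← pow_succ']
  by_cases hk : (k : ℕ) + 1 < blockDim m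
  · rw [Finset.sum_eq_single ⟨k + 1, hk⟩]
    · rw [blockVector_eq, smul_smul]
      congr 1
      rw [← stringNorm_succ_mul_ladder (N := twiceSpin m) (k := k)
        (by have := blockDim_eq m; omega)]
      simp [spinRaising, mul_comm]
    · intro l _ hl
      have : ¬ (l : ℕ) = k + 1 := fun h => hl (Fin.ext h)
      simp [spinRaising, this]
    · simp
  · have hk' : (k : ℕ) = twiceSpin m := by
      have := le_twiceSpin k
      have := blockDim_eq m
      omega
    rw [hk', lowering_pow_topVector, smul_zero, Finset.sum_eq_zero]
    intro l _
    have : ¬ (l : ℕ) = k + 1 := by have := l.2; omega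
    simp [spinRaising, this]

theorem raising_mulVec_blockVector (w : MultiplicityBasis n) (m : Label n)
    (ν : Fin (multiplicity m)) (k : Fin (blockDim m)) :
    collective n sigmaPlus *ᵥ blockVector w m ν k =
      ∑ l, spinRaising m l k • blockVector w m ν l := by
  rw [blockVector_eq, mulVec_smul]
  obtain ⟨k, hk⟩ := k
  cases k with
  | zero =>
    rw [Finset.sum_eq_zero]
    · simp [(isHighestWeight_topVector w m ν).raising]
    · intro l _
      simp [spinRaising]
  | succ k =>
    have hkN : k < twiceSpin m := by have := blockDim_eq m; omega
    rw [(isHighestWeight_topVector w m ν).raising_lowering,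
      Finset.sum_eq_single ⟨k, by omega⟩]
    · rw [blockVector_eq, smul_smul, smul_smul]
      congr 1
      have h := ladder_sq hkN.le
      have : ((stringNorm (twiceSpin m) (k + 1) * (((k : ℝ) + 1) * (twiceSpin m - k)) : ℝ) : ℂ) =
          ((ladder (twiceSpin m) k * stringNorm (twiceSpin m) k : ℝ) : ℂ) := by
        rw [← h, ← stringNorm_succ_mul_ladder hkN]
        congr 1; ring
      simpa [spinRaising] using this
    · intro l _ hl
      have : ¬ k = (l : ℕ) := fun h => hl (Fin.ext h.symm)
      simp [spinRaising, this]
    · simp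

theorem pauliZ_mulVec_blockVector (w : MultiplicityBasis n) (m : Label n)
    (ν : Fin (multiplicity m)) (k : Fin (blockDim m)) :
    collective n pauliZ *ᵥ blockVector w m ν k =
      ((twiceSpin m : ℂ) - 2 * (k : ℕ)) • blockVector w m ν k := by
  rw [blockVector_eq, mulVec_smul, (isHighestWeight_topVector w m ν).weight_lowering, smul_comm]
  simp

/-! ### Blockwise operators -/

theorem blockMap_conjTranspose_apply (w : MultiplicityBasis n) (m : Label n)
    (ν : Fin (multiplicity m)) (x : Config n) (k : Fin (blockDim m)) :
    (blockMap w m ν)ᴴ x k = blockVector w m ν k x := by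
  simp [blockMap]

theorem blockMap_mul_conjTranspose (w : MultiplicityBasis n) (m : Label n)
    (ν ν' : Fin (multiplicity m)) :
    blockMap w m ν * (blockMap w m ν')ᴴ = if ν = ν' then 1 else 0 := by
  ext k l
  have : (blockMap w m ν * (blockMap w m ν')ᴴ) k l =
      star (blockVector w m ν k) ⬝ᵥ blockVector w m ν' l := by
    simp [mul_apply, dotProduct, blockMap]
  rw [this, star_blockVector_dotProduct]
  by_cases hν : ν = ν' <;> by_cases hk : k = l <;> simp [hν, hk, Matrix.one_apply]

theorem blockMap_mul_conjTranspose_self (w : MultiplicityBasis n) (m : Label n)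
    (ν : Fin (multiplicity m)) : blockMap w m ν * (blockMap w m ν)ᴴ = 1 := by
  rw [blockMap_mul_conjTranspose, if_pos rfl]

theorem blockMap_mul_conjTranspose_of_ne (w : MultiplicityBasis n) {m m' : Label n} (h : m ≠ m')
    (ν : Fin (multiplicity m)) (ν' : Fin (multiplicity m')) :
    blockMap w m ν * (blockMap w m' ν')ᴴ = 0 := by
  ext k l
  have : (blockMap w m ν * (blockMap w m' ν')ᴴ) k l =
      star (blockVector w m ν k) ⬝ᵥ blockVector w m' ν' l := by
    simp [mul_apply, dotProduct, blockMap]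
  rw [this, star_blockVector_dotProduct_of_ne w h]
  rfl

theorem mul_blockMap_conjTranspose {w : MultiplicityBasis n} {m : Label n}
    {ν : Fin (multiplicity m)} {A : Op n} {a : BlockOp m}
    (h : ∀ k, A *ᵥ blockVector w m ν k = ∑ l, a l k • blockVector w m ν l) :
    A * (blockMap w m ν)ᴴ = (blockMap w m ν)ᴴ * a := by
  ext x k
  have := congrFun (h k) x
  simp only [mulVec, dotProduct, Finset.sum_apply, Pi.smul_apply, smul_eq_mul] at this
  simp only [mul_apply, blockMap_conjTranspose_apply, this]
  exact Finset.sum_congr rfl fun _ _ => mul_comm _ _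

theorem lowering_mul_blockMap (w : MultiplicityBasis n) (m : Label n) (ν : Fin (multiplicity m)) :
    collective n sigmaMinus * (blockMap w m ν)ᴴ = (blockMap w m ν)ᴴ * (spinRaising m)ᴴ :=
  mul_blockMap_conjTranspose (lowering_mulVec_blockVector w m ν)

theorem raising_mul_blockMap (w : MultiplicityBasis n) (m : Label n) (ν : Fin (multiplicity m)) :
    collective n sigmaPlus * (blockMap w m ν)ᴴ = (blockMap w m ν)ᴴ * spinRaising m :=
  mul_blockMap_conjTranspose (raising_mulVec_blockVector w m ν)

/-- The matrix of `∑_j Z_j` in a block. -/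
noncomputable def spinWeight (m : Label n) : BlockOp m :=
  diagonal fun k => (twiceSpin m : ℂ) - 2 * (k : ℕ)

theorem pauliZ_mul_blockMap (w : MultiplicityBasis n) (m : Label n) (ν : Fin (multiplicity m)) :
    collective n pauliZ * (blockMap w m ν)ᴴ = (blockMap w m ν)ᴴ * spinWeight m := by
  refine mul_blockMap_conjTranspose fun k => ?_
  rw [pauliZ_mulVec_blockVector, Finset.sum_eq_single k]
  · simp [spinWeight]
  · intro l _ hl
    simp [spinWeight, hl]
  · simp

/-- An operator acts blockwise if it commutes with the partial isometries `(Q_λ^ν)† Q_λ^ν'` that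
identify the copies of each block: it is then `⨁_λ 1 ⊗ A_λ` on the span of the blocks. -/
def IsBlockwise (w : MultiplicityBasis n) (A : Op n) : Prop :=
  ∀ m (ν ν' : Fin (multiplicity m)), Commute A ((blockMap w m ν)ᴴ * blockMap w m ν')

namespace IsBlockwise

variable {w : MultiplicityBasis n} {A B : Op n}

theorem one : IsBlockwise w 1 := fun _ _ _ => Commute.one_left _

theorem add (hA : IsBlockwise w A) (hB : IsBlockwise w B) : IsBlockwise w (A + B) :=
  fun m ν ν' => (hA m ν ν').add_left (hB m ν ν')

theorem mul (hA : IsBlockwise w A) (hB : IsBlockwise w B) : IsBlockwise w (A * B) :=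
  fun m ν ν' => (hA m ν ν').mul_left (hB m ν ν')

theorem smul (hA : IsBlockwise w A) (c : ℂ) : IsBlockwise w (c • A) :=
  fun m ν ν' => (hA m ν ν').smul_left c

theorem conjTranspose (hA : IsBlockwise w A) : IsBlockwise w Aᴴ := fun m ν ν' => by
  have := congrArg Matrix.conjTranspose (hA m ν' ν).eq
  simp only [conjTranspose_mul, conjTranspose_conjTranspose] at this
  exact this.symm

theorem list_prod {l : List (Op n)} (h : ∀ A ∈ l, IsBlockwise w A) : IsBlockwise w l.prod := by
  induction l with
  | nil => exact one
  | cons A l ih =>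
    rw [List.prod_cons]
    exact (h A (by simp)).mul (ih fun B hB => h B (by simp [hB]))

theorem exp (hA : IsBlockwise w A) : IsBlockwise w (NormedSpace.exp A) := fun m ν ν' => by
  let : NormedRing (Op n) := Matrix.linftyOpNormedRing
  let : NormedAlgebra ℂ (Op n) := Matrix.linftyOpNormedAlgebra
  exact (hA m ν ν').exp_left

/-- On each copy of a block, a blockwise operator acts through its restriction to any copy. -/
theorem mul_blockMap (hA : IsBlockwise w A) (m : Label n) (ν ν' : Fin (multiplicity m)) :
    A * (blockMap w m ν)ᴴ = (blockMap w m ν)ᴴ * restrict w m ν' A := by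
  have h := congrArg (· * (blockMap w m ν')ᴴ) (hA m ν ν').eq
  simp only [Matrix.mul_assoc, blockMap_mul_conjTranspose_self, Matrix.mul_one] at h
  simpa only [restrict, Matrix.mul_assoc] using h

theorem blockMap_mul (hA : IsBlockwise w A) (m : Label n) (ν ν' : Fin (multiplicity m)) :
    blockMap w m ν * A = restrict w m ν' A * blockMap w m ν := by
  have h := congrArg (blockMap w m ν' * ·) (hA m ν' ν).eq
  simp only [← Matrix.mul_assoc, blockMap_mul_conjTranspose_self, Matrix.one_mul] at h
  exact h.symm

theorem restrict_eq (hA : IsBlockwise w A) (m : Label n) (ν ν' : Fin (multiplicity m)) :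
    restrict w m ν A = restrict w m ν' A := by
  rw [restrict, Matrix.mul_assoc, hA.mul_blockMap m ν ν', ← Matrix.mul_assoc,
    blockMap_mul_conjTranspose_self, Matrix.one_mul]

end IsBlockwise

/-- Restriction to a block is multiplicative as soon as one factor acts blockwise. -/
theorem restrict_mul_of_left {w : MultiplicityBasis n} {A : Op n} (hA : IsBlockwise w A) (B : Op n)
    (m : Label n) (ν : Fin (multiplicity m)) :
    restrict w m ν (A * B) = restrict w m ν A * restrict w m ν B := by
  rw [restrict, ← Matrix.mul_assoc, hA.blockMap_mul m ν ν]
  simp only [restrict, Matrix.mul_assoc]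

theorem restrict_mul_of_right {w : MultiplicityBasis n} (A : Op n) {B : Op n}
    (hB : IsBlockwise w B) (m : Label n) (ν : Fin (multiplicity m)) :
    restrict w m ν (A * B) = restrict w m ν A * restrict w m ν B := by
  rw [restrict, ← Matrix.mul_assoc, Matrix.mul_assoc _ B, hB.mul_blockMap m ν ν]
  simp only [restrict, Matrix.mul_assoc]

theorem restrict_conjTranspose (w : MultiplicityBasis n) (m : Label n) (ν : Fin (multiplicity m))
    (A : Op n) : restrict w m ν Aᴴ = (restrict w m ν A)ᴴ := by
  simp [restrict, Matrix.mul_assoc]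

theorem restrict_one (w : MultiplicityBasis n) (m : Label n) (ν : Fin (multiplicity m)) :
    restrict w m ν 1 = 1 := by
  simp [restrict, blockMap_mul_conjTranspose_self]

theorem restrict_add (w : MultiplicityBasis n) (m : Label n) (ν : Fin (multiplicity m))
    (A B : Op n) : restrict w m ν (A + B) = restrict w m ν A + restrict w m ν B := by
  simp [restrict, Matrix.mul_add, Matrix.add_mul]

theorem restrict_smul (w : MultiplicityBasis n) (m : Label n) (ν : Fin (multiplicity m))
    (c : ℂ) (A : Op n) : restrict w m ν (c • A) = c • restrict w m ν A := by
  simp [restrict]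

theorem restrict_eq_of_mul {w : MultiplicityBasis n} {m : Label n} {ν : Fin (multiplicity m)}
    {A : Op n} {a : BlockOp m} (h : A * (blockMap w m ν)ᴴ = (blockMap w m ν)ᴴ * a) :
    restrict w m ν A = a := by
  rw [restrict, Matrix.mul_assoc, h, ← Matrix.mul_assoc, blockMap_mul_conjTranspose_self,
    Matrix.one_mul]

theorem isBlockwise_of_mul {w : MultiplicityBasis n} {A : Op n} (a : ∀ m : Label n, BlockOp m)
    (h : ∀ m ν, A * (blockMap w m ν)ᴴ = (blockMap w m ν)ᴴ * a m)
    (h' : ∀ m ν, Aᴴ * (blockMap w m ν)ᴴ = (blockMap w m ν)ᴴ * (a m)ᴴ) : IsBlockwise w A := by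
  intro m ν ν'
  have h2 := congrArg Matrix.conjTranspose (h' m ν')
  simp only [conjTranspose_mul, conjTranspose_conjTranspose] at h2
  rw [Commute, SemiconjBy, ← Matrix.mul_assoc, h, Matrix.mul_assoc, Matrix.mul_assoc, h2]

theorem isBlockwise_lowering (w : MultiplicityBasis n) :
    IsBlockwise w (collective n sigmaMinus) :=
  isBlockwise_of_mul (fun m => (spinRaising m)ᴴ) (lowering_mul_blockMap w) fun m ν => by
    rw [lowering_conjTranspose, conjTranspose_conjTranspose, raising_mul_blockMap]

theorem isBlockwise_raising (w : MultiplicityBasis n) :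
    IsBlockwise w (collective n sigmaPlus) := by
  rw [← lowering_conjTranspose]
  exact (isBlockwise_lowering w).conjTranspose

theorem spinWeight_conjTranspose (m : Label n) : (spinWeight m)ᴴ = spinWeight m := by
  rw [spinWeight, diagonal_conjTranspose]
  congr 1
  funext k
  simp

theorem isBlockwise_pauliZ (w : MultiplicityBasis n) : IsBlockwise w (collective n pauliZ) :=
  isBlockwise_of_mul spinWeight (pauliZ_mul_blockMap w) fun m ν => by
    rw [pauliZ_conjTranspose, spinWeight_conjTranspose, pauliZ_mul_blockMap]

theorem restrict_raising (w : MultiplicityBasis n) (m : Label n) (ν : Fin (multiplicity m)) :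
    restrict w m ν (collective n sigmaPlus) = spinRaising m :=
  restrict_eq_of_mul (raising_mul_blockMap w m ν)

theorem restrict_lowering (w : MultiplicityBasis n) (m : Label n) (ν : Fin (multiplicity m)) :
    restrict w m ν (collective n sigmaMinus) = (spinRaising m)ᴴ :=
  restrict_eq_of_mul (lowering_mul_blockMap w m ν)

theorem restrict_pauliZ (w : MultiplicityBasis n) (m : Label n) (ν : Fin (multiplicity m)) :
    restrict w m ν (collective n pauliZ) = spinWeight m :=
  restrict_eq_of_mul (pauliZ_mul_blockMap w m ν)

/-! ### The blocks exhaust the space -/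

theorem pauliZ_mul_raising (n : ℕ) :
    collective n pauliZ * collective n sigmaPlus =
      collective n sigmaPlus * collective n pauliZ + (2 : ℂ) • collective n sigmaPlus := by
  rw [collective_commutator, ← collective_smul]
  congr 2
  ext i j
  fin_cases i <;> fin_cases j <;> norm_num [sigmaPlus, pauliZ]

theorem weight_raising {N : ℂ} {u : Config n → ℂ} (h : collective n pauliZ *ᵥ u = N • u) :
    collective n pauliZ *ᵥ (collective n sigmaPlus *ᵥ u) =
      (N + 2) • (collective n sigmaPlus *ᵥ u) := by
  rw [mulVec_mulVec, pauliZ_mul_raising, add_mulVec, ← mulVec_mulVec, h, mulVec_smul, smul_mulVec]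
  module

/-- A weight vector is supported on the configurations of that weight. -/
theorem ones_eq_of_weight {k : ℂ} {u : Config n → ℂ}
    (h : collective n pauliZ *ᵥ u = ((n : ℂ) - 2 * k) • u) {x : Config n} (hx : u x ≠ 0) :
    (ones x : ℂ) = k := by
  have h1 := congrFun h x
  rw [collective_pauliZ_mulVec, Pi.smul_apply, smul_eq_mul] at h1
  have h2 := mul_right_cancel₀ hx h1
  linear_combination (-1 / 2 : ℂ) * h2

theorem weight_of_ones_eq {k : ℕ} {u : Config n → ℂ} (h : ∀ x, u x ≠ 0 → ones x = k) :
    collective n pauliZ *ᵥ u = ((n : ℂ) - 2 * k) • u := by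
  funext x
  rw [collective_pauliZ_mulVec, Pi.smul_apply, smul_eq_mul]
  by_cases hx : u x = 0
  · simp [hx]
  · rw [h x hx]

/-- A nonzero highest-weight vector has nonnegative weight, because
`‖S⁻ u‖² = N ‖u‖²`. -/
theorem IsHighestWeight.nonneg {N : ℝ} {u : Config n → ℂ} (h : IsHighestWeight (N : ℂ) u)
    (hu : u ≠ 0) : 0 ≤ N := by
  have h1 := h.star_lowering_dotProduct_lowering h 1 1
  have h2 : 0 ≤ star (collective n sigmaMinus ^ 1 *ᵥ u) ⬝ᵥ (collective n sigmaMinus ^ 1 *ᵥ u) :=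
    dotProduct_star_self_nonneg _
  have h3 : 0 < star u ⬝ᵥ u := dotProduct_star_self_pos_iff.mpr hu
  rw [h1] at h2
  simp only [if_true, Finset.prod_range_one, Nat.cast_zero, zero_add, one_mul, sub_zero] at h2
  rw [Complex.le_def] at h2
  rw [Complex.lt_def] at h3
  have h4 := h2.1
  simp only [Complex.zero_re, Complex.re_ofReal_mul] at h4 h3
  by_contra hN
  nlinarith [h3.1]

theorem blockVector_zero (w : MultiplicityBasis n) (m : Label n) (ν : Fin (multiplicity m)) :
    blockVector w m ν 0 = topVector w m ν := by
  simp [blockVector_eq, stringNorm_zero]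

/-- A highest-weight vector orthogonal to all chosen basis vectors vanishes. -/
theorem eq_zero_of_orthogonal_topVector (w : MultiplicityBasis n) {m : Label n} {u : Config n → ℂ}
    (h : IsHighestWeight ((n : ℂ) - 2 * (m : ℕ)) u)
    (horth : ∀ ν, star (topVector w m ν) ⬝ᵥ u = 0) : u = 0 := by
  let u' : highestWeightSpace m := ⟨WithLp.toLp 2 u, mem_highestWeightSpace.mpr h⟩
  have : u' = 0 := by
    rw [← (w m).sum_repr u']
    refine Finset.sum_eq_zero fun ν _ => ?_
    rw [OrthonormalBasis.repr_apply_apply, Submodule.coe_inner,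
      EuclideanSpace.inner_eq_star_dotProduct, dotProduct_comm]
    exact (congrArg (· • w m ν) (horth ν)).trans (zero_smul ℂ _)
  exact congrArg (fun v : highestWeightSpace m => (v : EuclideanSpace ℂ (Config n)).ofLp) this

/-- The blocks `ℋ_λ^ν` exhaust the space. The complementary projection commutes with the collective
operators, so it would map a basis vector that it does not kill, with the fewest qubits in the
state `|1⟩`, to a nonzero highest-weight vector orthogonal to all blocks. -/
theorem sum_blockMap (w : MultiplicityBasis n) :
    ∑ m : Label n, ∑ ν : Fin (multiplicity m), (blockMap w m ν)ᴴ * blockMap w m ν = 1 := by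
  set R : Op n := 1 - ∑ m : Label n, ∑ ν : Fin (multiplicity m), (blockMap w m ν)ᴴ * blockMap w m ν
    with hR
  have hcomm : ∀ A, IsBlockwise w A → A * R = R * A := by
    intro A hA
    refine Commute.eq ?_
    exact (Commute.one_right A).sub_right (Commute.sum_right _ _ _ fun m _ =>
      Commute.sum_right _ _ _ fun ν _ => hA m ν ν)
  have hQR : ∀ m ν, blockMap w m ν * R = 0 := by
    intro m ν
    rw [hR, Matrix.mul_sub, Matrix.mul_one, Matrix.mul_sum, sub_eq_zero,
      Finset.sum_eq_single m _ (by simp), Matrix.mul_sum, Finset.sum_eq_single ν _ (by simp)]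
    · rw [← Matrix.mul_assoc, blockMap_mul_conjTranspose_self, Matrix.one_mul]
    · intro ν' _ hν
      rw [← Matrix.mul_assoc, blockMap_mul_conjTranspose, if_neg hν.symm, Matrix.zero_mul]
    · intro m' _ hm
      rw [Matrix.mul_sum]
      refine Finset.sum_eq_zero fun ν' _ => ?_
      rw [← Matrix.mul_assoc, blockMap_mul_conjTranspose_of_ne w hm.symm, Matrix.zero_mul]
  have hweight : ∀ v : Config n → ℂ, ∀ A, IsBlockwise w A → A *ᵥ (R *ᵥ v) = R *ᵥ (A *ᵥ v) := by
    intro v A hA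
    rw [mulVec_mulVec, hcomm A hA, mulVec_mulVec]
  -- Raising `R e_y` gives a combination of vectors `R e_z` with one excitation fewer.
  have key : ∀ k : ℕ, ∀ y : Config n, ones y = k → R *ᵥ Pi.single y 1 = 0 := by
    intro k
    induction k using Nat.strong_induction_on with
    | _ k ih =>
      intro y hy
      have hZ : collective n pauliZ *ᵥ (Pi.single y 1 : Config n → ℂ) =
          ((n : ℂ) - 2 * k) • Pi.single y 1 := by
        refine weight_of_ones_eq fun x hx => ?_
        have : x = y := by
          by_contra hxy
          exact hx (by simp [hxy])
        rw [this, hy]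
      have hu : IsHighestWeight ((n : ℂ) - 2 * k) (R *ᵥ Pi.single y 1) := by
        refine ⟨?_, ?_⟩
        · rw [hweight _ _ (isBlockwise_raising w)]
          have hsupp := weight_raising hZ
          rw [show ((n : ℂ) - 2 * k + 2) = (n : ℂ) - 2 * ((k : ℂ) - 1) by ring] at hsupp
          set v := collective n sigmaPlus *ᵥ (Pi.single y 1 : Config n → ℂ)
          have hv : v = ∑ z, v z • (Pi.single z 1 : Config n → ℂ) := by
            funext x
            simp [Finset.sum_apply, Pi.single_apply]
          rw [hv, mulVec_sum]
          refine Finset.sum_eq_zero fun z _ => ?_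
          by_cases hz : v z = 0
          · rw [hz, zero_smul, mulVec_zero]
          · have h1 := ones_eq_of_weight hsupp hz
            have h2 : ones z + 1 = k := by
              have : ((ones z + 1 : ℕ) : ℂ) = k := by push_cast; rw [h1]; ring
              exact_mod_cast this
            rw [mulVec_smul, ih (ones z) (by omega) z rfl, smul_zero]
        · rw [hweight _ _ (isBlockwise_pauliZ w), hZ, mulVec_smul]
      by_cases hk : 2 * k ≤ n
      · refine eq_zero_of_orthogonal_topVector w (m := ⟨k, by omega⟩) hu fun ν => ?_
        have h1 := congrFun (congrArg (· *ᵥ (Pi.single y 1 : Config n → ℂ)) (hQR ⟨k, by omega⟩ ν)) 0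
        simp only [← mulVec_mulVec, zero_mulVec, Pi.zero_apply] at h1
        rw [← blockVector_zero]
        exact h1
      · by_contra hne
        have h1 : IsHighestWeight ((((n : ℝ) - 2 * k : ℝ)) : ℂ) (R *ᵥ Pi.single y 1) := by
          push_cast; exact hu
        have h2 := h1.nonneg hne
        have h3 : (n : ℝ) < 2 * k := by exact_mod_cast not_le.mp hk
        linarith
  have hR0 : R = 0 := by
    ext x y
    simpa using congrFun (key _ y rfl) x
  exact (sub_eq_zero.mp hR0).symm

/-- The trace is the sum of the traces over the blocks. -/
theorem trace_eq_sum_restrict (w : MultiplicityBasis n) (B : Op n) :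
    B.trace = ∑ m : Label n, ∑ ν : Fin (multiplicity m), (restrict w m ν B).trace := by
  conv_lhs => rw [← Matrix.one_mul B, ← sum_blockMap w]
  simp only [Matrix.sum_mul, trace_sum]
  refine Finset.sum_congr rfl fun m _ => Finset.sum_congr rfl fun ν _ => ?_
  rw [restrict, Matrix.mul_assoc, Matrix.mul_assoc, trace_mul_comm, Matrix.mul_assoc]

/-! ### Multiplicities are positive -/

theorem card_ones_eq (n k : ℕ) : Fintype.card {x : Config n // ones x = k} = n.choose k := by
  rw [← Fintype.card_fin n, ← Fintype.card_finset_len, Fintype.card_fin]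
  refine Fintype.card_congr ⟨fun x => ⟨Finset.univ.filter fun j => x.1 j = 1, x.2⟩,
    fun s => ⟨fun j => if j ∈ s.1 then 1 else 0, ?_⟩, fun x => ?_, fun s => ?_⟩
  · simpa [ones] using s.2
  · refine Subtype.ext (funext fun j => ?_)
    have : ∀ b : Fin 2, (if b = 1 then (1 : Fin 2) else 0) = b := by decide
    simpa using this (x.1 j)
  · refine Subtype.ext ?_
    ext j
    simp

theorem choose_lt_choose_succ {n k : ℕ} (h : 2 * (k + 1) ≤ n) :
    n.choose k < n.choose (k + 1) := by
  have h1 := Nat.choose_succ_right_eq n k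
  have h2 : 0 < n.choose k := Nat.choose_pos (by omega)
  obtain ⟨r, hr⟩ : ∃ r, n - k = k + 1 + (r + 1) := ⟨n - k - (k + 1) - 1, by omega⟩
  rw [hr] at h1
  by_contra hle
  nlinarith [not_lt.mp hle]

/-- Every two-row diagram occurs: the raising operator maps the vectors of weight `n - 2m` to
those of weight `n - 2m + 2`, a space of smaller dimension. -/
theorem multiplicity_pos (m : Label n) : 0 < multiplicity m := by
  have hm := two_mul_label_le m
  let ext : ({x : Config n // ones x = m} → ℂ) →ₗ[ℂ] (Config n → ℂ) :=
    Function.ExtendByZero.linearMap ℂ Subtype.val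
  let f : ({x : Config n // ones x = m} → ℂ) →ₗ[ℂ] ({x : Config n // ones x + 1 = m} → ℂ) :=
    LinearMap.funLeft ℂ ℂ Subtype.val ∘ₗ (collective n sigmaPlus).mulVecLin ∘ₗ ext
  have hcard : Fintype.card {x : Config n // ones x + 1 = m} <
      Fintype.card {x : Config n // ones x = m} := by
    rw [card_ones_eq]
    rcases h : (m : ℕ) with _ | k
    · simp
    · have := card_ones_eq n k
      simp only [Nat.add_right_cancel_iff, this]
      exact choose_lt_choose_succ (by omega)
  have hker : LinearMap.ker f ≠ ⊥ := LinearMap.ker_ne_bot_of_finrank_lt (by simpa using hcard)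
  obtain ⟨v, hv, hv0⟩ := (Submodule.ne_bot_iff _).mp hker
  have hext : ∀ x : {x : Config n // ones x = m}, ext v x = v x := fun x =>
    Subtype.val_injective.extend_apply v 0 x
  have hext' : ∀ x, ext v x ≠ 0 → ones x = m := by
    intro x hx
    by_contra h
    refine hx (Function.extend_apply' v (0 : Config n → ℂ) x ?_)
    rintro ⟨y, rfl⟩
    exact h y.2
  have hZ := weight_of_ones_eq hext'
  have hhw : IsHighestWeight ((n : ℂ) - 2 * (m : ℕ)) (ext v) := by
    refine ⟨?_, hZ⟩
    funext x
    by_contra hx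
    have h1 := weight_raising hZ
    rw [show ((n : ℂ) - 2 * (m : ℕ) + 2) = (n : ℂ) - 2 * ((m : ℕ) - 1 : ℂ) by ring] at h1
    have h2 := ones_eq_of_weight h1 hx
    have h3 : ones x + 1 = m := by
      have : ((ones x + 1 : ℕ) : ℂ) = (m : ℕ) := by push_cast; rw [h2]; ring
      exact_mod_cast this
    exact hx (congrFun (LinearMap.mem_ker.mp hv) ⟨x, h3⟩)
  have hmem : (WithLp.toLp 2 (ext v) : EuclideanSpace ℂ (Config n)) ∈ highestWeightSpace m :=
    mem_highestWeightSpace.mpr hhw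
  have : Nontrivial (highestWeightSpace m) := by
    refine (Submodule.nontrivial_iff_ne_bot).mpr ((Submodule.ne_bot_iff _).mpr ⟨_, hmem, ?_⟩)
    intro h
    refine hv0 (funext fun x => ?_)
    rw [← hext]
    exact congrFun (congrArg WithLp.ofLp h) x
  exact Module.finrank_pos

end Blocks

/-! ### Tensors invariant under the unitary group -/

section InvariantTensor

variable {d : ℕ}

/-- Invariance of a four-index tensor under `W ⊗ conj W ⊗ W ⊗ conj W` for all unitary `W`. -/
def IsInvariantTensor (t : Fin d → Fin d → Fin d → Fin d → ℂ) : Prop :=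
  ∀ W ∈ unitaryGroup (Fin d) ℂ, ∀ i j k l, t i j k l =
    ∑ a, ∑ b, ∑ c, ∑ e, W i a * star (W j b) * (W k c * star (W l e)) * t a b c e

variable {t : Fin d → Fin d → Fin d → Fin d → ℂ}

/-- Invariance under diagonal phases leaves only the entries in which the upper indices are a
rearrangement of the lower ones. -/
theorem IsInvariantTensor.eq_or_eq (h : IsInvariantTensor t) {i j k l : Fin d}
    (ht : t i j k l ≠ 0) : (i = j ∧ k = l) ∨ (i = l ∧ k = j) := by
  -- The phases `i` at one position `p` and `1` elsewhere suffice.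
  let z : Fin d → Fin d → ℂ := fun p a => if a = p then Complex.I else 1
  have hz : ∀ p a, z p a * star (z p a) = 1 := by
    intro p a
    by_cases hap : a = p <;> simp [z, hap]
  have hU : ∀ p, diagonal (z p) ∈ unitaryGroup (Fin d) ℂ := by
    intro p
    rw [mem_unitaryGroup_iff, star_eq_conjTranspose, diagonal_conjTranspose, diagonal_mul_diagonal,
      ← diagonal_one]
    congr 1
    funext a
    exact hz p a
  have hp : ∀ p, z p i * star (z p j) * (z p k * star (z p l)) = 1 := by
    intro p
    have h1 := h _ (hU p) i j k l
    simp only [diagonal_apply, apply_ite star, star_zero, ite_mul, mul_ite, zero_mul, mul_zero,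
      Finset.sum_ite_eq, Finset.mem_univ, if_true] at h1
    exact mul_right_cancel₀ ht (h1.symm.trans (one_mul _).symm)
  have hI1 : Complex.I ≠ 1 := fun h => by simpa using congrArg Complex.re h
  have hI2 : -Complex.I ≠ 1 := fun h => by simpa using congrArg Complex.re h
  have hI3 : (-1 : ℂ) ≠ 1 := by norm_num
  have hi : i = j ∨ i = l := by
    by_contra hc
    push Not at hc
    have := hp i
    by_cases hk : k = i <;> simp [z, hc.1.symm, hc.2.symm, hk, hI1, hI3] at this
  have hk : k = j ∨ k = l := by
    by_contra hc
    push Not at hc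
    have := hp k
    by_cases hk : i = k <;> simp [z, hc.1.symm, hc.2.symm, hk, hI1, hI3] at this
  rcases hi with hi | hi <;> rcases hk with hk | hk
  · left
    refine ⟨hi, ?_⟩
    by_contra hc
    have := hp l
    have hil : i ≠ l := by rw [hi, ← hk]; exact hc
    simp [z, hi ▸ hil, hc, hil, hI2] at this
  · exact Or.inl ⟨hi, hk⟩
  · exact Or.inr ⟨hi, hk⟩
  · right
    refine ⟨hi, ?_⟩
    by_contra hc
    have := hp j
    have hij : i ≠ j := by rw [hi, ← hk]; exact hc
    simp [z, hi ▸ hij, hc, hij, hI2] at this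

/-- Invariance under permutation matrices. -/
theorem IsInvariantTensor.perm (h : IsInvariantTensor t) (σ : Equiv.Perm (Fin d))
    (i j k l : Fin d) : t i j k l = t (σ i) (σ j) (σ k) (σ l) := by
  have hU : Matrix.of (fun i a : Fin d => if σ i = a then (1 : ℂ) else 0) ∈
      unitaryGroup (Fin d) ℂ := by
    rw [mem_unitaryGroup_iff]
    ext a b
    simp [mul_apply, Matrix.one_apply, eq_comm]
  have h1 := h _ hU i j k l
  simpa [of_apply, apply_ite star, ite_mul, mul_ite] using h1

/-- Invariance under a reflection mixing two coordinates relates the diagonal entries of the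
tensor to the other ones. The reflection along `e_i + 2 e_j` has the rational row
`(3/5, -4/5)`. -/
theorem IsInvariantTensor.diag (h : IsInvariantTensor t) {i j : Fin d} (hij : i ≠ j) :
    t i i i i = t i i j j + t i j j i := by
  let u : Fin d → ℂ := Pi.single i 1 + (2 : ℂ) • Pi.single j 1
  let W : Matrix (Fin d) (Fin d) ℂ := 1 - (2 / 5 : ℂ) • vecMulVec u u
  have huu : u ⬝ᵥ u = 5 := by
    simp [u, dotProduct_add, hij, hij.symm]
    norm_num
  have hWs : Wᴴ = W := by
    have hu : star u = u := by
      funext a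
      simp only [u, Pi.star_apply, Pi.add_apply, Pi.smul_apply, Pi.single_apply]
      split_ifs <;> simp
    simp [W, conjTranspose_sub, conjTranspose_smul, conjTranspose_vecMulVec, hu]
  have hU : W ∈ unitaryGroup (Fin d) ℂ := by
    rw [mem_unitaryGroup_iff, star_eq_conjTranspose, hWs]
    have : vecMulVec u u * vecMulVec u u = (5 : ℂ) • vecMulVec u u := by
      rw [vecMulVec_mul_vecMulVec, huu, vecMulVec_smul]
    simp only [W, Matrix.sub_mul, Matrix.mul_sub, Matrix.one_mul, Matrix.mul_one,
      Matrix.smul_mul, Matrix.mul_smul,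
      this]
    module
  have hrow : ∀ a, W i a = (if a = i then 3 / 5 else 0) + (if a = j then -4 / 5 else 0) := by
    intro a
    by_cases ha : a = i
    · subst ha
      simp [W, u, vecMulVec_apply, hij]
      norm_num
    · by_cases hb : a = j
      · subst hb
        simp [W, u, vecMulVec_apply, hij, hij.symm]
        norm_num
      · simp [W, u, vecMulVec_apply, ha, hb, Ne.symm ha, hij]
  have hstar : ∀ a, star (W i a) = W i a := by
    intro a
    rw [hrow]
    split_ifs <;> simp
  have h0 : ∀ {a b c e : Fin d}, ¬ ((a = b ∧ c = e) ∨ (a = e ∧ c = b)) → t a b c e = 0 := by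
    intro a b c e hne
    by_contra hc
    exact hne (h.eq_or_eq hc)
  have hs : ∀ a b c e, t a b c e = t (Equiv.swap i j a) (Equiv.swap i j b) (Equiv.swap i j c)
    (Equiv.swap i j e) := h.perm _
  have h1 : t j j j j = t i i i i := by rw [hs]; simp
  have h2 : t j j i i = t i i j j := by rw [hs]; simp
  have h3 : t j i i j = t i j j i := by rw [hs]; simp
  have h4 := h W hU i i i i
  have expand : ∀ f : Fin d → ℂ, ∑ a, W i a * f a = 3 / 5 * f i + -4 / 5 * f j := by
    intro f
    simp [hrow, add_mul, Finset.sum_add_distrib]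
  have h5 : t i i i i = ∑ a, W i a * ∑ b, W i b * ∑ c, W i c * ∑ e, W i e * t a b c e := by
    rw [h4]
    simp only [Finset.mul_sum, hstar]
    refine Finset.sum_congr rfl fun a _ => Finset.sum_congr rfl fun b _ =>
      Finset.sum_congr rfl fun c _ => Finset.sum_congr rfl fun e _ => ?_
    ring
  simp only [expand] at h5
  rw [h0 (a := i) (b := i) (c := i) (e := j) (by simp [hij]),
    h0 (a := i) (b := i) (c := j) (e := i) (by simp [hij.symm]),
    h0 (a := i) (b := j) (c := i) (e := i) (by simp [hij]),
    h0 (a := i) (b := j) (c := i) (e := j) (by simp [hij]),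
    h0 (a := i) (b := j) (c := j) (e := j) (by simp [hij]),
    h0 (a := j) (b := i) (c := i) (e := i) (by simp [hij.symm]),
    h0 (a := j) (b := i) (c := j) (e := i) (by simp [hij.symm]),
    h0 (a := j) (b := i) (c := j) (e := j) (by simp [hij.symm]),
    h0 (a := j) (b := j) (c := i) (e := j) (by simp [hij]),
    h0 (a := j) (b := j) (c := j) (e := i) (by simp [hij.symm]), h1, h2, h3] at h5
  -- `288 / 625 = 1 - (3/5)⁴ - (4/5)⁴ = 2 (3/5)² (4/5)²`
  linear_combination (625 / 288 : ℂ) * h5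

/-- An invariant four-index tensor is a combination of the identity and the swap; the coefficient
of the swap is determined by the two traces. -/
theorem IsInvariantTensor.exists_eq (h : IsInvariantTensor t) {s₁ s₂ : ℂ}
    (h₁ : ∑ i, ∑ j, t i i j j = s₁) (h₂ : ∑ i, ∑ j, t i j j i = s₂) :
    ∃ β : ℂ, ∀ i j k l, t i j k l =
      β * ((if i = j then 1 else 0) * (if k = l then 1 else 0)) +
      (s₂ - s₁ / d) / ((d : ℂ) ^ 2 - 1) * ((if i = l then 1 else 0) * (if k = j then 1 else 0)) := by
  by_cases hd : ∃ i j : Fin d, i ≠ j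
  · obtain ⟨p, q, hpq⟩ := hd
    have hperm : ∀ i j, i ≠ j → ∃ σ : Equiv.Perm (Fin d), σ i = p ∧ σ j = q := by
      intro i j hij
      refine ⟨(Equiv.swap i p).trans (Equiv.swap (Equiv.swap i p j) q), ?_, ?_⟩
      · have hne : Equiv.swap i p j ≠ p := by
          intro hc
          apply hij
          apply (Equiv.swap i p).injective
          simp [hc]
        simp [Equiv.swap_apply_of_ne_of_ne hne.symm hpq]
      · simp
    have hform : ∀ i j k l, t i j k l =
        t p p q q * ((if i = j then 1 else 0) * (if k = l then 1 else 0)) +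
        t p q q p * ((if i = l then 1 else 0) * (if k = j then 1 else 0)) := by
      intro i j k l
      by_cases hne : (i = j ∧ k = l) ∨ (i = l ∧ k = j)
      · rcases hne with ⟨rfl, rfl⟩ | ⟨rfl, rfl⟩
        · by_cases hik : i = k
          · subst hik
            obtain ⟨j, hj⟩ : ∃ j, i ≠ j := by
              by_cases hip : i = p
              · exact ⟨q, hip ▸ hpq⟩
              · exact ⟨p, hip⟩
            obtain ⟨σ, rfl, rfl⟩ := hperm i j hj
            rw [h.diag hj, h.perm σ i i j j, h.perm σ i j j i]
            simp
          · obtain ⟨σ, rfl, rfl⟩ := hperm i k hik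
            rw [h.perm σ]
            simp [hik]
        · by_cases hik : i = k
          · subst hik
            obtain ⟨j, hj⟩ : ∃ j, i ≠ j := by
              by_cases hip : i = p
              · exact ⟨q, hip ▸ hpq⟩
              · exact ⟨p, hip⟩
            obtain ⟨σ, rfl, rfl⟩ := hperm i j hj
            rw [h.diag hj, h.perm σ i i j j, h.perm σ i j j i]
            simp
          · obtain ⟨σ, rfl, rfl⟩ := hperm i k hik
            rw [h.perm σ]
            simp [hik]
      · have h0 : t i j k l = 0 := by
          by_contra hc
          exact hne (h.eq_or_eq hc)
        have h1 : (if i = j then (1 : ℂ) else 0) * (if k = l then 1 else 0) = 0 := by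
          by_cases h1 : i = j
          · rw [if_neg fun h2 => hne (Or.inl ⟨h1, h2⟩), mul_zero]
          · rw [if_neg h1, zero_mul]
        have h2 : (if i = l then (1 : ℂ) else 0) * (if k = j then 1 else 0) = 0 := by
          by_cases h2 : i = l
          · rw [if_neg fun h3 => hne (Or.inr ⟨h2, h3⟩), mul_zero]
          · rw [if_neg h2, zero_mul]
        rw [h0, h1, h2]
        simp
    obtain ⟨β, γ, hform⟩ : ∃ β γ : ℂ, ∀ i j k l, t i j k l =
        β * ((if i = j then 1 else 0) * (if k = l then 1 else 0)) +
        γ * ((if i = l then 1 else 0) * (if k = j then 1 else 0)) := ⟨_, _, hform⟩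
    refine ⟨β, ?_⟩
    have e1 : s₁ = (d : ℂ) ^ 2 * β + d * γ := by
      rw [← h₁]
      simp only [hform]
      simp [Finset.sum_add_distrib]
      ring
    have e2 : s₂ = (d : ℂ) * β + (d : ℂ) ^ 2 * γ := by
      rw [← h₂]
      simp only [hform]
      simp [Finset.sum_add_distrib]
      ring
    have hd2 : 2 ≤ d := by
      have h1 := p.2
      have h2 := q.2
      have h3 : (p : ℕ) ≠ q := fun hc => hpq (Fin.ext hc)
      omega
    have hd0 : (d : ℂ) ≠ 0 := by
      have : d ≠ 0 := by omega
      exact_mod_cast this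
    have hd1 : (d : ℂ) ^ 2 - 1 ≠ 0 := by
      intro hc
      have : d ^ 2 = 1 := by exact_mod_cast sub_eq_zero.mp hc
      nlinarith
    have e3 : (s₂ - s₁ / d) / ((d : ℂ) ^ 2 - 1) = γ := by
      rw [div_eq_iff hd1, e1, e2]
      field_simp
      ring
    rw [e3]
    exact hform
  · -- For `d ≤ 1` identity and swap agree, so that the coefficient of the swap does not matter.
    push Not at hd
    rcases isEmpty_or_nonempty (Fin d) with he | ⟨⟨p⟩⟩
    · exact ⟨0, fun i => he.elim i⟩
    · have hp : ∀ i, i = p := fun i => hd i p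
      have hd1 : d = 1 := by
        have := Fintype.card_le_one_iff.mpr hd
        have := p.2
        rw [Fintype.card_fin] at *
        omega
      refine ⟨t p p p p, fun i j k l => ?_⟩
      have hd' : (d : ℂ) = 1 := by exact_mod_cast hd1
      rw [hp i, hp j, hp k, hp l, hd']
      simp

end InvariantTensor

theorem integral_sum₂ {Ω ι κ : Type*} [Fintype ι] [Fintype κ] [MeasurableSpace Ω] {P : Measure Ω}
    {f : ι → κ → Ω → ℂ} (hf : ∀ a b, Integrable (f a b) P) :
    ∫ x, ∑ a, ∑ b, f a b x ∂P = ∑ a, ∑ b, ∫ x, f a b x ∂P := by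
  rw [integral_finsetSum _ fun a _ => integrable_finsetSum _ fun b _ => hf a b]
  exact Finset.sum_congr rfl fun a _ => integral_finsetSum _ fun b _ => hf a b

theorem integral_sum₄ {Ω ι κ ι' κ' : Type*} [Fintype ι] [Fintype κ] [Fintype ι'] [Fintype κ']
    [MeasurableSpace Ω] {P : Measure Ω} {f : ι → κ → ι' → κ' → Ω → ℂ}
    (hf : ∀ a b c e, Integrable (f a b c e) P) :
    ∫ x, ∑ a, ∑ b, ∑ c, ∑ e, f a b c e x ∂P = ∑ a, ∑ b, ∑ c, ∑ e, ∫ x, f a b c e x ∂P := by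
  rw [integral_sum₂ fun a b => integrable_finsetSum _ fun c _ => integrable_finsetSum _ fun e _ =>
    hf a b c e]
  exact Finset.sum_congr rfl fun a _ => Finset.sum_congr rfl fun b _ => integral_sum₂ (hf a b)

/-! ### Twirling over the Haar measure -/

theorem haarUnitary_isHaarMeasure (d : ℕ) : (haarUnitary d).IsHaarMeasure := by
  unfold haarUnitary; infer_instance

theorem haarUnitary_isProbabilityMeasure (d : ℕ) : IsProbabilityMeasure (haarUnitary d) := by
  refine ⟨?_⟩
  have := Measure.haarMeasure_self (G := unitaryGroup (Fin d) ℂ) (K₀ := ⊤)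
  simpa [haarUnitary] using this

attribute [local instance] haarUnitary_isHaarMeasure haarUnitary_isProbabilityMeasure

/-- Compact groups are unimodular: a right translate of the Haar probability measure is again
a Haar probability measure. -/
theorem haarUnitary_isMulRightInvariant (d : ℕ) : (haarUnitary d).IsMulRightInvariant := by
  refine ⟨fun g => ?_⟩
  have : IsProbabilityMeasure (Measure.map (· * g) (haarUnitary d)) :=
    Measure.isProbabilityMeasure_map (by fun_prop)
  exact Measure.isHaarMeasure_eq_of_isProbabilityMeasure _ _

attribute [local instance] haarUnitary_isMulRightInvariant

theorem integrable_haarUnitary {d : ℕ} {f : unitaryGroup (Fin d) ℂ → ℂ} (hf : Continuous f) :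
    Integrable f (haarUnitary d) :=
  hf.integrable_of_hasCompactSupport (HasCompactSupport.of_compactSpace f)

/-- The coefficient of the swap in the second-order twirl of `M ⊗ N`. For `d = 1` it is `0`, by
division by zero; there the swap is the identity and its coefficient is arbitrary. -/
noncomputable def swapCoeff {d : ℕ} (M N : Matrix (Fin d) (Fin d) ℂ) : ℂ :=
  ((M * N).trace - M.trace * N.trace / d) / ((d : ℂ) ^ 2 - 1)

theorem swapCoeff_one {d : ℕ} [NeZero d] (M : Matrix (Fin d) (Fin d) ℂ) : swapCoeff M 1 = 0 := by
  simp [swapCoeff, NeZero.ne d]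

/-- Second-order twirl along a random unitary `g U` whose law is left invariant. -/
theorem exists_twirl_of_invariant {d : ℕ} {g : unitaryGroup (Fin d) ℂ → unitaryGroup (Fin d) ℂ}
    (hg : Continuous g)
    (hinv : ∀ (W : unitaryGroup (Fin d) ℂ) (F : unitaryGroup (Fin d) ℂ → ℂ),
      ∫ U, F (W * g U) ∂(haarUnitary d) = ∫ U, F (g U) ∂(haarUnitary d))
    (M N : Matrix (Fin d) (Fin d) ℂ) :
    ∃ β : ℂ, ∀ i j k l,
      ∫ U, ((g U : Matrix (Fin d) (Fin d) ℂ) * M * (g U : Matrix (Fin d) (Fin d) ℂ)ᴴ) i j *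
        ((g U : Matrix (Fin d) (Fin d) ℂ) * N * (g U : Matrix (Fin d) (Fin d) ℂ)ᴴ) k l
          ∂(haarUnitary d) =
      β * ((if i = j then 1 else 0) * (if k = l then 1 else 0)) +
        swapCoeff M N * ((if i = l then 1 else 0) * (if k = j then 1 else 0)) := by
  let T : Matrix (Fin d) (Fin d) ℂ → unitaryGroup (Fin d) ℂ → Matrix (Fin d) (Fin d) ℂ :=
    fun M U => (U : Matrix (Fin d) (Fin d) ℂ) * M * (U : Matrix (Fin d) (Fin d) ℂ)ᴴ
  have hcont : ∀ M, Continuous fun U => T M (g U) := fun M => by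
    have : Continuous fun U => (g U : Matrix (Fin d) (Fin d) ℂ) := continuous_subtype_val.comp hg
    exact (this.matrix_mul continuous_const).matrix_mul this.matrix_conjTranspose
  have hint : ∀ i j k l, Integrable (fun U => T M (g U) i j * T N (g U) k l) (haarUnitary d) :=
    fun i j k l => integrable_haarUnitary
      (((hcont M).matrix_elem i j).mul ((hcont N).matrix_elem k l))
  have htr : ∀ M U, (T M U).trace = M.trace := by
    intro M U
    have hU : (U : Matrix (Fin d) (Fin d) ℂ)ᴴ * U = 1 := mem_unitaryGroup_iff'.mp U.2
    simp only [T]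
    rw [Matrix.mul_assoc, trace_mul_comm, Matrix.mul_assoc, hU, Matrix.mul_one]
  have hmul : ∀ M N U, T M U * T N U = T (M * N) U := by
    intro M N U
    have hU : (U : Matrix (Fin d) (Fin d) ℂ)ᴴ * U = 1 := mem_unitaryGroup_iff'.mp U.2
    simp only [T]
    calc _ = (U : Matrix (Fin d) (Fin d) ℂ) * M * ((U : Matrix (Fin d) (Fin d) ℂ)ᴴ * U) * N *
        (U : Matrix (Fin d) (Fin d) ℂ)ᴴ := by simp only [Matrix.mul_assoc]
      _ = _ := by rw [hU, Matrix.mul_one]; simp only [Matrix.mul_assoc]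
  have hT : ∀ (W U : unitaryGroup (Fin d) ℂ) M i j, T M (W * U) i j =
      ∑ a, ∑ b, (W : Matrix (Fin d) (Fin d) ℂ) i a * star ((W : Matrix (Fin d) (Fin d) ℂ) j b) *
        T M U a b := by
    intro W U M i j
    have : T M (W * U) = (W : Matrix (Fin d) (Fin d) ℂ) * T M U *
        (W : Matrix (Fin d) (Fin d) ℂ)ᴴ := by
      simp only [T, Submonoid.coe_mul, conjTranspose_mul, Matrix.mul_assoc]
    rw [this, mul_apply]
    simp only [mul_apply, Finset.sum_mul, conjTranspose_apply]
    rw [Finset.sum_comm]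
    refine Finset.sum_congr rfl fun a _ => Finset.sum_congr rfl fun b _ => ?_
    ring
  have h : IsInvariantTensor fun i j k l => ∫ U, T M (g U) i j * T N (g U) k l ∂(haarUnitary d) := by
    intro W hW i j k l
    simp only
    rw [← hinv ⟨W, hW⟩ fun U => T M U i j * T N U k l]
    simp only [← integral_const_mul]
    rw [← integral_sum₄ fun a b c e => (hint a b c e).const_mul _]
    refine integral_congr_ae (.of_forall fun U => ?_)
    simp only [hT, Finset.sum_mul]
    refine Finset.sum_congr rfl fun a _ => Finset.sum_congr rfl fun b _ => ?_
    rw [Finset.mul_sum]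
    refine Finset.sum_congr rfl fun c _ => ?_
    rw [Finset.mul_sum]
    refine Finset.sum_congr rfl fun e _ => ?_
    ring
  refine h.exists_eq ?_ ?_
  · rw [← integral_sum₂ fun i j => hint i i j j]
    have : ∀ U, ∑ i, ∑ j, T M (g U) i i * T N (g U) j j = M.trace * N.trace := by
      intro U
      rw [← htr M (g U), ← htr N (g U), trace, trace, Finset.sum_mul_sum]
      rfl
    simp [this]
  · rw [← integral_sum₂ fun i j => hint i j j i]
    have : ∀ U, ∑ i, ∑ j, T M (g U) i j * T N (g U) j i = (M * N).trace := by
      intro U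
      rw [← htr (M * N) (g U), ← hmul, trace]
      simp [mul_apply]
    simp [this]

/-- A map `g` such that `g U` has a left invariant law for Haar distributed `U`. -/
structure HasInvariantLaw {d : ℕ} (g : unitaryGroup (Fin d) ℂ → unitaryGroup (Fin d) ℂ) : Prop where
  continuous : Continuous g
  integral_mul : ∀ (W : unitaryGroup (Fin d) ℂ) (F : unitaryGroup (Fin d) ℂ → ℂ),
    ∫ U, F (W * g U) ∂(haarUnitary d) = ∫ U, F (g U) ∂(haarUnitary d)

theorem hasInvariantLaw_id (d : ℕ) :
    HasInvariantLaw (fun U : unitaryGroup (Fin d) ℂ => U) where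
  continuous := continuous_id
  integral_mul W F := integral_mul_left_eq_self F W

theorem hasInvariantLaw_inv (d : ℕ) :
    HasInvariantLaw (fun U : unitaryGroup (Fin d) ℂ => U⁻¹) where
  continuous := continuous_inv
  integral_mul W F := by
    rw [← integral_mul_right_eq_self (fun U => F U⁻¹) W⁻¹]
    simp

/-- The conjugate `U M U†`. -/
def conjBy {d : ℕ} (U M : Matrix (Fin d) (Fin d) ℂ) : Matrix (Fin d) (Fin d) ℂ := U * M * Uᴴ

theorem continuous_conjBy_apply {d : ℕ} {g : unitaryGroup (Fin d) ℂ → unitaryGroup (Fin d) ℂ}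
    (hg : Continuous g) (M : Matrix (Fin d) (Fin d) ℂ) (i j : Fin d) :
    Continuous fun U => conjBy (g U : Matrix (Fin d) (Fin d) ℂ) M i j := by
  have : Continuous fun U => (g U : Matrix (Fin d) (Fin d) ℂ) := continuous_subtype_val.comp hg
  exact ((this.matrix_mul continuous_const).matrix_mul this.matrix_conjTranspose).matrix_elem i j

theorem conjBy_one {d : ℕ} (U : unitaryGroup (Fin d) ℂ) :
    conjBy (U : Matrix (Fin d) (Fin d) ℂ) 1 = 1 := by
  rw [conjBy, Matrix.mul_one]
  exact mem_unitaryGroup_iff.mp U.2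

/-- First-order twirl: it follows from the second-order one with `N = 1`. -/
theorem exists_integral_conjBy {d : ℕ} [NeZero d]
    {g : unitaryGroup (Fin d) ℂ → unitaryGroup (Fin d) ℂ}
    (hg : HasInvariantLaw g) (M : Matrix (Fin d) (Fin d) ℂ) :
    ∃ β : ℂ, ∀ i j, ∫ U, conjBy (g U : Matrix (Fin d) (Fin d) ℂ) M i j ∂(haarUnitary d) =
      β * (if i = j then 1 else 0) := by
  obtain ⟨β, hβ⟩ := exists_twirl_of_invariant hg.continuous hg.integral_mul M 1
  refine ⟨β, fun i j => ?_⟩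
  have h1 := hβ i j 0 0
  change ∫ U, conjBy (g U : Matrix (Fin d) (Fin d) ℂ) M i j *
    conjBy (g U : Matrix (Fin d) (Fin d) ℂ) 1 0 0 ∂(haarUnitary d) = _ at h1
  simpa [conjBy_one, swapCoeff_one] using h1

/-- The marginal of a single block is the Haar measure. -/
theorem integral_blockHaar {n : ℕ} (m : Label n)
    {f : unitaryGroup (Fin (blockDim m)) ℂ → ℂ} (hf : Continuous f) :
    ∫ U, f (U m) ∂(blockHaar n) = ∫ U, f U ∂(haarUnitary (blockDim m)) := by
  have h := measurePreserving_eval (fun m : Label n => haarUnitary (blockDim m)) m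
  rw [← h.map_eq, integral_map h.measurable.aemeasurable hf.aestronglyMeasurable]
  rfl

/-- Distinct blocks are independent. -/
theorem integral_blockHaar_mul {n : ℕ} {m m' : Label n} (hm : m ≠ m')
    {f : unitaryGroup (Fin (blockDim m)) ℂ → ℂ} (hf : Continuous f)
    {f' : unitaryGroup (Fin (blockDim m')) ℂ → ℂ} (hf' : Continuous f') :
    ∫ U, f (U m) * f' (U m') ∂(blockHaar n) =
      (∫ U, f U ∂(haarUnitary (blockDim m))) * ∫ U, f' U ∂(haarUnitary (blockDim m')) := by
  rw [← integral_blockHaar m hf, ← integral_blockHaar m' hf']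
  have hind := (iIndepFun_pi (μ := fun m : Label n => haarUnitary (blockDim m))
    (X := fun m (U : unitaryGroup (Fin (blockDim m)) ℂ) => U)
    fun m => aemeasurable_id).indepFun hm
  exact hind.integral_fun_comp_mul_comp (measurable_pi_apply m).aemeasurable
    (measurable_pi_apply m').aemeasurable hf.aestronglyMeasurable hf'.aestronglyMeasurable

section BlockTwirl

variable {n : ℕ} {g : ∀ d, unitaryGroup (Fin d) ℂ → unitaryGroup (Fin d) ℂ}

theorem exists_blockTwirl (hg : ∀ d, HasInvariantLaw (g d)) (m : Label n) (M N : BlockOp m) :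
    ∃ β : ℂ, ∀ i j k l,
      ∫ U, conjBy (g _ (U m) : BlockOp m) M i j * conjBy (g _ (U m) : BlockOp m) N k l
          ∂(blockHaar n) =
      β * ((if i = j then 1 else 0) * (if k = l then 1 else 0)) +
        swapCoeff M N * ((if i = l then 1 else 0) * (if k = j then 1 else 0)) := by
  obtain ⟨β, hβ⟩ := exists_twirl_of_invariant (hg (blockDim m)).continuous
    (hg (blockDim m)).integral_mul M N
  refine ⟨β, fun i j k l => ?_⟩
  rw [← hβ]
  exact integral_blockHaar m (f := fun V => conjBy (g _ V : BlockOp m) M i j *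
    conjBy (g _ V : BlockOp m) N k l)
    ((continuous_conjBy_apply (hg _).continuous M i j).mul
      (continuous_conjBy_apply (hg _).continuous N k l))

theorem exists_blockTwirl_of_ne (hg : ∀ d, HasInvariantLaw (g d)) {m m' : Label n} (hm : m ≠ m')
    (M : BlockOp m) (N : BlockOp m') :
    ∃ β : ℂ, ∀ i j k l,
      ∫ U, conjBy (g _ (U m) : BlockOp m) M i j * conjBy (g _ (U m') : BlockOp m') N k l
          ∂(blockHaar n) =
      β * ((if i = j then 1 else 0) * (if k = l then 1 else 0)) := by
  obtain ⟨β, hβ⟩ := exists_integral_conjBy (hg (blockDim m)) M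
  obtain ⟨β', hβ'⟩ := exists_integral_conjBy (hg (blockDim m')) N
  refine ⟨β * β', fun i j k l => ?_⟩
  refine (integral_blockHaar_mul hm (continuous_conjBy_apply (hg _).continuous M i j)
    (continuous_conjBy_apply (hg _).continuous N k l)).trans ?_
  rw [hβ, hβ']
  ring

end BlockTwirl

/-! ### From the two-design property to Haar moments -/

theorem conjBy_eq_sum_adEntry {n : ℕ} (U : ∀ m : Label n, BlockOp m) (m : Label n)
    (M : BlockOp m) (i j : Fin (blockDim m)) :
    conjBy (U m) M i j =
      ∑ r : Fin (blockDim m) × Fin (blockDim m), M r.1 r.2 * adEntry U ⟨m, (i, r.1), (j, r.2)⟩ := by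
  rw [conjBy, mul_apply, Fintype.sum_prod_type_right]
  refine Finset.sum_congr rfl fun q _ => ?_
  rw [mul_apply, Finset.sum_mul]
  refine Finset.sum_congr rfl fun p _ => ?_
  simp only [adEntry, conjTranspose_apply]
  ring

theorem conjBy_conjTranspose_eq_sum_adEntry {n : ℕ} (U : ∀ m : Label n, BlockOp m) (m : Label n)
    (M : BlockOp m) (i j : Fin (blockDim m)) :
    conjBy (U m)ᴴ M i j =
      ∑ r : Fin (blockDim m) × Fin (blockDim m), M r.1 r.2 * adEntry U ⟨m, (r.2, j), (r.1, i)⟩ := by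
  rw [conjBy, mul_apply, Fintype.sum_prod_type_right]
  refine Finset.sum_congr rfl fun q _ => ?_
  rw [mul_apply, Finset.sum_mul]
  refine Finset.sum_congr rfl fun p _ => ?_
  simp only [adEntry, conjTranspose_apply, star_star]
  ring

/-- Second countability makes the Borel structure on the product over the blocks the product of the
Borel structures, so that continuous functions on it are measurable. -/
instance unitaryGroup_secondCountable (d : ℕ) :
    SecondCountableTopology (unitaryGroup (Fin d) ℂ) := by
  have : SecondCountableTopology (Matrix (Fin d) (Fin d) ℂ) :=
    inferInstanceAs (SecondCountableTopology (Fin d → Fin d → ℂ))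
  exact TopologicalSpace.Subtype.secondCountableTopology _

theorem integrable_blockHaar {n : ℕ} {f : (∀ m : Label n, unitaryGroup (Fin (blockDim m)) ℂ) → ℂ}
    (hf : Continuous f) : Integrable f (blockHaar n) := by
  have : IsFiniteMeasure (blockHaar n) := by unfold blockHaar; infer_instance
  exact hf.integrable_of_hasCompactSupport (HasCompactSupport.of_compactSpace f)

theorem continuous_adEntry {n : ℕ} (a : EntryIndex n) :
    Continuous fun U : ∀ m : Label n, unitaryGroup (Fin (blockDim m)) ℂ =>
      adEntry (fun m => (U m : BlockOp m)) a := by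
  have h : Continuous fun U : ∀ m : Label n, unitaryGroup (Fin (blockDim m)) ℂ =>
      (U a.1 : BlockOp a.1) := continuous_subtype_val.comp (continuous_apply a.1)
  exact (h.matrix_elem _ _).mul (h.matrix_elem _ _).star

theorem integral_sum_mul_sum_blockHaar {n : ℕ} {ι κ : Type*} [Fintype ι] [Fintype κ] (c : ι → ℂ)
    (a : ι → EntryIndex n) (c' : κ → ℂ) (a' : κ → EntryIndex n) :
    ∫ U, (∑ r, c r * adEntry (fun m => (U m : BlockOp m)) (a r)) *
      (∑ r, c' r * adEntry (fun m => (U m : BlockOp m)) (a' r)) ∂(blockHaar n) =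
    ∑ r, ∑ r', c r * c' r' * haarMoment (a r) (a' r') := by
  have hint : ∀ r r', Integrable (fun U : ∀ m : Label n, unitaryGroup (Fin (blockDim m)) ℂ =>
      c r * adEntry (fun m => (U m : BlockOp m)) (a r) *
        (c' r' * adEntry (fun m => (U m : BlockOp m)) (a' r'))) (blockHaar n) := fun r r' =>
    integrable_blockHaar ((continuous_const.mul (continuous_adEntry (a r))).mul
      (continuous_const.mul (continuous_adEntry (a' r'))))
  simp only [Finset.sum_mul_sum]
  rw [integral_sum₂ hint]
  refine Finset.sum_congr rfl fun r _ => Finset.sum_congr rfl fun r' _ => ?_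
  rw [haarMoment, ← integral_const_mul]
  refine integral_congr_ae (.of_forall fun U => ?_)
  simp only
  ring

section Design

variable {n : ℕ} {Θ : Type*} [MeasurableSpace Θ] {P : Measure Θ}
  {A B : Θ → ∀ m : Label n, BlockOp m}

/-- All products of four entries occurring in the two-design condition are integrable. -/
def IntegrableEntries (P : Measure Θ) (A B : Θ → ∀ m : Label n, BlockOp m) : Prop :=
  ∀ a a' b b' : EntryIndex n, Integrable
    (fun θ => adEntry (A θ) a * adEntry (A θ) a' * (adEntry (B θ) b * adEntry (B θ) b')) P

theorem sum_mul_sum_mul {ι κ ι' κ' : Type*} [Fintype ι] [Fintype κ] [Fintype ι'] [Fintype κ']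
    (f : ι → ℂ) (g : κ → ℂ) (f' : ι' → ℂ) (g' : κ' → ℂ) :
    (∑ a, f a) * (∑ b, g b) * ((∑ c, f' c) * ∑ e, g' e) =
      ∑ a, ∑ b, ∑ c, ∑ e, f a * g b * (f' c * g' e) := by
  rw [Finset.sum_mul_sum, Finset.sum_mul_sum, Finset.sum_mul]
  refine Finset.sum_congr rfl fun a _ => ?_
  rw [Finset.sum_mul]
  refine Finset.sum_congr rfl fun b _ => ?_
  rw [Finset.mul_sum]
  refine Finset.sum_congr rfl fun c _ => ?_
  rw [Finset.mul_sum]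

/-- The two-design condition for linear combinations of entries. -/
theorem IndependentTwoDesigns.integral_sum (h : IndependentTwoDesigns P A B)
    (hint : IntegrableEntries P A B) {ι κ ι' κ' : Type*} [Fintype ι] [Fintype κ] [Fintype ι']
    [Fintype κ'] (c : ι → ℂ) (a : ι → EntryIndex n) (c' : κ → ℂ) (a' : κ → EntryIndex n)
    (e : ι' → ℂ) (b : ι' → EntryIndex n) (e' : κ' → ℂ) (b' : κ' → EntryIndex n) :
    (Integrable (fun θ => (∑ r, c r * adEntry (A θ) (a r)) * (∑ r, c' r * adEntry (A θ) (a' r)) *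
      ((∑ r, e r * adEntry (B θ) (b r)) * (∑ r, e' r * adEntry (B θ) (b' r)))) P) ∧
    ∫ θ, (∑ r, c r * adEntry (A θ) (a r)) * (∑ r, c' r * adEntry (A θ) (a' r)) *
      ((∑ r, e r * adEntry (B θ) (b r)) * (∑ r, e' r * adEntry (B θ) (b' r))) ∂P =
    (∫ U, (∑ r, c r * adEntry (fun m => (U m : BlockOp m)) (a r)) *
        (∑ r, c' r * adEntry (fun m => (U m : BlockOp m)) (a' r)) ∂(blockHaar n)) *
      ∫ U, (∑ r, e r * adEntry (fun m => (U m : BlockOp m)) (b r)) *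
        (∑ r, e' r * adEntry (fun m => (U m : BlockOp m)) (b' r)) ∂(blockHaar n) := by
  have hterm : ∀ r r' s s', Integrable (fun θ => c r * adEntry (A θ) (a r) *
      (c' r' * adEntry (A θ) (a' r')) *
      (e s * adEntry (B θ) (b s) * (e' s' * adEntry (B θ) (b' s')))) P := by
    intro r r' s s'
    refine ((hint (a r) (a' r') (b s) (b' s')).const_mul (c r * c' r' * (e s * e' s'))).congr
      (.of_forall fun θ => ?_)
    simp only
    ring
  simp only [sum_mul_sum_mul]
  refine ⟨integrable_finsetSum _ fun r _ => integrable_finsetSum _ fun r' _ =>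
    integrable_finsetSum _ fun s _ => integrable_finsetSum _ fun s' _ => hterm r r' s s', ?_⟩
  rw [integral_sum₄ hterm, integral_sum_mul_sum_blockHaar, integral_sum_mul_sum_blockHaar,
    Finset.sum_mul]
  refine Finset.sum_congr rfl fun r _ => ?_
  rw [Finset.sum_mul]
  refine Finset.sum_congr rfl fun r' _ => ?_
  rw [Finset.mul_sum]
  refine Finset.sum_congr rfl fun s _ => ?_
  rw [Finset.mul_sum]
  refine Finset.sum_congr rfl fun s' _ => ?_
  rw [mul_mul_mul_comm, ← h, ← integral_const_mul]
  refine integral_congr_ae (.of_forall fun U => ?_)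
  simp only
  ring

/-- The two-design condition for conjugated operators. -/
theorem IndependentTwoDesigns.integral_conjBy (h : IndependentTwoDesigns P A B)
    (hint : IntegrableEntries P A B) (m m' : Label n) (N M : BlockOp m) (N' M' : BlockOp m')
    (q p : Fin (blockDim m) × Fin (blockDim m)) (q' p' : Fin (blockDim m') × Fin (blockDim m')) :
    (Integrable (fun θ => conjBy (A θ m)ᴴ N q.1 q.2 * conjBy (A θ m')ᴴ N' q'.1 q'.2 *
      (conjBy (B θ m) M p.1 p.2 * conjBy (B θ m') M' p'.1 p'.2)) P) ∧
    ∫ θ, conjBy (A θ m)ᴴ N q.1 q.2 * conjBy (A θ m')ᴴ N' q'.1 q'.2 *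
      (conjBy (B θ m) M p.1 p.2 * conjBy (B θ m') M' p'.1 p'.2) ∂P =
    (∫ U, conjBy ((U m)⁻¹ : unitaryGroup _ ℂ).1 N q.1 q.2 *
        conjBy ((U m')⁻¹ : unitaryGroup _ ℂ).1 N' q'.1 q'.2 ∂(blockHaar n)) *
      ∫ U, conjBy (U m).1 M p.1 p.2 * conjBy (U m').1 M' p'.1 p'.2 ∂(blockHaar n) := by
  have e1 : ∀ (U : ∀ m : Label n, unitaryGroup (Fin (blockDim m)) ℂ) m (N : BlockOp m) i j,
      conjBy ((U m)⁻¹ : unitaryGroup _ ℂ).1 N i j =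
      ∑ r : Fin (blockDim m) × Fin (blockDim m), N r.1 r.2 *
        adEntry (fun m => (U m : BlockOp m)) ⟨m, (r.2, j), (r.1, i)⟩ := fun U m N i j =>
    conjBy_conjTranspose_eq_sum_adEntry (fun m => (U m : BlockOp m)) m N i j
  have e2 : ∀ (U : ∀ m : Label n, unitaryGroup (Fin (blockDim m)) ℂ) m (N : BlockOp m) i j,
      conjBy (U m).1 N i j =
      ∑ r : Fin (blockDim m) × Fin (blockDim m), N r.1 r.2 *
        adEntry (fun m => (U m : BlockOp m)) ⟨m, (i, r.1), (j, r.2)⟩ := fun U m N i j =>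
    conjBy_eq_sum_adEntry (fun m => (U m : BlockOp m)) m N i j
  simp only [e1, e2, conjBy_eq_sum_adEntry, conjBy_conjTranspose_eq_sum_adEntry]
  exact h.integral_sum hint _ _ _ _ _ _ _ _

/-! ### Second moments of the commutator form -/

/-- Coefficients of the bilinear form `(T, R) ↦ -i Tr[(H T - T H) R]`. -/
noncomputable def commTensor {d : ℕ} (H : Matrix (Fin d) (Fin d) ℂ) (p q : Fin d × Fin d) : ℂ :=
  -Complex.I * (H q.2 p.1 * (if p.2 = q.1 then 1 else 0) -
    H p.2 q.1 * (if p.1 = q.2 then 1 else 0))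

/-- The commutator form, expanded in matrix entries. -/
theorem commForm_eq_sum {d : ℕ} (H T R : Matrix (Fin d) (Fin d) ℂ) :
    -Complex.I * ((H * T - T * H) * R).trace =
      ∑ p : Fin d × Fin d, ∑ q : Fin d × Fin d,
        commTensor H p q * (T p.1 p.2 * R q.1 q.2) := by
  have e1 : (H * T * R).trace = ∑ p : Fin d × Fin d, ∑ q : Fin d × Fin d,
      H q.2 p.1 * (if p.2 = q.1 then 1 else 0) * (T p.1 p.2 * R q.1 q.2) := by
    rw [trace_mul_cycle, trace_mul_cycle]
    simp only [Fintype.sum_prod_type, trace, diag_apply, mul_apply, Finset.sum_mul]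
    refine Finset.sum_congr rfl fun i _ => ?_
    rw [Finset.sum_comm]
    refine Finset.sum_congr rfl fun j _ => ?_
    rw [Finset.sum_comm]
    refine Finset.sum_congr rfl fun l _ => ?_
    simp [mul_ite, ite_mul]
    ring
  have e2 : (T * H * R).trace = ∑ p : Fin d × Fin d, ∑ q : Fin d × Fin d,
      H p.2 q.1 * (if p.1 = q.2 then 1 else 0) * (T p.1 p.2 * R q.1 q.2) := by
    rw [Matrix.mul_assoc]
    simp only [Fintype.sum_prod_type, trace, diag_apply, mul_apply, Finset.mul_sum]
    refine Finset.sum_congr rfl fun i _ => Finset.sum_congr rfl fun j _ =>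
      Finset.sum_congr rfl fun k _ => ?_
    simp [mul_ite, ite_mul]
    ring
  rw [Matrix.sub_mul, trace_sub, e1, e2, ← Finset.sum_sub_distrib, Finset.mul_sum]
  refine Finset.sum_congr rfl fun p _ => ?_
  rw [← Finset.sum_sub_distrib, Finset.mul_sum]
  refine Finset.sum_congr rfl fun q _ => ?_
  rw [commTensor]
  ring

theorem sum_commTensor_diag_left {d : ℕ} (H : Matrix (Fin d) (Fin d) ℂ) (q : Fin d × Fin d) :
    ∑ p : Fin d × Fin d, commTensor H p q * (if p.1 = p.2 then 1 else 0) = 0 := by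
  simp [Fintype.sum_prod_type, commTensor, mul_ite, mul_sub, Finset.sum_sub_distrib]

theorem sum_commTensor_diag_right {d : ℕ} (H : Matrix (Fin d) (Fin d) ℂ) (p : Fin d × Fin d) :
    ∑ q : Fin d × Fin d, commTensor H p q * (if q.1 = q.2 then 1 else 0) = 0 := by
  simp [Fintype.sum_prod_type, commTensor, mul_ite, mul_sub, Finset.sum_sub_distrib]

theorem sum_commTensor_swap {d : ℕ} (H : Matrix (Fin d) (Fin d) ℂ) :
    ∑ p : Fin d × Fin d, ∑ q : Fin d × Fin d, commTensor H p q * commTensor H p.swap q.swap =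
      2 * (d * (H * H).trace - H.trace ^ 2) := by
  have hprod : ∀ i j k l : Fin d, commTensor H (i, j) (k, l) * commTensor H (j, i) (l, k) =
      (if j = k then (if i = l then -2 * (H l i * H k j) else 0) else 0) +
        (if j = k then H l i * H i l else 0) + (if i = l then H j k * H k j else 0) := by
    intro i j k l
    by_cases h1 : j = k <;> by_cases h2 : i = l
    · subst h1 h2
      simp only [commTensor, if_true]
      linear_combination (H i i - H j j) * (H j j - H i i) * Complex.I_sq
    · simp only [commTensor, h1, h2, if_true, if_false]
      linear_combination (-(H l i * H i l)) * Complex.I_sq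
    · simp only [commTensor, h1, h2, if_true, if_false]
      linear_combination (-(H j k * H k j)) * Complex.I_sq
    · simp [commTensor, h1, h2]
  simp only [Fintype.sum_prod_type, Prod.swap_prod_mk, hprod, Finset.sum_add_distrib]
  have e1 : ∑ i, ∑ j, ∑ k, ∑ l, (if j = k then (if i = l then -2 * (H l i * H k j) else 0) else 0) =
      -2 * H.trace ^ 2 := by
    have : ∀ i j k : Fin d, ∑ l, (if j = k then (if i = l then -2 * (H l i * H k j) else 0) else 0)
        = if j = k then -2 * (H i i * H k j) else 0 := by
      intro i j k
      split_ifs <;> simp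
    simp only [this, Finset.sum_ite_eq, Finset.mem_univ, if_true]
    rw [sq, trace, Finset.sum_mul_sum, Finset.mul_sum]
    simp only [Finset.mul_sum, diag_apply]
  have e2 : ∑ i, ∑ j : Fin d, ∑ k, ∑ l, (if j = k then H l i * H i l else 0) =
      d * (H * H).trace := by
    have : ∀ i j k : Fin d, ∑ l, (if j = k then H l i * H i l else 0)
        = if j = k then ∑ l, H l i * H i l else 0 := by
      intro i j k
      split_ifs <;> simp
    simp only [this, Finset.sum_ite_eq, Finset.mem_univ, if_true]
    simp only [Finset.sum_const, Finset.card_univ, Fintype.card_fin, nsmul_eq_mul, trace,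
      diag_apply, mul_apply, Finset.mul_sum]
    exact Finset.sum_congr rfl fun i _ => Finset.sum_congr rfl fun l _ => by ring
  have e3 : ∑ i : Fin d, ∑ j, ∑ k, ∑ l, (if i = l then H j k * H k j else 0) =
      d * (H * H).trace := by
    simp only [Finset.sum_ite_eq, Finset.mem_univ, if_true]
    simp [trace, mul_apply]
  rw [e1, e2, e3]
  ring

/-- Contracting a kernel `K` with a tensor `D` that it annihilates gives zero, whatever stands in
the remaining slots. -/
theorem sum_contract_eq_zero {ι κ ι' κ' : Type*} [Fintype ι] [Fintype κ] [Fintype ι'] [Fintype κ']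
    {K : ι → κ → ℂ} (K' : ι' → κ' → ℂ) {D : ι → ℂ} (D' : ι' → ℂ) (E : κ → κ' → ℂ) (β : ℂ)
    (hK : ∀ q, ∑ p, K p q * D p = 0) :
    ∑ p, ∑ q, ∑ p', ∑ q', K p q * K' p' q' * (E q q' * (β * (D p * D' p'))) = 0 := by
  rw [Finset.sum_comm]
  refine Finset.sum_eq_zero fun q _ => ?_
  calc _ = (∑ p, K p q * D p) * ∑ p', ∑ q', K' p' q' * E q q' * β * D' p' := by
        rw [Finset.sum_mul]
        refine Finset.sum_congr rfl fun p _ => ?_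
        rw [Finset.mul_sum]
        refine Finset.sum_congr rfl fun p' _ => ?_
        rw [Finset.mul_sum]
        exact Finset.sum_congr rfl fun q' _ => by ring
    _ = 0 := by rw [hK, zero_mul]

/-- The commutator form sees only the swap parts of the two twirls, since commutators with the
identity and traces of commutators vanish. -/
theorem sum_contract_swap {d : ℕ} (H : Matrix (Fin d) (Fin d) ℂ) (β γ β' γ' : ℂ) :
    ∑ p : Fin d × Fin d, ∑ q : Fin d × Fin d, ∑ p' : Fin d × Fin d, ∑ q' : Fin d × Fin d,
      commTensor H p q * commTensor H p' q' *
        ((β' * ((if q.1 = q.2 then 1 else 0) * (if q'.1 = q'.2 then 1 else 0)) +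
          γ' * ((if q.1 = q'.2 then 1 else 0) * (if q'.1 = q.2 then 1 else 0))) *
        (β * ((if p.1 = p.2 then 1 else 0) * (if p'.1 = p'.2 then 1 else 0)) +
          γ * ((if p.1 = p'.2 then 1 else 0) * (if p'.1 = p.2 then 1 else 0)))) =
      γ' * γ * (2 * (d * (H * H).trace - H.trace ^ 2)) := by
  have hswap : ∀ p p' : Fin d × Fin d,
      (if p.1 = p'.2 then (1 : ℂ) else 0) * (if p'.1 = p.2 then 1 else 0) =
        if p' = p.swap then 1 else 0 := by
    rintro ⟨i, j⟩ ⟨k, l⟩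
    by_cases h1 : k = j <;> by_cases h2 : i = l
    · simp [h1, h2]
    · simp [h2, Ne.symm h2]
    · simp [h1]
    · simp [h1]
  have h1 := sum_contract_eq_zero (commTensor H) (fun p => if p.1 = p.2 then 1 else 0)
    (fun q q' => β' * ((if q.1 = q.2 then 1 else 0) * (if q'.1 = q'.2 then 1 else 0)) +
      γ' * ((if q.1 = q'.2 then 1 else 0) * (if q'.1 = q.2 then 1 else 0))) β
    (sum_commTensor_diag_left H)
  have h2 := sum_contract_eq_zero (K := fun q p => commTensor H p q) (fun q p => commTensor H p q)
    (fun q => if q.1 = q.2 then 1 else 0)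
    (fun p p' => γ * ((if p.1 = p'.2 then 1 else 0) * (if p'.1 = p.2 then 1 else 0))) β'
    (sum_commTensor_diag_right H)
  have h3 : ∑ p : Fin d × Fin d, ∑ q : Fin d × Fin d, ∑ p' : Fin d × Fin d, ∑ q' : Fin d × Fin d,
      commTensor H p q * commTensor H p' q' *
        ((if q' = q.swap then γ' else 0) * (if p' = p.swap then γ else 0)) =
      γ' * γ * (2 * (d * (H * H).trace - H.trace ^ 2)) := by
    rw [← sum_commTensor_swap, Finset.mul_sum]
    refine Finset.sum_congr rfl fun p _ => ?_
    rw [Finset.mul_sum]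
    refine Finset.sum_congr rfl fun q _ => ?_
    rw [Finset.sum_comm]
    simp only [mul_ite, ite_mul, mul_zero, zero_mul, Finset.sum_ite_eq', Finset.mem_univ, if_true]
    ring
  rw [Finset.sum_comm] at h2
  have h2' : ∑ p : Fin d × Fin d, ∑ q : Fin d × Fin d, ∑ p' : Fin d × Fin d, ∑ q' : Fin d × Fin d,
      commTensor H p q * commTensor H p' q' *
        (γ * ((if p.1 = p'.2 then 1 else 0) * (if p'.1 = p.2 then 1 else 0)) *
          (β' * ((if q.1 = q.2 then 1 else 0) * (if q'.1 = q'.2 then 1 else 0)))) = 0 := by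
    refine Eq.trans (Finset.sum_congr rfl fun p _ => Finset.sum_congr rfl fun q _ => ?_) h2
    rw [Finset.sum_comm]
  rw [← h3]
  refine Eq.trans ?_ ((congrArg₂ (· + ·) (congrArg₂ (· + ·) h1 h2') rfl).trans (by ring))
  simp only [← Finset.sum_add_distrib]
  refine Finset.sum_congr rfl fun p _ => Finset.sum_congr rfl fun q _ =>
    Finset.sum_congr rfl fun p' _ => Finset.sum_congr rfl fun q' _ => ?_
  rw [hswap, hswap]
  by_cases hp : p' = p.swap <;> by_cases hq : q' = q.swap <;> simp only [hp, hq, if_true, if_false] <;>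
    ring

/-- The contribution `-i Tr[[H_λ, B_λ M_λ B_λ†] A_λ† N_λ A_λ]` of the block `λ` to the partial
derivative of the loss. -/
noncomputable def blockForm (H N M A B : ∀ m : Label n, BlockOp m) (m : Label n) : ℂ :=
  -Complex.I * ((H m * conjBy (B m) (M m) - conjBy (B m) (M m) * H m) *
    conjBy (A m)ᴴ (N m)).trace

theorem blockForm_mul (H N M A B : ∀ m : Label n, BlockOp m) (m m' : Label n) :
    blockForm H N M A B m * blockForm H N M A B m' =
      ∑ p : Fin (blockDim m) × Fin (blockDim m), ∑ q : Fin (blockDim m) × Fin (blockDim m),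
      ∑ p' : Fin (blockDim m') × Fin (blockDim m'), ∑ q' : Fin (blockDim m') × Fin (blockDim m'),
        commTensor (H m) p q * commTensor (H m') p' q' *
          (conjBy (A m)ᴴ (N m) q.1 q.2 * conjBy (A m')ᴴ (N m') q'.1 q'.2 *
            (conjBy (B m) (M m) p.1 p.2 * conjBy (B m') (M m') p'.1 p'.2)) := by
  rw [blockForm, blockForm, commForm_eq_sum, commForm_eq_sum, Finset.sum_mul_sum]
  simp only [Finset.sum_mul_sum]
  refine Finset.sum_congr rfl fun p _ => ?_
  rw [Finset.sum_comm]
  refine Finset.sum_congr rfl fun q _ => Finset.sum_congr rfl fun p' _ =>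
    Finset.sum_congr rfl fun q' _ => ?_
  ring

theorem IndependentTwoDesigns.integral_blockForm_mul (h : IndependentTwoDesigns P A B)
    (hint : IntegrableEntries P A B) (H N M : ∀ m : Label n, BlockOp m) (m m' : Label n) :
    Integrable (fun θ => blockForm H N M (A θ) (B θ) m * blockForm H N M (A θ) (B θ) m') P ∧
    ∫ θ, blockForm H N M (A θ) (B θ) m * blockForm H N M (A θ) (B θ) m' ∂P =
      ∑ p : Fin (blockDim m) × Fin (blockDim m), ∑ q : Fin (blockDim m) × Fin (blockDim m),
      ∑ p' : Fin (blockDim m') × Fin (blockDim m'), ∑ q' : Fin (blockDim m') × Fin (blockDim m'),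
        commTensor (H m) p q * commTensor (H m') p' q' *
          ((∫ U, conjBy ((U m)⁻¹ : unitaryGroup _ ℂ).1 (N m) q.1 q.2 *
            conjBy ((U m')⁻¹ : unitaryGroup _ ℂ).1 (N m') q'.1 q'.2 ∂(blockHaar n)) *
          ∫ U, conjBy (U m).1 (M m) p.1 p.2 * conjBy (U m').1 (M m') p'.1 p'.2 ∂(blockHaar n)) := by
  have hterm := fun q p q' p' => h.integral_conjBy hint m m' (N m) (M m) (N m') (M m') q p q' p'
  simp only [blockForm_mul]
  refine ⟨integrable_finsetSum _ fun p _ => integrable_finsetSum _ fun q _ =>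
    integrable_finsetSum _ fun p' _ => integrable_finsetSum _ fun q' _ =>
      (hterm q p q' p').1.const_mul _, ?_⟩
  rw [integral_sum₄ fun p q p' q' => (hterm q p q' p').1.const_mul _]
  refine Finset.sum_congr rfl fun p _ => Finset.sum_congr rfl fun q _ =>
    Finset.sum_congr rfl fun p' _ => Finset.sum_congr rfl fun q' _ => ?_
  rw [integral_const_mul, (hterm q p q' p').2]

theorem IndependentTwoDesigns.integral_blockForm_mul_of_ne (h : IndependentTwoDesigns P A B)
    (hint : IntegrableEntries P A B) (H N M : ∀ m : Label n, BlockOp m) {m m' : Label n}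
    (hm : m ≠ m') :
    ∫ θ, blockForm H N M (A θ) (B θ) m * blockForm H N M (A θ) (B θ) m' ∂P = 0 := by
  rw [(h.integral_blockForm_mul hint H N M m m').2]
  obtain ⟨β, hβ⟩ := exists_blockTwirl_of_ne hasInvariantLaw_id hm (M m) (M m')
  simp only [hβ]
  exact sum_contract_eq_zero (commTensor (H m')) (fun p => if p.1 = p.2 then 1 else 0) _ β
    (sum_commTensor_diag_left (H m))

theorem IndependentTwoDesigns.integral_blockForm_mul_self (h : IndependentTwoDesigns P A B)
    (hint : IntegrableEntries P A B) (H N M : ∀ m : Label n, BlockOp m) (m : Label n) :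
    ∫ θ, blockForm H N M (A θ) (B θ) m * blockForm H N M (A θ) (B θ) m ∂P =
      swapCoeff (N m) (N m) * swapCoeff (M m) (M m) *
        (2 * ((blockDim m : ℂ) * (H m * H m).trace - (H m).trace ^ 2)) := by
  rw [(h.integral_blockForm_mul hint H N M m m).2]
  obtain ⟨β, hβ⟩ := exists_blockTwirl hasInvariantLaw_id m (M m) (M m)
  obtain ⟨β', hβ'⟩ := exists_blockTwirl hasInvariantLaw_inv m (N m) (N m)
  simp only [hβ, hβ']
  exact sum_contract_swap _ _ _ _ _

/-- The mean of a block contribution vanishes. First moments are second moments in which one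
factor is the conjugate of the identity. -/
theorem IndependentTwoDesigns.integral_blockForm (h : IndependentTwoDesigns P A B)
    (hint : IntegrableEntries P A B) (hA : ∀ θ m, (A θ m)ᴴ * A θ m = 1)
    (hB : ∀ θ m, B θ m * (B θ m)ᴴ = 1) (H N M : ∀ m : Label n, BlockOp m) (m : Label n) :
    Integrable (fun θ => blockForm H N M (A θ) (B θ) m) P ∧
      ∫ θ, blockForm H N M (A θ) (B θ) m ∂P = 0 := by
  have hA1 : ∀ θ, conjBy (A θ m)ᴴ 1 = 1 := fun θ => by
    rw [conjBy, Matrix.mul_one, conjTranspose_conjTranspose, hA]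
  have hB1 : ∀ θ, conjBy (B θ m) 1 = 1 := fun θ => by
    rw [conjBy, Matrix.mul_one, hB]
  have hterm := fun q p => h.integral_conjBy hint m m (N m) (M m) 1 1 q p (0, 0) (0, 0)
  simp only [hA1, hB1, one_apply_eq, mul_one] at hterm
  obtain ⟨β, hβ⟩ := exists_blockTwirl hasInvariantLaw_id m (M m) 1
  simp only [swapCoeff_one, zero_mul, add_zero] at hβ
  simp only [blockForm, commForm_eq_sum]
  have hterm' : ∀ p q : Fin (blockDim m) × Fin (blockDim m), Integrable (fun θ =>
      commTensor (H m) p q * (conjBy (B θ m) (M m) p.1 p.2 * conjBy (A θ m)ᴴ (N m) q.1 q.2)) P :=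
    fun p q => by
      refine ((hterm q p).1.const_mul (commTensor (H m) p q)).congr (.of_forall fun θ => ?_)
      simp only
      ring
  refine ⟨integrable_finsetSum _ fun p _ => integrable_finsetSum _ fun q _ => hterm' p q, ?_⟩
  rw [integral_sum₂ hterm', Finset.sum_comm]
  refine Finset.sum_eq_zero fun q _ => ?_
  have : ∀ p : Fin (blockDim m) × Fin (blockDim m), ∫ θ, commTensor (H m) p q *
      (conjBy (B θ m) (M m) p.1 p.2 * conjBy (A θ m)ᴴ (N m) q.1 q.2) ∂P =
      (commTensor (H m) p q * (if p.1 = p.2 then 1 else 0)) *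
        ((∫ U, conjBy ((U m)⁻¹ : unitaryGroup _ ℂ).1 (N m) q.1 q.2 *
          conjBy ((U m)⁻¹ : unitaryGroup _ ℂ).1 1 0 0 ∂(blockHaar n)) * β) := by
    intro p
    rw [integral_const_mul]
    simp only [mul_comm (conjBy (B _ m) (M m) p.1 p.2)]
    rw [(hterm q p).2, hβ]
    simp only [if_true, mul_one]
    ring
  rw [Finset.sum_congr rfl fun p _ => this p, ← Finset.sum_mul, sum_commTensor_diag_left, zero_mul]

/-- The second moment of the sum of the block contributions: different blocks are uncorrelated. -/
theorem IndependentTwoDesigns.integral_sum_blockForm_sq (h : IndependentTwoDesigns P A B)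
    (hint : IntegrableEntries P A B) (H N M : ∀ m : Label n, BlockOp m) :
    ∫ θ, (∑ m, blockForm H N M (A θ) (B θ) m) ^ 2 ∂P =
      ∑ m, swapCoeff (N m) (N m) * swapCoeff (M m) (M m) *
        (2 * ((blockDim m : ℂ) * (H m * H m).trace - (H m).trace ^ 2)) := by
  simp only [sq (∑ m, _), Finset.sum_mul_sum]
  rw [integral_sum₂ fun m m' => (h.integral_blockForm_mul hint H N M m m').1]
  refine Finset.sum_congr rfl fun m _ => ?_
  rw [Finset.sum_eq_single m, h.integral_blockForm_mul_self hint]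
  · intro m' _ hm
    exact h.integral_blockForm_mul_of_ne hint H N M hm.symm
  · simp

end Design

section Variance

variable {n : ℕ}

/-! ### The generators and measurements act blockwise -/

theorem isBlockwise_pauliX (w : MultiplicityBasis n) : IsBlockwise w (collective n pauliX) := by
  rw [collective_pauliX]
  exact (isBlockwise_raising w).add (isBlockwise_lowering w)

theorem isBlockwise_pauliY (w : MultiplicityBasis n) : IsBlockwise w (collective n pauliY) := by
  rw [collective_pauliY]
  exact ((isBlockwise_lowering w).add ((isBlockwise_raising w).smul _)).smul _

theorem isBlockwise_pairSum {w : MultiplicityBasis n} {A : Matrix (Fin 2) (Fin 2) ℂ}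
    (hA : A * A = 1) (h : IsBlockwise w (collective n A)) : IsBlockwise w (pairSum n A) := by
  rw [pairSum_eq n hA]
  exact ((h.mul h).add (IsBlockwise.one.smul _)).smul _

theorem pauliX_apply (a b : Fin 2) : pauliX a b = if b = a + 1 then 1 else 0 := by
  fin_cases a <;> fin_cases b <;> simp [pauliX]

/-- The `k`-th elementary symmetric polynomial of `X_1, …, X_n`: the operator that flips every
set of `k` qubits. -/
def flipSum (n k : ℕ) : Op n := Matrix.of fun x y => if hammingDist x y = k then 1 else 0

theorem hammingDist_update_flip (x y : Config n) (j : Fin n) :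
    hammingDist (Function.update x j (x j + 1)) y + (if x j = y j then 0 else 1) =
      hammingDist x y + (if x j = y j then 1 else 0) := by
  have hsplit : ∀ z : Config n, hammingDist z y =
      (if z j ≠ y j then 1 else 0) + ∑ i ∈ Finset.univ.erase j, (if z i ≠ y i then 1 else 0) := by
    intro z
    rw [hammingDist, Finset.card_filter]
    exact (Finset.add_sum_erase _ _ (Finset.mem_univ j)).symm
  rw [hsplit, hsplit x, Function.update_self, Finset.sum_congr rfl fun i hi => by
    rw [Function.update_of_ne (Finset.ne_of_mem_erase hi)]]
  have : ∀ a b : Fin 2, (if a + 1 ≠ b then 1 else 0) + (if a = b then 0 else 1) =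
      (if a ≠ b then 1 else 0) + (if a = b then 1 else 0) := by decide
  have := this (x j) (y j)
  omega

theorem pauliX_mul_flipSum (n k : ℕ) :
    collective n pauliX * flipSum n (k + 1) =
      ((k : ℂ) + 2) • flipSum n (k + 2) + ((n : ℂ) - k) • flipSum n k := by
  ext x y
  have h1 : (collective n pauliX * flipSum n (k + 1)) x y =
      (collective n pauliX *ᵥ fun z => flipSum n (k + 1) z y) x := rfl
  have h2 : ∀ j, ∑ b, pauliX (x j) b * flipSum n (k + 1) (Function.update x j b) y =
      (if x j = y j then (if hammingDist x y = k then 1 else 0) else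
        (if hammingDist x y = k + 2 then 1 else 0)) := by
    intro j
    have h3 := hammingDist_update_flip x y j
    simp only [pauliX_apply, ite_mul, one_mul, zero_mul, Finset.sum_ite_eq', Finset.mem_univ,
      if_true, flipSum, of_apply]
    by_cases hj : x j = y j
    · simp only [hj, if_true] at h3 ⊢
      exact if_congr (by omega) rfl rfl
    · simp only [hj, if_false] at h3 ⊢
      exact if_congr (by omega) rfl rfl
  have h3 : (Finset.univ.filter fun j => ¬ x j = y j).card = hammingDist x y := rfl
  have h4 : (((Finset.univ.filter fun j => x j = y j).card : ℕ) : ℂ) =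
      (n : ℂ) - (hammingDist x y : ℂ) := by
    have := Finset.card_filter_add_card_filter_not (s := (Finset.univ : Finset (Fin n)))
      (fun j => x j = y j)
    rw [h3, Finset.card_univ, Fintype.card_fin] at this
    have := congrArg (Nat.cast (R := ℂ)) this
    push_cast at this
    linear_combination this
  rw [h1, collective_mulVec, Finset.sum_congr rfl fun j _ => h2 j, Finset.sum_ite, Finset.sum_const,
    Finset.sum_const, nsmul_eq_mul, nsmul_eq_mul, h3, h4]
  simp only [flipSum, Matrix.add_apply, Matrix.smul_apply, of_apply, smul_eq_mul]
  by_cases h5 : hammingDist x y = k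
  · simp [h5]
  · by_cases h6 : hammingDist x y = k + 2
    · simp [h6]
    · simp [h5, h6]

theorem flipSum_zero (n : ℕ) : flipSum n 0 = 1 := by
  ext x y
  simp [flipSum, Matrix.one_apply]

theorem flipSum_one (n : ℕ) : flipSum n 1 = collective n pauliX := by
  refine matrix_ext_mulVec fun v => funext fun x => ?_
  have hsum : (collective n pauliX *ᵥ v) x = ∑ j, v (Function.update x j (x j + 1)) := by
    rw [collective_mulVec]
    simp [pauliX_apply]
  have hne : ∀ a : Fin 2, a + 1 ≠ a := by decide
  have hinj : Function.Injective fun j => Function.update x j (x j + 1) := by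
    intro i j hij
    by_contra hc
    have := congrFun hij i
    simp only [Function.update_self, Function.update_of_ne hc] at this
    exact hne _ this
  rw [hsum, mulVec, dotProduct, ← Finset.sum_image (s := Finset.univ)
    (g := fun j => Function.update x j (x j + 1)) (f := v) fun a _ b _ h => hinj h]
  rw [← Finset.sum_subset (Finset.subset_univ _)]
  · refine Finset.sum_congr rfl fun y hy => ?_
    obtain ⟨j, -, rfl⟩ := Finset.mem_image.mp hy
    have := hammingDist_update_flip x x j
    simp only [hammingDist_self, if_true] at this
    rw [flipSum, of_apply, hammingDist_comm, if_pos (by omega), one_mul]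
  · intro y _ hy
    rw [flipSum, of_apply, if_neg, zero_mul]
    intro h
    obtain ⟨j, hj⟩ := Finset.card_eq_one.mp h
    refine hy (Finset.mem_image.mpr ⟨j, Finset.mem_univ _, ?_⟩)
    funext i
    by_cases hij : i = j
    · subst hij
      have h1 : x i ≠ y i := by
        have : i ∈ Finset.univ.filter fun k => x k ≠ y k := by rw [hj]; simp
        simpa using this
      have h2 : ∀ a b : Fin 2, a ≠ b → a + 1 = b := by decide
      rw [Function.update_self]
      exact h2 _ _ h1
    · rw [Function.update_of_ne hij]
      by_contra hc
      have : i ∈ Finset.univ.filter fun k => x k ≠ y k := by simpa using hc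
      rw [hj, Finset.mem_singleton] at this
      exact hij this

/-- By the recursion `pauliX_mul_flipSum`, the operators `flipSum n k` are polynomials in
`∑_j X_j`. -/
theorem isBlockwise_flipSum (w : MultiplicityBasis n) (k : ℕ) : IsBlockwise w (flipSum n k) := by
  suffices h : IsBlockwise w (flipSum n k) ∧ IsBlockwise w (flipSum n (k + 1)) from h.1
  induction k with
  | zero =>
    rw [flipSum_zero, zero_add, flipSum_one]
    exact ⟨IsBlockwise.one, isBlockwise_pauliX w⟩
  | succ k ih =>
    refine ⟨ih.2, ?_⟩
    have hk : (k : ℂ) + 2 ≠ 0 := by exact_mod_cast (by omega : k + 2 ≠ 0)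
    have : flipSum n (k + 2) = ((k : ℂ) + 2)⁻¹ • (collective n pauliX * flipSum n (k + 1) +
        (-((n : ℂ) - k)) • flipSum n k) := by
      rw [pauliX_mul_flipSum, add_assoc, ← add_smul, add_neg_cancel, zero_smul, add_zero,
        smul_smul, inv_mul_cancel₀ hk, one_smul]
    rw [this]
    exact (((isBlockwise_pauliX w).mul ih.2).add (ih.1.smul _)).smul _

theorem tensorPower_pauliX_eq (n : ℕ) : tensorPower n pauliX = flipSum n n := by
  ext x y
  have h2 : ∀ a b : Fin 2, b = a + 1 ↔ a ≠ b := by decide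
  simp only [tensorPower, flipSum, of_apply, pauliX_apply, h2]
  by_cases h : ∀ j, x j ≠ y j
  · rw [Finset.prod_congr rfl fun j _ => if_pos (h j), if_pos]
    · simp
    · rw [hammingDist, Finset.filter_true_of_mem fun j _ => h j, Finset.card_univ, Fintype.card_fin]
  · push Not at h
    obtain ⟨j, hj⟩ := h
    rw [Finset.prod_eq_zero (Finset.mem_univ j) (if_neg (not_not.mpr hj)), if_neg]
    have : j ∉ Finset.univ.filter fun i => x i ≠ y i := by simpa using hj
    have := Finset.card_lt_univ_of_notMem this
    rw [Fintype.card_fin] at this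
    exact this.ne

theorem tensorPower_pauliX_mulVec (v : Config n → ℂ) (x : Config n) :
    (tensorPower n pauliX *ᵥ v) x = v (x + 1) := by
  rw [mulVec, dotProduct, Finset.sum_eq_single (x + 1)]
  · simp [tensorPower, pauliX_apply]
  · intro y _ hy
    obtain ⟨j, hj⟩ := Function.ne_iff.mp hy
    rw [tensorPower, of_apply, Finset.prod_eq_zero (Finset.mem_univ j), zero_mul]
    rw [pauliX_apply, if_neg]
    simpa using hj
  · simp

theorem tensorPower_pauliX_mul_self (n : ℕ) :
    tensorPower n pauliX * tensorPower n pauliX = 1 := by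
  refine matrix_ext_mulVec fun v => funext fun x => ?_
  rw [← mulVec_mulVec, tensorPower_pauliX_mulVec, tensorPower_pauliX_mulVec, one_mulVec]
  congr 1
  funext j
  have : ∀ a : Fin 2, a + 1 + 1 = a := by decide
  exact this _

theorem tensorPower_pauliX_mul_pauliZ (n : ℕ) :
    tensorPower n pauliX * collective n pauliZ =
      (-1 : ℂ) • (collective n pauliZ * tensorPower n pauliX) := by
  refine matrix_ext_mulVec fun v => funext fun x => ?_
  rw [← mulVec_mulVec, tensorPower_pauliX_mulVec, collective_pauliZ_mulVec, smul_mulVec,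
    ← mulVec_mulVec, Pi.smul_apply, collective_pauliZ_mulVec, tensorPower_pauliX_mulVec]
  have h1 : (ones (x + 1) : ℂ) = (n : ℂ) - ones x := by
    have h2 := Finset.card_filter_add_card_filter_not (s := (Finset.univ : Finset (Fin n)))
      (fun j => x j = 1)
    have h3 : ∀ a : Fin 2, a + 1 = 1 ↔ ¬ a = 1 := by decide
    have h4 : (Finset.univ.filter fun j => ¬ x j = 1).card = ones (x + 1) := by
      simp only [ones, Pi.add_apply, Pi.one_apply, h3]
    rw [h4, Finset.card_univ, Fintype.card_fin] at h2
    have := congrArg (Nat.cast (R := ℂ)) h2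
    rw [Nat.cast_add] at this
    change (ones x : ℂ) + ones (x + 1) = n at this
    linear_combination this
  rw [h1, smul_eq_mul]
  ring

theorem isBlockwise_of_mem_generatorSet (w : MultiplicityBasis n) {H : Op n}
    (h : H ∈ generatorSet n) : IsBlockwise w H := by
  rcases h with rfl | rfl | rfl
  · exact (isBlockwise_pauliX w).smul _
  · exact (isBlockwise_pauliY w).smul _
  · exact (isBlockwise_pairSum pauliZ_mul_self (isBlockwise_pauliZ w)).smul _

theorem isBlockwise_of_mem_measurementSet (w : MultiplicityBasis n) {O : Op n}
    (h : O ∈ measurementSet n) : IsBlockwise w O := by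
  rcases h with rfl | rfl | rfl
  · exact (isBlockwise_pauliX w).smul _
  · exact (isBlockwise_pairSum pauliX_mul_self (isBlockwise_pauliX w)).smul _
  · rw [tensorPower_pauliX_eq]
    exact isBlockwise_flipSum w n

theorem isHermitian_pauliX : pauliX.IsHermitian := by
  ext i j
  fin_cases i <;> fin_cases j <;> simp [pauliX]

theorem isHermitian_pauliY : pauliY.IsHermitian := by
  ext i j
  fin_cases i <;> fin_cases j <;> simp [pauliY]

theorem isHermitian_pauliZ : pauliZ.IsHermitian := by
  ext i j
  fin_cases i <;> fin_cases j <;> simp [pauliZ]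

theorem isHermitian_oneBody {A : Matrix (Fin 2) (Fin 2) ℂ} (hA : A.IsHermitian) :
    (oneBody n A).IsHermitian := by
  rw [IsHermitian, oneBody, conjTranspose_smul, collective_conjTranspose, hA.eq]
  simp

theorem isHermitian_twoBody {A : Matrix (Fin 2) (Fin 2) ℂ} (hA : A.IsHermitian)
    (hA2 : A * A = 1) : (twoBody n A).IsHermitian := by
  rw [IsHermitian, twoBody, pairSum_eq n hA2]
  simp [conjTranspose_smul, collective_conjTranspose, hA.eq]

theorem isHermitian_tensorPower {A : Matrix (Fin 2) (Fin 2) ℂ} (hA : A.IsHermitian) :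
    (tensorPower n A).IsHermitian := by
  ext x y
  simp only [tensorPower, conjTranspose_apply, of_apply, star_prod, hA.apply]

theorem isHermitian_of_mem_generatorSet {H : Op n} (h : H ∈ generatorSet n) : H.IsHermitian := by
  rcases h with rfl | rfl | rfl
  · exact isHermitian_oneBody isHermitian_pauliX
  · exact isHermitian_oneBody isHermitian_pauliY
  · exact isHermitian_twoBody isHermitian_pauliZ pauliZ_mul_self

theorem isHermitian_of_mem_measurementSet {O : Op n} (h : O ∈ measurementSet n) :
    O.IsHermitian := by
  rcases h with rfl | rfl | rfl
  · exact isHermitian_oneBody isHermitian_pauliX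
  · exact isHermitian_twoBody isHermitian_pauliX pauliX_mul_self
  · exact isHermitian_tensorPower isHermitian_pauliX

/-! ### Layers of the network -/

theorem exp_mul_exp_neg (A : Op n) : NormedSpace.exp A * NormedSpace.exp (-A) = 1 := by
  rw [← Matrix.exp_add_of_commute _ _ (Commute.refl A).neg_right, add_neg_cancel,
    NormedSpace.exp_zero]

theorem conjTranspose_exp_of_isHermitian {H : Op n} (hH : H.IsHermitian) (t : ℝ) :
    (NormedSpace.exp ((-(Complex.I * (t : ℂ))) • H))ᴴ =
      NormedSpace.exp (-((-(Complex.I * (t : ℂ))) • H)) := by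
  rw [← Matrix.exp_conjTranspose, conjTranspose_smul, hH.eq, ← neg_smul]
  congr 2
  simp

theorem QNN.layer_mem_unitaryGroup (V : QNN n) (θ : Fin V.depth → ℝ) (l : Fin V.depth) :
    V.layer θ l ∈ unitaryGroup (Config n) ℂ := by
  rw [mem_unitaryGroup_iff, star_eq_conjTranspose, QNN.layer,
    conjTranspose_exp_of_isHermitian (isHermitian_of_mem_generatorSet (V.gen_mem l)),
    exp_mul_exp_neg]

theorem QNN.layersProd_mem_unitaryGroup (V : QNN n) (p : Fin V.depth → Bool)
    (θ : Fin V.depth → ℝ) : V.layersProd p θ ∈ unitaryGroup (Config n) ℂ := by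
  refine Submonoid.list_prod_mem _ fun A hA => ?_
  obtain ⟨l, -, rfl⟩ := List.mem_map.mp hA
  exact V.layer_mem_unitaryGroup θ l

theorem QNN.isBlockwise_layersProd (w : MultiplicityBasis n) (V : QNN n) (p : Fin V.depth → Bool)
    (θ : Fin V.depth → ℝ) : IsBlockwise w (V.layersProd p θ) := by
  refine IsBlockwise.list_prod fun A hA => ?_
  obtain ⟨l, -, rfl⟩ := List.mem_map.mp hA
  exact ((isBlockwise_of_mem_generatorSet w (V.gen_mem l)).smul _).exp

theorem continuous_matrix_exp : Continuous (NormedSpace.exp : Op n → Op n) := by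
  let : NormedRing (Op n) := Matrix.linftyOpNormedRing
  let : NormedAlgebra ℂ (Op n) := Matrix.linftyOpNormedAlgebra
  let : NormedAlgebra ℚ (Op n) := Matrix.linftyOpNormedAlgebra
  have : CompleteSpace (Op n) := FiniteDimensional.complete ℂ (Op n)
  exact NormedSpace.exp_continuous

theorem QNN.continuous_layersProd (V : QNN n) (p : Fin V.depth → Bool) :
    Continuous (V.layersProd p) := by
  refine continuous_list_prod _ fun l _ => continuous_matrix_exp.comp ?_
  fun_prop

/-- Filtering a sorted list in which all elements satisfying `p` come before those satisfying
`r`. -/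
theorem filter_or_eq_append {α : Type*} [LT α] {l : List α} (hl : l.Pairwise (· < ·))
    {p r : α → Bool} (h : ∀ a b, a < b → r a → ¬ p b) (hpr : ∀ a, r a → ¬ p a) :
    l.filter (fun a => p a || r a) = l.filter p ++ l.filter r := by
  induction l with
  | nil => rfl
  | cons a l ih =>
    rw [List.pairwise_cons] at hl
    by_cases hr : r a
    · have h1 : ∀ b ∈ l, ¬ p b := fun b hb => h a b (hl.1 b hb) hr
      have h2 : l.filter p = [] := List.filter_eq_nil_iff.mpr h1
      have h3 := ih hl.2
      rw [h2, List.nil_append] at h3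
      simp [hr, hpr a hr, h2, h3]
    · by_cases hp : p a <;> simp [hp, hr, ih hl.2]

theorem QNN.layersProd_or (V : QNN n) {p r : Fin V.depth → Bool}
    (h : ∀ a b, a < b → r a → ¬ p b) (hpr : ∀ a, r a → ¬ p a) (θ : Fin V.depth → ℝ) :
    V.layersProd (fun a => p a || r a) θ = V.layersProd r θ * V.layersProd p θ := by
  rw [QNN.layersProd, filter_or_eq_append (List.pairwise_lt_finRange _) h hpr,
    List.reverse_append, List.map_append, List.prod_append]
  rfl

theorem QNN.unitary_eq (V : QNN n) (μ : Fin V.depth) (θ : Fin V.depth → ℝ) :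
    V.unitary θ = V.after μ θ * V.before μ θ := by
  rw [QNN.unitary, QNN.after, QNN.before, ← QNN.layersProd_or]
  · congr 1
    funext a
    simpa using le_or_gt a μ
  · intro a b hab ha
    simp only [decide_eq_true_eq] at *
    exact not_le.mpr (ha.trans hab)
  · intro a ha
    simpa using ha

theorem QNN.before_eq (V : QNN n) (μ : Fin V.depth) (θ : Fin V.depth → ℝ) :
    V.before μ θ = V.layer θ μ * V.layersProd (fun l => decide (l < μ)) θ := by
  have h1 : V.layer θ μ = V.layersProd (fun l => decide (l = μ)) θ := by
    have : (List.finRange V.depth).filter (fun l => decide (l = μ)) = [μ] := by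
      rw [List.filter_eq, List.count_eq_one_of_mem (List.nodup_finRange _) (List.mem_finRange μ)]
      rfl
    rw [QNN.layersProd, this]
    simp
  rw [h1, QNN.before, ← QNN.layersProd_or]
  · congr 1
    funext a
    simp [le_iff_lt_or_eq]
  · intro a b hab ha
    simp only [decide_eq_true_eq] at *
    rw [← ha]
    exact hab.not_gt
  · intro a ha
    simp only [decide_eq_true_eq] at *
    rw [ha]
    exact lt_irrefl μ

theorem QNN.layersProd_update (V : QNN n) {p : Fin V.depth → Bool} {μ : Fin V.depth}
    (hp : ¬ p μ) (θ : Fin V.depth → ℝ) (t : ℝ) :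
    V.layersProd p (Function.update θ μ t) = V.layersProd p θ := by
  rw [QNN.layersProd, QNN.layersProd]
  congr 1
  refine List.map_congr_left fun l hl => ?_
  have : l ≠ μ := by
    rintro rfl
    rw [List.mem_reverse, List.mem_filter] at hl
    exact hp hl.2
  rw [QNN.layer, QNN.layer, Function.update_of_ne this]

/-! ### The partial derivative of the loss -/

/-- The derivative of `s ↦ e^{s x} τ e^{-s x}`, seen through a linear functional, so that no norm on
matrices has to be fixed in the statement. -/
theorem hasDerivAt_exp_conj (x τ : Op n) (t : ℝ) (L : Op n →ₗ[ℝ] ℝ) :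
    HasDerivAt (fun s : ℝ => L (NormedSpace.exp (s • x) * τ * NormedSpace.exp (s • (-x))))
      (L (x * (NormedSpace.exp (t • x) * τ * NormedSpace.exp (t • (-x))) -
        NormedSpace.exp (t • x) * τ * NormedSpace.exp (t • (-x)) * x)) t := by
  let : NormedRing (Op n) := Matrix.linftyOpNormedRing
  let : NormedAlgebra ℝ (Op n) := Matrix.linftyOpNormedAlgebra
  have : CompleteSpace (Op n) := FiniteDimensional.complete ℝ (Op n)
  have h1 := hasDerivAt_exp_smul_const' x t
  have h2 := hasDerivAt_exp_smul_const (-x) t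
  have h3 := (h1.mul_const τ).mul h2
  have h4 := L.toContinuousLinearMap.hasFDerivAt.comp_hasDerivAt t h3
  refine h4.congr_deriv (congrArg L ?_)
  noncomm_ring

theorem empiricalLoss_eq (V : QNN n) (O : Op n) (S : Dataset n) (θ : Fin V.depth → ℝ) :
    empiricalLoss V O S θ = (V.unitary θ * S.average * (V.unitary θ)ᴴ * O).trace.re := by
  simp only [empiricalLoss, loss, Dataset.average, Matrix.mul_sum, Matrix.sum_mul, trace_sum,
    Complex.re_sum, Matrix.mul_smul, Matrix.smul_mul, trace_smul, smul_eq_mul, Complex.re_ofReal_mul]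

/-- The commutator form of the partial derivative, on the whole space. -/
noncomputable def gradForm (H O σ A B : Op n) : ℂ :=
  -Complex.I * ((H * (B * σ * Bᴴ) - B * σ * Bᴴ * H) * (Aᴴ * O * A)).trace

theorem partialLoss_eq (V : QNN n) (O : Op n) (S : Dataset n) (μ : Fin V.depth)
    (θ : Fin V.depth → ℝ) :
    partialLoss V O S μ θ =
      (gradForm (V.gen μ) O S.average (V.after μ θ) (V.before μ θ)).re := by
  set A := V.after μ θ with hA
  set C := V.layersProd (fun l => decide (l < μ)) θ with hC
  set x : Op n := (-Complex.I) • V.gen μ with hx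
  let L : Op n →ₗ[ℝ] ℝ := Complex.reLm ∘ₗ
    ((traceLinearMap (Config n) ℂ ℂ).restrictScalars ℝ) ∘ₗ
      (LinearMap.mulRight ℝ (Aᴴ * O)) ∘ₗ (LinearMap.mulLeft ℝ A)
  have hL : ∀ Y, L Y = (A * Y * (Aᴴ * O)).trace.re := fun Y => rfl
  have hexp : ∀ s : ℝ, NormedSpace.exp ((-(Complex.I * (s : ℂ))) • V.gen μ) =
      NormedSpace.exp (s • x) := by
    intro s
    rw [hx, ← Complex.coe_smul, smul_smul]
    congr 2
    ring
  have hexp' : ∀ s : ℝ, (NormedSpace.exp ((-(Complex.I * (s : ℂ))) • V.gen μ))ᴴ =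
      NormedSpace.exp (s • (-x)) := by
    intro s
    rw [conjTranspose_exp_of_isHermitian (isHermitian_of_mem_generatorSet (V.gen_mem μ)), hx,
      ← Complex.coe_smul, ← neg_smul, ← neg_smul, smul_smul]
    congr 2
    ring
  have hfun : (fun s : ℝ => empiricalLoss V O S (Function.update θ μ s)) = fun s : ℝ =>
      L (NormedSpace.exp (s • x) * (C * S.average * Cᴴ) * NormedSpace.exp (s • (-x))) := by
    funext s
    rw [empiricalLoss_eq, hL, V.unitary_eq μ, V.before_eq μ, QNN.after,
      V.layersProd_update (by simp), V.layersProd_update (by simp), QNN.layer, Function.update_self,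
      conjTranspose_mul, conjTranspose_mul, hexp', hexp]
    simp only [Matrix.mul_assoc]
    rfl
  have hB : V.before μ θ = NormedSpace.exp (θ μ • x) * C := by
    rw [V.before_eq μ, QNN.layer, hexp]
  have hB' : (V.before μ θ)ᴴ = Cᴴ * NormedSpace.exp (θ μ • (-x)) := by
    rw [V.before_eq μ, conjTranspose_mul, QNN.layer, hexp']
  rw [partialLoss, hfun, (hasDerivAt_exp_conj x _ (θ μ) L).deriv, hL]
  have hBσ : NormedSpace.exp (θ μ • x) * (C * S.average * Cᴴ) * NormedSpace.exp (θ μ • (-x)) =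
      V.before μ θ * S.average * (V.before μ θ)ᴴ := by
    rw [hB', hB]
    simp only [Matrix.mul_assoc]
  rw [hBσ, gradForm]
  congr 1
  rw [Matrix.mul_assoc, trace_mul_comm, Matrix.mul_assoc, hx, Matrix.smul_mul, Matrix.mul_smul,
    ← smul_sub, Matrix.smul_mul, trace_smul, smul_eq_mul]

/-- The commutator form is real for Hermitian data. -/
theorem star_gradForm {H O σ : Op n} (hH : H.IsHermitian) (hO : O.IsHermitian)
    (hσ : σ.IsHermitian) (A B : Op n) : star (gradForm H O σ A B) = gradForm H O σ A B := by
  have h1 : (B * σ * Bᴴ)ᴴ = B * σ * Bᴴ := by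
    simp [Matrix.mul_assoc, hσ.eq]
  have h2 : (Aᴴ * O * A)ᴴ = Aᴴ * O * A := by
    simp [Matrix.mul_assoc, hO.eq]
  rw [gradForm, star_mul', ← trace_conjTranspose, conjTranspose_mul, conjTranspose_sub,
    conjTranspose_mul H, conjTranspose_mul _ H, h1, h2, hH.eq, trace_mul_comm, ← neg_sub,
    Matrix.neg_mul, trace_neg]
  simp

theorem Dataset.isHermitian_average (S : Dataset n) : S.average.IsHermitian := by
  rw [IsHermitian, Dataset.average, conjTranspose_sum]
  refine Finset.sum_congr rfl fun i _ => ?_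
  rw [conjTranspose_smul, (S.posSemidef i).isHermitian.eq]
  simp

theorem restrict_sub (w : MultiplicityBasis n) (m : Label n) (ν : Fin (multiplicity m))
    (A B : Op n) : restrict w m ν (A - B) = restrict w m ν A - restrict w m ν B := by
  simp [restrict, Matrix.mul_sub, Matrix.sub_mul]

/-- The commutator form is the sum of the contributions of the blocks. -/
theorem gradForm_eq_sum_blockForm (w : MultiplicityBasis n) {H O A B : Op n} (σ : Op n)
    (hH : IsBlockwise w H) (hO : IsBlockwise w O) (hA : IsBlockwise w A) (hB : IsBlockwise w B)
    (ν : ∀ m : Label n, Fin (multiplicity m)) :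
    gradForm H O σ A B = ∑ m, blockForm (fun m => restrict w m (ν m) H)
      (fun m => restrict w m (ν m) O) (fun m => ∑ κ, restrict w m κ σ)
      (fun m => restrict w m (ν m) A) (fun m => restrict w m (ν m) B) m := by
  rw [gradForm, trace_eq_sum_restrict w, Finset.mul_sum]
  refine Finset.sum_congr rfl fun m _ => ?_
  have hterm : ∀ κ, restrict w m κ ((H * (B * σ * Bᴴ) - B * σ * Bᴴ * H) * (Aᴴ * O * A)) =
      (restrict w m (ν m) H * (restrict w m (ν m) B * restrict w m κ σ * (restrict w m (ν m) B)ᴴ) -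
        restrict w m (ν m) B * restrict w m κ σ * (restrict w m (ν m) B)ᴴ * restrict w m (ν m) H) *
      ((restrict w m (ν m) A)ᴴ * restrict w m (ν m) O * restrict w m (ν m) A) := by
    intro κ
    rw [restrict_mul_of_right _ ((hA.conjTranspose.mul hO).mul hA), restrict_sub,
      restrict_mul_of_left hH, restrict_mul_of_right _ hH, restrict_mul_of_right _ hB.conjTranspose,
      restrict_mul_of_left hB, restrict_mul_of_right _ hA, restrict_mul_of_right _ hO,
      restrict_conjTranspose, restrict_conjTranspose, hH.restrict_eq m κ (ν m),
      hO.restrict_eq m κ (ν m), hA.restrict_eq m κ (ν m), hB.restrict_eq m κ (ν m)]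
  simp only [hterm, blockForm, conjBy, conjTranspose_conjTranspose, ← trace_sum, ← Matrix.sum_mul,
    Finset.sum_sub_distrib, ← Matrix.mul_sum]

theorem continuous_restrict (w : MultiplicityBasis n) (m : Label n) (ν : Fin (multiplicity m)) :
    Continuous (restrict w m ν) :=
  (continuous_const.matrix_mul continuous_id).matrix_mul continuous_const

theorem restrict_mem_unitary {w : MultiplicityBasis n} {U : Op n} (hU : IsBlockwise w U)
    (hU1 : U ∈ unitaryGroup (Config n) ℂ) (m : Label n) (ν : Fin (multiplicity m)) :
    restrict w m ν U ∈ unitaryGroup (Fin (blockDim m)) ℂ := by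
  rw [mem_unitaryGroup_iff, star_eq_conjTranspose, ← restrict_conjTranspose,
    ← restrict_mul_of_left hU, ← star_eq_conjTranspose, mem_unitaryGroup_iff.mp hU1, restrict_one]

theorem norm_adEntry_le {U : ∀ m : Label n, BlockOp m}
    (hU : ∀ m, U m ∈ unitaryGroup (Fin (blockDim m)) ℂ) (a : EntryIndex n) :
    ‖adEntry U a‖ ≤ 1 := by
  rw [adEntry, norm_mul, norm_star]
  exact mul_le_one₀ (entry_norm_bound_of_unitary (hU _) _ _) (norm_nonneg _)
    (entry_norm_bound_of_unitary (hU _) _ _)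

theorem integrableEntries_layersProd (w : MultiplicityBasis n) (V : QNN n)
    (P : Measure (Fin V.depth → ℝ)) [IsFiniteMeasure P] (p r : Fin V.depth → Bool)
    (ν : ∀ m : Label n, Fin (multiplicity m)) :
    IntegrableEntries P (fun θ m => restrict w m (ν m) (V.layersProd p θ))
      (fun θ m => restrict w m (ν m) (V.layersProd r θ)) := by
  intro a a' b b'
  have hcont : ∀ (p : Fin V.depth → Bool) (a : EntryIndex n), Continuous fun θ =>
      adEntry (fun m => restrict w m (ν m) (V.layersProd p θ)) a := by
    intro p a
    have := (continuous_restrict w a.1 (ν a.1)).comp (V.continuous_layersProd p)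
    exact (this.matrix_elem _ _).mul (this.matrix_elem _ _).star
  have hbound : ∀ (p : Fin V.depth → Bool) (a : EntryIndex n) θ,
      ‖adEntry (fun m => restrict w m (ν m) (V.layersProd p θ)) a‖ ≤ 1 := fun p a θ =>
    norm_adEntry_le (fun m => restrict_mem_unitary (V.isBlockwise_layersProd w p θ)
      (V.layersProd_mem_unitaryGroup p θ) m (ν m)) a
  refine Integrable.of_bound (((hcont p a).mul (hcont p a')).mul
    ((hcont r b).mul (hcont r b'))).aestronglyMeasurable 1 (.of_forall fun θ => ?_)
  simp only [norm_mul]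
  exact mul_le_one₀ (mul_le_one₀ (hbound p a θ) (norm_nonneg _) (hbound p a' θ))
    (by positivity) (mul_le_one₀ (hbound r b θ) (norm_nonneg _) (hbound r b' θ))

/-- The variance of the partial derivative is the sum over the blocks of
`2 γ(O_λ) γ(σ_λ) (d_λ Tr[H_λ²] - Tr[H_λ]²)`, where `γ` is the swap coefficient of the twirl. -/
theorem variance_partialLoss (w : MultiplicityBasis n) (V : QNN n) {O : Op n}
    (hO : O ∈ measurementSet n) (S : Dataset n) (μ : Fin V.depth) (P : Measure (Fin V.depth → ℝ))
    [IsProbabilityMeasure P] (hdesign : FormsIndependentTwoDesigns w V μ P)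
    (ν : ∀ m : Label n, Fin (multiplicity m)) :
    ((variance (partialLoss V O S μ) P : ℝ) : ℂ) =
      ∑ m : Label n, swapCoeff (restrict w m (ν m) O) (restrict w m (ν m) O) *
        swapCoeff (∑ κ, restrict w m κ S.average) (∑ κ, restrict w m κ S.average) *
        (2 * ((blockDim m : ℂ) * (restrict w m (ν m) (V.gen μ) * restrict w m (ν m) (V.gen μ)).trace -
          (restrict w m (ν m) (V.gen μ)).trace ^ 2)) := by
  have hdes := hdesign ν
  have hint := integrableEntries_layersProd w V P (fun l => decide (μ < l))
    (fun l => decide (l ≤ μ)) ν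
  set A : (Fin V.depth → ℝ) → ∀ m : Label n, BlockOp m :=
    fun θ m => restrict w m (ν m) (V.after μ θ) with hA
  set B : (Fin V.depth → ℝ) → ∀ m : Label n, BlockOp m :=
    fun θ m => restrict w m (ν m) (V.before μ θ) with hB
  have hAU : ∀ θ m, (A θ m)ᴴ * A θ m = 1 := fun θ m => mem_unitaryGroup_iff'.mp
    (restrict_mem_unitary (V.isBlockwise_layersProd w _ θ) (V.layersProd_mem_unitaryGroup _ θ) m _)
  have hBU : ∀ θ m, B θ m * (B θ m)ᴴ = 1 := fun θ m => mem_unitaryGroup_iff.mp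
    (restrict_mem_unitary (V.isBlockwise_layersProd w _ θ) (V.layersProd_mem_unitaryGroup _ θ) m _)
  set X := fun θ => blockForm (fun m => restrict w m (ν m) (V.gen μ))
    (fun m => restrict w m (ν m) O) (fun m => ∑ κ, restrict w m κ S.average) (A θ) (B θ) with hX
  have hgrad : ∀ θ, ((partialLoss V O S μ θ : ℝ) : ℂ) = ∑ m, X θ m := by
    intro θ
    rw [partialLoss_eq]
    refine Eq.trans ?_ (gradForm_eq_sum_blockForm w (A := V.after μ θ) (B := V.before μ θ) S.average
      (isBlockwise_of_mem_generatorSet w (V.gen_mem μ)) (isBlockwise_of_mem_measurementSet w hO)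
      (V.isBlockwise_layersProd w _ θ) (V.isBlockwise_layersProd w _ θ) ν)
    exact Complex.conj_eq_iff_re.mp (star_gradForm (isHermitian_of_mem_generatorSet (V.gen_mem μ))
      (isHermitian_of_mem_measurementSet hO) S.isHermitian_average _ _)
  have hmean := fun m => hdes.integral_blockForm hint hAU hBU
    (fun m => restrict w m (ν m) (V.gen μ)) (fun m => restrict w m (ν m) O)
    (fun m => ∑ κ, restrict w m κ S.average) m
  have hsq := hdes.integral_sum_blockForm_sq hint
    (fun m => restrict w m (ν m) (V.gen μ)) (fun m => restrict w m (ν m) O)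
    (fun m => ∑ κ, restrict w m κ S.average)
  have hint1 : Integrable (fun θ => ((partialLoss V O S μ θ : ℝ) : ℂ)) P := by
    simp only [hgrad]
    exact integrable_finsetSum _ fun m _ => (hmean m).1
  have hmeas : AEStronglyMeasurable (partialLoss V O S μ) P := by
    have := hint1.1.re
    simpa using this
  have h0 : ∫ θ, partialLoss V O S μ θ ∂P = 0 := by
    have : ((∫ θ, partialLoss V O S μ θ ∂P : ℝ) : ℂ) = 0 := by
      rw [← integral_complex_ofReal]
      simp only [hgrad]
      rw [integral_finsetSum _ fun m _ => (hmean m).1]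
      exact Finset.sum_eq_zero fun m _ => (hmean m).2
    exact_mod_cast this
  rw [variance_of_integral_eq_zero hmeas.aemeasurable h0, ← hsq, ← integral_complex_ofReal]
  refine integral_congr_ae (.of_forall fun θ => ?_)
  simp only [Complex.ofReal_pow, hgrad]
  rfl

end Variance

/-! ### Lower bounds on `Δ` -/

section Delta

variable {d : ℕ} {B : Matrix (Fin d) (Fin d) ℂ}

theorem ofReal_trace_re (hB : B.IsHermitian) : ((B.trace.re : ℝ) : ℂ) = B.trace := by
  refine Complex.conj_eq_iff_re.mp ?_
  rw [← Complex.star_def, ← trace_conjTranspose, hB.eq]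

theorem ofReal_delta (hB : B.IsHermitian) :
    ((Delta B : ℝ) : ℂ) = (B * B).trace - B.trace ^ 2 / d := by
  have h1 : (B * B).IsHermitian := by
    rw [IsHermitian, conjTranspose_mul, hB.eq]
  refine Complex.conj_eq_iff_re.mp ?_
  rw [← ofReal_trace_re hB, ← ofReal_trace_re h1]
  simp

theorem trace_mul_self_eq_sum_normSq (hB : B.IsHermitian) :
    (B * B).trace = ((∑ i, ∑ j, Complex.normSq (B i j) : ℝ) : ℂ) := by
  push_cast
  rw [trace]
  refine Finset.sum_congr rfl fun i _ => ?_
  rw [diag_apply, mul_apply]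
  refine Finset.sum_congr rfl fun j _ => ?_
  rw [← hB.apply j i, Complex.normSq_eq_conj_mul_self, mul_comm]
  rfl

/-- `Δ(B)` is the squared Hilbert-Schmidt norm of the traceless part of `B`. -/
theorem delta_eq_sum_normSq [NeZero d] (hB : B.IsHermitian) :
    Delta B = ∑ i, ∑ j, Complex.normSq ((B - ((B.trace.re / d : ℝ) : ℂ) • 1) i j) := by
  have hd : (d : ℂ) ≠ 0 := NeZero.ne _
  have hC : (B - ((B.trace.re / d : ℝ) : ℂ) • (1 : Matrix (Fin d) (Fin d) ℂ)).IsHermitian := by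
    rw [IsHermitian, conjTranspose_sub, conjTranspose_smul, hB.eq]
    simp
  have h := trace_mul_self_eq_sum_normSq hC
  have h2 : ((Delta B : ℝ) : ℂ) = ((∑ i, ∑ j, Complex.normSq
      ((B - ((B.trace.re / d : ℝ) : ℂ) • (1 : Matrix (Fin d) (Fin d) ℂ)) i j) : ℝ) : ℂ) := by
    rw [← h, ofReal_delta hB]
    simp only [Matrix.sub_mul, Matrix.mul_sub, Matrix.smul_mul, Matrix.mul_smul, Matrix.one_mul,
      Matrix.mul_one, trace_sub, trace_smul, trace_one, Fintype.card_fin, smul_eq_mul,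
      Complex.ofReal_div, ofReal_trace_re hB, Complex.ofReal_natCast]
    field_simp
    ring
  exact_mod_cast h2

theorem delta_nonneg [NeZero d] (hB : B.IsHermitian) : 0 ≤ Delta B := by
  rw [delta_eq_sum_normSq hB]
  exact Finset.sum_nonneg fun i _ => Finset.sum_nonneg fun j _ => Complex.normSq_nonneg _

theorem normSq_le_delta [NeZero d] (hB : B.IsHermitian) {i j : Fin d} (hij : i ≠ j) :
    Complex.normSq (B i j) ≤ Delta B := by
  rw [delta_eq_sum_normSq hB]
  refine le_trans ?_ (Finset.single_le_sum (fun i _ => Finset.sum_nonneg fun j _ =>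
    Complex.normSq_nonneg _) (Finset.mem_univ i))
  refine le_trans ?_ (Finset.single_le_sum (fun j _ => Complex.normSq_nonneg _) (Finset.mem_univ j))
  simp [hij]

theorem sub_sq_le_delta [NeZero d] (hB : B.IsHermitian) {i j : Fin d} (hij : i ≠ j) :
    ((B i i).re - (B j j).re) ^ 2 / 2 ≤ Delta B := by
  rw [delta_eq_sum_normSq hB]
  set a := B.trace.re / d
  have h1 : ∀ k, ((B k k).re - a) ^ 2 ≤
      ∑ l, Complex.normSq ((B - ((a : ℝ) : ℂ) • (1 : Matrix (Fin d) (Fin d) ℂ)) k l) := by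
    intro k
    refine le_trans ?_ (Finset.single_le_sum (fun j _ => Complex.normSq_nonneg _)
      (Finset.mem_univ k))
    rw [Complex.normSq_apply]
    have : ((B - ((a : ℝ) : ℂ) • (1 : Matrix (Fin d) (Fin d) ℂ)) k k).re = (B k k).re - a := by
      simp
    rw [this]
    nlinarith [mul_self_nonneg ((B - ((a : ℝ) : ℂ) • (1 : Matrix (Fin d) (Fin d) ℂ)) k k).im]
  have h2 := Finset.add_le_sum (s := Finset.univ) (f := fun k => ∑ l, Complex.normSq
    ((B - ((a : ℝ) : ℂ) • (1 : Matrix (Fin d) (Fin d) ℂ)) k l))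
    (fun k _ => Finset.sum_nonneg fun l _ => Complex.normSq_nonneg _) (Finset.mem_univ i)
    (Finset.mem_univ j) hij
  nlinarith [h1 i, h1 j, sq_nonneg (((B i i).re - a) + ((B j j).re - a))]

theorem delta_eq_zero_of_dim_one (hd : d = 1) : Delta B = 0 := by
  subst hd
  simp [Delta, trace, mul_apply, sq]

theorem swapCoeff_self (hB : B.IsHermitian) :
    swapCoeff B B = ((Delta B / ((d : ℝ) ^ 2 - 1) : ℝ) : ℂ) := by
  rw [swapCoeff, Complex.ofReal_div, ofReal_delta hB]
  push_cast
  simp only [sq]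

end Delta

section LowerBounds

variable {n : ℕ}

theorem isHermitian_restrict (w : MultiplicityBasis n) (m : Label n) (ν : Fin (multiplicity m))
    {A : Op n} (hA : A.IsHermitian) : (restrict w m ν A).IsHermitian := by
  rw [IsHermitian, ← restrict_conjTranspose, hA.eq]

/-- The variance in terms of `Δ`. Blocks with `d_λ = 1` contribute `0`, also on the right hand side,
where the denominator vanishes. -/
theorem variance_partialLoss_eq_sum_delta (w : MultiplicityBasis n) (V : QNN n) {O : Op n}
    (hO : O ∈ measurementSet n) (S : Dataset n) (μ : Fin V.depth) (P : Measure (Fin V.depth → ℝ))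
    [IsProbabilityMeasure P] (hdesign : FormsIndependentTwoDesigns w V μ P)
    (ν : ∀ m : Label n, Fin (multiplicity m)) :
    variance (partialLoss V O S μ) P = ∑ m : Label n,
      Delta (restrict w m (ν m) O) / ((blockDim m : ℝ) ^ 2 - 1) *
        (Delta (∑ κ, restrict w m κ S.average) / ((blockDim m : ℝ) ^ 2 - 1)) *
        (2 * (blockDim m * Delta (restrict w m (ν m) (V.gen μ)))) := by
  have h := variance_partialLoss w V hO S μ P hdesign ν
  have h2 : ∀ m : Label n, swapCoeff (restrict w m (ν m) O) (restrict w m (ν m) O) *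
        swapCoeff (∑ κ, restrict w m κ S.average) (∑ κ, restrict w m κ S.average) *
        (2 * ((blockDim m : ℂ) * (restrict w m (ν m) (V.gen μ) * restrict w m (ν m) (V.gen μ)).trace -
          (restrict w m (ν m) (V.gen μ)).trace ^ 2)) =
      ((Delta (restrict w m (ν m) O) / ((blockDim m : ℝ) ^ 2 - 1) *
        (Delta (∑ κ, restrict w m κ S.average) / ((blockDim m : ℝ) ^ 2 - 1)) *
        (2 * (blockDim m * Delta (restrict w m (ν m) (V.gen μ)))) : ℝ) : ℂ) := by
    intro m
    have hd : (blockDim m : ℂ) ≠ 0 := Nat.cast_ne_zero.mpr (Nat.succ_ne_zero _)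
    have hσ : (∑ κ, restrict w m κ S.average).IsHermitian := by
      rw [IsHermitian, conjTranspose_sum]
      exact Finset.sum_congr rfl fun κ _ => isHermitian_restrict w m κ S.isHermitian_average
    rw [swapCoeff_self (isHermitian_restrict w m _ (isHermitian_of_mem_measurementSet hO)),
      swapCoeff_self hσ, Complex.ofReal_mul, Complex.ofReal_mul, Complex.ofReal_mul,
      Complex.ofReal_mul, ofReal_delta (isHermitian_restrict w m _
        (isHermitian_of_mem_generatorSet (V.gen_mem μ))), Complex.ofReal_natCast,
      Complex.ofReal_ofNat, mul_sub (blockDim m : ℂ), mul_div_cancel₀ _ hd]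
  rw [Finset.sum_congr rfl fun m _ => h2 m] at h
  exact_mod_cast h

theorem le_variance_partialLoss (w : MultiplicityBasis n) (V : QNN n) {O : Op n}
    (hO : O ∈ measurementSet n) (S : Dataset n) (μ : Fin V.depth) (P : Measure (Fin V.depth → ℝ))
    [IsProbabilityMeasure P] (hdesign : FormsIndependentTwoDesigns w V μ P)
    (ν : ∀ m : Label n, Fin (multiplicity m)) (m : Label n) :
    Delta (restrict w m (ν m) O) / ((blockDim m : ℝ) ^ 2 - 1) *
        (Delta (∑ κ, restrict w m κ S.average) / ((blockDim m : ℝ) ^ 2 - 1)) *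
        (2 * (blockDim m * Delta (restrict w m (ν m) (V.gen μ)))) ≤
      variance (partialLoss V O S μ) P := by
  have hsum := variance_partialLoss_eq_sum_delta w V hO S μ P hdesign ν
  rw [hsum]
  refine Finset.single_le_sum (f := fun m : Label n => Delta (restrict w m (ν m) O) /
    ((blockDim m : ℝ) ^ 2 - 1) * (Delta (∑ κ, restrict w m κ S.average) /
      ((blockDim m : ℝ) ^ 2 - 1)) *
      (2 * (blockDim m * Delta (restrict w m (ν m) (V.gen μ))))) (fun m _ => ?_) (Finset.mem_univ m)
  have hσ : (∑ κ, restrict w m κ S.average).IsHermitian := by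
    rw [IsHermitian, conjTranspose_sum]
    exact Finset.sum_congr rfl fun κ _ => isHermitian_restrict w m κ S.isHermitian_average
  have h1 := delta_nonneg (isHermitian_restrict w m (ν m) (isHermitian_of_mem_measurementSet hO))
  have h2 := delta_nonneg hσ
  have h3 := delta_nonneg (isHermitian_restrict w m (ν m)
    (isHermitian_of_mem_generatorSet (V.gen_mem μ)))
  have h4 : (0 : ℝ) ≤ (blockDim m : ℝ) ^ 2 - 1 := by
    have h5 : (1 : ℝ) ≤ blockDim m := Nat.one_le_cast.mpr (Nat.succ_pos _)
    exact sub_nonneg.mpr (one_le_pow₀ h5)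
  exact mul_nonneg (mul_nonneg (div_nonneg h1 h4) (div_nonneg h2 h4))
    (mul_nonneg zero_le_two (mul_nonneg (Nat.cast_nonneg _) h3))

/-! ### The generators and measurements in a block -/

theorem restrict_pauliX (w : MultiplicityBasis n) (m : Label n) (ν : Fin (multiplicity m)) :
    restrict w m ν (collective n pauliX) = spinRaising m + (spinRaising m)ᴴ := by
  rw [collective_pauliX, restrict_add, restrict_raising, restrict_lowering]

theorem restrict_pauliY (w : MultiplicityBasis n) (m : Label n) (ν : Fin (multiplicity m)) :
    restrict w m ν (collective n pauliY) =
      Complex.I • ((spinRaising m)ᴴ + (-1 : ℂ) • spinRaising m) := by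
  rw [collective_pauliY, restrict_smul, restrict_add, restrict_smul, restrict_raising,
    restrict_lowering]

theorem restrict_twoBody {w : MultiplicityBasis n} {A : Matrix (Fin 2) (Fin 2) ℂ} (hA : A * A = 1)
    (h : IsBlockwise w (collective n A)) (m : Label n) (ν : Fin (multiplicity m)) :
    restrict w m ν (twoBody n A) = (1 / ((n : ℂ) * ((n : ℂ) - 1))) •
      (restrict w m ν (collective n A) * restrict w m ν (collective n A) + (-(n : ℂ)) • 1) := by
  rw [twoBody, pairSum_eq n hA, restrict_smul, restrict_smul, restrict_add, restrict_smul,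
    restrict_mul_of_left h, restrict_one, smul_smul]
  congr 1
  ring

theorem normSq_ladder {N k : ℕ} (hk : k ≤ N) :
    Complex.normSq (ladder N k : ℂ) = ((k : ℝ) + 1) * (N - k) := by
  rw [Complex.normSq_ofReal, ← sq, ladder_sq hk]

theorem spinRaising_apply_zero_one (m : Label n) (h : 1 < blockDim m) :
    spinRaising m 0 ⟨1, h⟩ = (ladder (twiceSpin m) 0 : ℂ) ∧ spinRaising m ⟨1, h⟩ 0 = 0 := by
  constructor <;> simp [spinRaising]

/-- The entry of `∑_j X_j` between the two topmost vectors of a block with twice the spin `N ≥ 1` is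
`√N`. -/
theorem one_div_pow_four_le_delta_oneBodyX (hn : 2 ≤ n) (w : MultiplicityBasis n) (m : Label n)
    (ν : Fin (multiplicity m)) (hd : 2 ≤ blockDim m) :
    1 / (n : ℝ) ^ 4 ≤ Delta (restrict w m ν (oneBody n pauliX)) := by
  have hn' : (2 : ℝ) ≤ n := by exact_mod_cast hn
  have h1 : 1 < blockDim m := hd
  have hN : (1 : ℝ) ≤ twiceSpin m := by
    have := blockDim_eq m
    exact_mod_cast (by omega : 1 ≤ twiceSpin m)
  have hne : (0 : Fin (blockDim m)) ≠ ⟨1, h1⟩ := fun h => by simpa using congrArg Fin.val h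
  refine le_trans ?_ (normSq_le_delta
    (isHermitian_restrict w m ν (isHermitian_oneBody isHermitian_pauliX)) hne)
  obtain ⟨e1, e2⟩ := spinRaising_apply_zero_one m h1
  rw [oneBody, restrict_smul, restrict_pauliX, Matrix.smul_apply, Matrix.add_apply,
    conjTranspose_apply, e1, e2, star_zero, add_zero, smul_eq_mul, Complex.normSq_mul,
    normSq_ladder (Nat.zero_le _), Complex.normSq_div, Complex.normSq_one, Complex.normSq_natCast]
  simp only [Nat.cast_zero, zero_add, sub_zero, one_mul]
  rw [div_mul_eq_mul_div, one_mul, div_le_div_iff₀ (by positivity) (by positivity)]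
  nlinarith [mul_le_mul hN (show (1 : ℝ) ≤ n ^ 2 by nlinarith) (by norm_num) (by linarith),
    sq_nonneg (n : ℝ), mul_nonneg (sq_nonneg (n : ℝ)) (sq_nonneg (n : ℝ))]

theorem one_div_pow_four_le_delta_oneBodyY (hn : 2 ≤ n) (w : MultiplicityBasis n) (m : Label n)
    (ν : Fin (multiplicity m)) (hd : 2 ≤ blockDim m) :
    1 / (n : ℝ) ^ 4 ≤ Delta (restrict w m ν (oneBody n pauliY)) := by
  have hn' : (2 : ℝ) ≤ n := by exact_mod_cast hn
  have h1 : 1 < blockDim m := hd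
  have hN : (1 : ℝ) ≤ twiceSpin m := by
    have := blockDim_eq m
    exact_mod_cast (by omega : 1 ≤ twiceSpin m)
  have hne : (0 : Fin (blockDim m)) ≠ ⟨1, h1⟩ := fun h => by simpa using congrArg Fin.val h
  refine le_trans ?_ (normSq_le_delta
    (isHermitian_restrict w m ν (isHermitian_oneBody isHermitian_pauliY)) hne)
  obtain ⟨e1, e2⟩ := spinRaising_apply_zero_one m h1
  rw [oneBody, restrict_smul, restrict_pauliY, Matrix.smul_apply, Matrix.smul_apply,
    Matrix.add_apply, Matrix.smul_apply,
    conjTranspose_apply, e1, e2, star_zero, zero_add, smul_eq_mul, smul_eq_mul, smul_eq_mul,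
    Complex.normSq_mul, Complex.normSq_mul, Complex.normSq_mul,
    normSq_ladder (Nat.zero_le _), Complex.normSq_div, Complex.normSq_one, Complex.normSq_natCast,
    Complex.normSq_I, Complex.normSq_neg, Complex.normSq_one]
  simp only [Nat.cast_zero, zero_add, sub_zero, one_mul]
  rw [div_mul_eq_mul_div, one_mul, div_le_div_iff₀ (by positivity) (by positivity)]
  nlinarith [mul_le_mul hN (show (1 : ℝ) ≤ n ^ 2 by nlinarith) (by norm_num) (by linarith),
    sq_nonneg (n : ℝ), mul_nonneg (sq_nonneg (n : ℝ)) (sq_nonneg (n : ℝ))]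

/-- The first two diagonal entries of `(∑_j Z_j)²` in a block with twice the spin `N ≥ 2` differ by
`N² - (N - 2)² = 4N - 4`. -/
theorem one_div_pow_four_le_delta_twoBodyZ (hn : 2 ≤ n) (w : MultiplicityBasis n) (m : Label n)
    (ν : Fin (multiplicity m)) (hd : 3 ≤ blockDim m) :
    1 / (n : ℝ) ^ 4 ≤ Delta (restrict w m ν (twoBody n pauliZ)) := by
  have hn' : (2 : ℝ) ≤ n := by exact_mod_cast hn
  have h1 : 1 < blockDim m := by omega
  have hN : (2 : ℝ) ≤ twiceSpin m := by
    have := blockDim_eq m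
    exact_mod_cast (by omega : 2 ≤ twiceSpin m)
  have hne : (0 : Fin (blockDim m)) ≠ ⟨1, h1⟩ := fun h => by simpa using congrArg Fin.val h
  refine le_trans ?_ (sub_sq_le_delta
    (isHermitian_restrict w m ν (isHermitian_twoBody isHermitian_pauliZ pauliZ_mul_self)) hne)
  have hdiag : ∀ k : Fin (blockDim m), (restrict w m ν (twoBody n pauliZ) k k).re =
      1 / (n * ((n : ℝ) - 1)) * (((twiceSpin m : ℝ) - 2 * (k : ℕ)) ^ 2 - n) := by
    intro k
    have : restrict w m ν (twoBody n pauliZ) k k =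
        ((1 / (n * ((n : ℝ) - 1)) * (((twiceSpin m : ℝ) - 2 * (k : ℕ)) ^ 2 - n) : ℝ) : ℂ) := by
      rw [restrict_twoBody pauliZ_mul_self (isBlockwise_pauliZ w), restrict_pauliZ, spinWeight,
        diagonal_mul_diagonal]
      simp only [Matrix.smul_apply, Matrix.add_apply, diagonal_apply_eq, one_apply_eq, smul_eq_mul]
      push_cast
      ring
    rw [this, Complex.ofReal_re]
  rw [hdiag, hdiag, ← mul_sub, mul_pow]
  have h4 : (4 : ℝ) ≤ ((twiceSpin m : ℝ) - 2 * ((0 : Fin (blockDim m)) : ℕ)) ^ 2 - n -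
      (((twiceSpin m : ℝ) - 2 * ((⟨1, h1⟩ : Fin (blockDim m)) : ℕ)) ^ 2 - n) := by
    simp only [Fin.val_zero, Nat.cast_zero, Nat.cast_one]
    nlinarith
  have h5 : 1 / (n : ℝ) ^ 2 ≤ 1 / (n * ((n : ℝ) - 1)) := by
    apply one_div_le_one_div_of_le <;> nlinarith
  have h6 : (1 / (n : ℝ) ^ 2) ^ 2 ≤ (1 / (n * ((n : ℝ) - 1))) ^ 2 :=
    pow_le_pow_left₀ (by positivity) h5 2
  have h7 : (1 / (n : ℝ) ^ 2) ^ 2 = 1 / (n : ℝ) ^ 4 := by rw [div_pow, one_pow, ← pow_mul]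
  rw [h7] at h6
  have h8 : (0 : ℝ) ≤ 1 / (n : ℝ) ^ 4 := by positivity
  have h9 := pow_le_pow_left₀ (by norm_num) h4 2
  nlinarith [mul_le_mul h6 h9 (by norm_num) (h8.trans h6)]

/-- The entry of `(∑_j X_j)²` between the first and the third vector of a block with twice the spin
`N ≥ 2` is `√(2 N (N - 1))`. -/
theorem one_div_pow_four_le_delta_twoBodyX (hn : 2 ≤ n) (w : MultiplicityBasis n) (m : Label n)
    (ν : Fin (multiplicity m)) (hd : 3 ≤ blockDim m) :
    1 / (n : ℝ) ^ 4 ≤ Delta (restrict w m ν (twoBody n pauliX)) := by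
  have hn' : (2 : ℝ) ≤ n := by exact_mod_cast hn
  have h1 : 1 < blockDim m := by omega
  have h2 : 2 < blockDim m := hd
  have hN' : 2 ≤ twiceSpin m := by
    have := blockDim_eq m
    omega
  have hN : (2 : ℝ) ≤ twiceSpin m := by exact_mod_cast hN'
  have hne : (0 : Fin (blockDim m)) ≠ ⟨2, h2⟩ := fun h => by simpa using congrArg Fin.val h
  refine le_trans ?_ (normSq_le_delta
    (isHermitian_restrict w m ν (isHermitian_twoBody isHermitian_pauliX pauliX_mul_self)) hne)
  have hentry : ((spinRaising m + (spinRaising m)ᴴ) * (spinRaising m + (spinRaising m)ᴴ)) 0 ⟨2, h2⟩ =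
      (ladder (twiceSpin m) 0 : ℂ) * (ladder (twiceSpin m) 1 : ℂ) := by
    rw [mul_apply, Finset.sum_eq_single ⟨1, h1⟩]
    · simp [spinRaising]
    · intro k _ hk
      have : ¬ (k : ℕ) = 1 := fun h => hk (Fin.ext h)
      simp [spinRaising, this]
    · simp
  rw [restrict_twoBody pauliX_mul_self (isBlockwise_pauliX w), restrict_pauliX, Matrix.smul_apply,
    Matrix.add_apply, hentry, Matrix.smul_apply, one_apply_ne hne, smul_zero, add_zero, smul_eq_mul,
    Complex.normSq_mul, Complex.normSq_mul, normSq_ladder (Nat.zero_le _),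
    normSq_ladder (by omega)]
  have h3 : Complex.normSq (1 / ((n : ℂ) * ((n : ℂ) - 1))) = (1 / (n * ((n : ℝ) - 1))) ^ 2 := by
    have : (1 / ((n : ℂ) * ((n : ℂ) - 1))) = ((1 / (n * ((n : ℝ) - 1)) : ℝ) : ℂ) := by
      push_cast; rfl
    rw [this, Complex.normSq_ofReal, sq]
  have h5 : 1 / (n : ℝ) ^ 2 ≤ 1 / (n * ((n : ℝ) - 1)) := by
    apply one_div_le_one_div_of_le <;> nlinarith
  have h6 : (1 / (n : ℝ) ^ 2) ^ 2 ≤ (1 / (n * ((n : ℝ) - 1))) ^ 2 :=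
    pow_le_pow_left₀ (by positivity) h5 2
  have h7 : (1 / (n : ℝ) ^ 2) ^ 2 = 1 / (n : ℝ) ^ 4 := by rw [div_pow, one_pow, ← pow_mul]
  rw [h7] at h6
  rw [h3]
  refine h6.trans (le_mul_of_one_le_right (sq_nonneg _) ?_)
  push_cast
  nlinarith

/-- `∏_j X_j` reverses the weights, so in a block it maps the top vector to a multiple of the bottom
one; being an involution, it has an entry of modulus one there. -/
theorem one_div_pow_four_le_delta_tensorPower (hn : 2 ≤ n) (w : MultiplicityBasis n) (m : Label n)
    (ν : Fin (multiplicity m)) (hd : 2 ≤ blockDim m) :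
    1 / (n : ℝ) ^ 4 ≤ Delta (restrict w m ν (tensorPower n pauliX)) := by
  have hn' : (2 : ℝ) ≤ n := by exact_mod_cast hn
  have hP : IsBlockwise w (tensorPower n pauliX) :=
    isBlockwise_of_mem_measurementSet w (Or.inr (Or.inr rfl))
  have hH := isHermitian_restrict w m ν (isHermitian_tensorPower (n := n) isHermitian_pauliX)
  set p := restrict w m ν (tensorPower n pauliX) with hp
  have hpp : p * p = 1 := by
    rw [hp, ← restrict_mul_of_left hP, tensorPower_pauliX_mul_self, restrict_one]
  have hpz : p * spinWeight m = (-1 : ℂ) • (spinWeight m * p) := by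
    rw [hp, ← restrict_pauliZ w m ν, ← restrict_mul_of_left hP, tensorPower_pauliX_mul_pauliZ,
      restrict_smul, restrict_mul_of_left (isBlockwise_pauliZ w)]
  have hlast : twiceSpin m < blockDim m := Nat.lt_succ_self _
  have hN : 1 ≤ twiceSpin m := by
    have := blockDim_eq m
    omega
  have hzero : ∀ k : Fin (blockDim m), k ≠ ⟨twiceSpin m, hlast⟩ → p 0 k = 0 := by
    intro k hk
    have h1 := congrFun (congrFun hpz 0) k
    rw [spinWeight, mul_diagonal, Matrix.smul_apply, diagonal_mul, smul_eq_mul] at h1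
    have h2 : (2 * ((twiceSpin m : ℂ) - (k : ℕ))) * p 0 k = 0 := by
      simp only [Fin.val_zero, Nat.cast_zero] at h1
      linear_combination h1
    refine (mul_eq_zero.mp h2).resolve_left ?_
    intro h3
    have h4 : ((twiceSpin m : ℕ) : ℂ) = (k : ℕ) := by linear_combination h3 / 2
    exact hk (Fin.ext (by exact_mod_cast h4.symm))
  have hne : (0 : Fin (blockDim m)) ≠ ⟨twiceSpin m, hlast⟩ := fun h => by
    have := congrArg Fin.val h
    simp only [Fin.val_zero] at this
    omega
  have hone := congrFun (congrFun hpp 0) 0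
  rw [mul_apply, Finset.sum_eq_single ⟨twiceSpin m, hlast⟩ (fun k _ hk => by
    rw [hzero k hk, zero_mul]) (by simp), one_apply_eq, ← hH.apply _ 0, Complex.star_def,
    Complex.mul_conj] at hone
  have hnorm : Complex.normSq (p 0 ⟨twiceSpin m, hlast⟩) = 1 := by exact_mod_cast hone
  refine le_trans ?_ (normSq_le_delta hH hne)
  rw [hnorm, div_le_one (by positivity)]
  exact one_le_pow₀ (by linarith)

theorem one_div_pow_four_le_delta_of_mem_generatorSet (hn : 2 ≤ n) (w : MultiplicityBasis n)
    {H : Op n} (hH : H ∈ generatorSet n) (m : Label n) (ν : Fin (multiplicity m))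
    (hd : 2 ≤ blockDim m) (hd3 : H = twoBody n pauliZ → 3 ≤ blockDim m) :
    1 / (n : ℝ) ^ 4 ≤ Delta (restrict w m ν H) := by
  rcases hH with rfl | rfl | rfl
  · exact one_div_pow_four_le_delta_oneBodyX hn w m ν hd
  · exact one_div_pow_four_le_delta_oneBodyY hn w m ν hd
  · exact one_div_pow_four_le_delta_twoBodyZ hn w m ν (hd3 rfl)

theorem one_div_pow_four_le_delta_of_mem_measurementSet (hn : 2 ≤ n) (w : MultiplicityBasis n)
    {O : Op n} (hO : O ∈ measurementSet n) (m : Label n) (ν : Fin (multiplicity m))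
    (hd : 2 ≤ blockDim m) (hd3 : O = twoBody n pauliX → 3 ≤ blockDim m) :
    1 / (n : ℝ) ^ 4 ≤ Delta (restrict w m ν O) := by
  rcases hO with rfl | rfl | rfl
  · exact one_div_pow_four_le_delta_oneBodyX hn w m ν hd
  · exact one_div_pow_four_le_delta_twoBodyX hn w m ν (hd3 rfl)
  · exact one_div_pow_four_le_delta_tensorPower hn w m ν hd

/-! ### Asymptotics -/

/-- The summand of a block in the variance, with `x` the number of qubits, `D` the dimension of the
block and `D² - 1 ≤ 4 x²`. -/
theorem div_le_variance_summand {x D a h s : ℝ} (hx : 2 ≤ x) (hD : 2 ≤ D) (hDx : D ≤ 2 * x)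
    (ha : 1 / x ^ 4 ≤ a) (hh : 1 / x ^ 4 ≤ h) (hs : 0 ≤ s) :
    s / (16 * x ^ 12) ≤ a / (D ^ 2 - 1) * (s / (D ^ 2 - 1)) * (2 * (D * h)) := by
  have hE0 : 0 < D ^ 2 - 1 := by nlinarith
  have hE : D ^ 2 - 1 ≤ 4 * x ^ 2 := by nlinarith
  have hEinv : 1 / (4 * x ^ 2) ≤ 1 / (D ^ 2 - 1) := one_div_le_one_div_of_le hE0 hE
  have hx0 : 0 < 1 / x ^ 4 := by positivity
  have hx1 : 0 < 1 / (4 * x ^ 2) := by positivity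
  have ha0 := hx0.le.trans ha
  have hE1 := hx1.le.trans hEinv
  have h1 : 1 / x ^ 4 ≤ 2 * (D * h) := by nlinarith
  calc s / (16 * x ^ 12) =
        (1 / x ^ 4 * (1 / (4 * x ^ 2))) * (s * (1 / (4 * x ^ 2))) * (1 / x ^ 4) := by
        field_simp
        norm_num
    _ ≤ (a * (1 / (D ^ 2 - 1))) * (s * (1 / (D ^ 2 - 1))) * (2 * (D * h)) :=
        mul_le_mul (mul_le_mul (mul_le_mul ha hEinv hx1.le ha0)
          (mul_le_mul_of_nonneg_left hEinv hs) (mul_nonneg hs hx1.le) (mul_nonneg ha0 hE1)) h1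
          hx0.le (mul_nonneg (mul_nonneg ha0 hE1) (mul_nonneg hs hE1))
    _ = a / (D ^ 2 - 1) * (s / (D ^ 2 - 1)) * (2 * (D * h)) := by ring

/-- A polynomial lower bound on the variance of the partial derivative, for a fixed number of
qubits, in terms of one block on which `Δ` of the averaged data does not vanish. -/
theorem delta_div_le_variance (hn : 2 ≤ n) (w : MultiplicityBasis n) (V : QNN n) {O : Op n}
    (hO : O ∈ measurementSet n) (S : Dataset n) (μ : Fin V.depth) (P : Measure (Fin V.depth → ℝ))
    [IsProbabilityMeasure P] (hdesign : FormsIndependentTwoDesigns w V μ P) (m : Label n)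
    (hm : V.gen μ = twoBody n pauliZ ∨ O = twoBody n pauliX → 3 ≤ blockDim m)
    (hσ : 0 < Delta (∑ κ, restrict w m κ S.average)) :
    Delta (∑ κ, restrict w m κ S.average) / (16 * (n : ℝ) ^ 12) ≤
      variance (partialLoss V O S μ) P := by
  have hd : 2 ≤ blockDim m := by
    -- On a one-dimensional block `Δ` vanishes identically.
    by_contra hc
    have : blockDim m = 1 := by
      have := blockDim_eq m
      omega
    rw [delta_eq_zero_of_dim_one this] at hσ
    exact lt_irrefl _ hσ
  let ν : ∀ m : Label n, Fin (multiplicity m) := fun m => ⟨0, multiplicity_pos m⟩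
  refine le_trans ?_ (le_variance_partialLoss w V hO S μ P hdesign ν m)
  have h1 := one_div_pow_four_le_delta_of_mem_measurementSet hn w hO m (ν m) hd
    fun h => hm (Or.inr h)
  have h2 := one_div_pow_four_le_delta_of_mem_generatorSet hn w (V.gen_mem μ) m (ν m) hd
    fun h => hm (Or.inl h)
  have hn' : (2 : ℝ) ≤ n := by exact_mod_cast hn
  have hD : (2 : ℝ) ≤ blockDim m := Nat.ofNat_le_cast.mpr hd
  have h3 : blockDim m ≤ n + 1 := Nat.succ_le_succ (Nat.sub_le _ _)
  have hDn : (blockDim m : ℝ) ≤ 2 * n := by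
    have h4 : ((blockDim m : ℕ) : ℝ) ≤ ((2 * n : ℕ) : ℝ) := Nat.cast_le.mpr (by omega)
    rwa [Nat.cast_mul, Nat.cast_ofNat] at h4
  exact div_le_variance_summand hn' hD hDn h1 h2 hσ.le

theorem not_isBarrenPlateau_of_isOmegaInvPoly {Θ : ℕ → Type*} [∀ n, MeasurableSpace (Θ n)]
    {P : ∀ n, Measure (Θ n)} {g : ∀ n, Θ n → ℝ}
    (h : IsOmegaInvPoly fun n => variance (g n) (P n)) : ¬ IsBarrenPlateau P g := by
  rintro ⟨-, b, hb, hO⟩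
  obtain ⟨C, hC, k, hk⟩ := h
  obtain ⟨c, hc⟩ := hO.bound
  have hlim : Tendsto (fun n : ℕ => c * ((n : ℝ) ^ k / b ^ n)) atTop (nhds 0) := by
    simpa using (tendsto_pow_const_div_const_pow_of_one_lt k hb).const_mul c
  obtain ⟨n, h1, h2, h3, h4⟩ := ((hlim.eventually (gt_mem_nhds hC)).and
    (hk.and (hc.and (eventually_gt_atTop 0)))).exists
  have hn : (0 : ℝ) < n := by exact_mod_cast h4
  have hbn : 0 < b ^ n := pow_pos (by linarith) n
  have h5 : C / (n : ℝ) ^ k ≤ c * (b ^ n)⁻¹ := by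
    refine h2.trans ((le_abs_self _).trans ?_)
    simpa [abs_of_pos (show 0 < b by linarith)] using h3
  rw [div_le_iff₀ (by positivity)] at h5
  have h6 : c * (b ^ n)⁻¹ * (n : ℝ) ^ k = c * ((n : ℝ) ^ k / b ^ n) := by ring
  linarith

end LowerBounds

end SnEquivariant

theorem corollary1
    (w : ∀ n : ℕ, MultiplicityBasis n)
    (V : ∀ n : ℕ, QNN n)
    (O : ∀ n : ℕ, Op n) (hO : ∀ n, O n ∈ measurementSet n)
    (S : ∀ n : ℕ, Dataset n)
    (μ : ∀ n : ℕ, Fin (V n).depth)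
    (P : ∀ n : ℕ, Measure (Fin (V n).depth → ℝ)) (hP : ∀ n, IsProbabilityMeasure (P n))
    (hdesign : ∀ᶠ n in atTop, FormsIndependentTwoDesigns (w n) (V n) (μ n) (P n))
    (m : ∀ n : ℕ, Label n)
    (hm : ∀ᶠ n in atTop,
      (V n).gen (μ n) = twoBody n pauliZ ∨ O n = twoBody n pauliX → 3 ≤ blockDim (m n))
    (hσ : IsOmegaInvPoly fun n =>
      Delta (∑ ν : Fin (multiplicity (m n)), restrict (w n) (m n) ν (S n).average)) :
    IsOmegaInvPoly (fun n => variance (partialLoss (V n) (O n) (S n) (μ n)) (P n)) ∧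
      ¬ IsBarrenPlateau P (fun n => partialLoss (V n) (O n) (S n) (μ n)) := by
  have key : IsOmegaInvPoly
      (fun n => variance (partialLoss (V n) (O n) (S n) (μ n)) (P n)) := by
    obtain ⟨C, hC, k, hk⟩ := hσ
    refine ⟨C / 16, by positivity, k + 12, ?_⟩
    filter_upwards [hdesign, hm, hk, eventually_ge_atTop 2] with n h1 h2 h3 h4
    have hn : (0 : ℝ) < n := by exact_mod_cast (by omega : 0 < n)
    have := hP n
    refine le_trans ?_ (delta_div_le_variance h4 (w n) (V n) (hO n) (S n) (μ n) (P n) h1 (m n) h2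
      (lt_of_lt_of_le (by positivity) h3))
    calc C / 16 / (n : ℝ) ^ (k + 12) = C / (n : ℝ) ^ k / (16 * (n : ℝ) ^ 12) := by
          rw [pow_add]
          field_simp
      _ ≤ _ := by gcongr
  exact ⟨key, not_isBarrenPlateau_of_isOmegaInvPoly key⟩
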